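/- **Setting.** Let $n\ge 1$, let $\mathbb Z^n$ have the componentwise order and let $I=D(\mathbb Z^n)$ be its lattice of downsets, with minimum $-\infty=\emptyset$ and maximum $\infty=\mathbb Z^n$. An *exact couple system* $E$ over $I$ consists of abelian groups $E^p_q$ ($q\le p$ in $I$), homomorphisms $\ell:E^p_q\to E^{p'}_{q'}$ for $p\le p'$, $q\le q'$, with $\ell\circ\ell=\ell$, and homomorphisms $k:E^p_q\to E^q_{-\infty}$ such that $k\circ \ell=\ell\circ k$ and the triangles $E^q_{-\infty}\xrightarrow{\ell}E^p_{-\infty}\xrightarrow{\ell}E^p_q\xrightarrow{k}E^q_{-\infty}$ are exact. It is *excisive* if $\ell:E^a_{a\cap b}\to E^{a\cup b}_b$ is an isomorphism for all $a,b\in I$. For $z\le q\le p\le b$ put $d_{pqz}:E^p_q\xrightarrow{k}E^q_{-\infty}\xrightarrow{\ell}E^q_z$ and $S^{pz}_{bq}=\ker(d_{pqz})/\operatorname{im}(d_{bpq}:E^b_p\to E^p_q)$. If moreover $z'\le q'\le p'\le b'$, $z\le p'$ and $q\le b'$, the *differential of the spectral system* $S^{pz}_{bq}\to S^{p'z'}_{b'q'}$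 is the map induced by $E^p_z\xrightarrow{k}E^z_{-\infty}\xrightarrow{\ell}E^{p'}_{z'}$ via the surjections $E^p_z\to S^{pz}_{bq}$ and $E^{p'}_{z'}\to S^{p'z'}_{b'q'}$ induced by $\ell$. "Natural" means natural with respect to morphisms of excisive exact couple systems (families of homomorphisms commuting with $\ell$ and $k$). View subsets of $\mathbb Z^n$ as graphs in which distinct comparable elements are adjacent. Let $Z(z,q,p,b)$ be the union of the connected components of $p\setminus z$ meeting $p\setminus q$, and $B(z,q,p,b)$ the union of the connected components of $b\setminus q$ meeting $p\setminus q$. *Words.* A finite word $\omega$ over $\{1,\dots,n,1^\infty,\dots,n^\infty,\mathrm{ext}\}$ is *admissible* if after a letter $j^\infty$ neither $j$ nor $j^\infty$ appears, the only letter allowed directly after $j^\infty$ is $\mathrm{ext}$, and each $\mathrm{ext}$ comes directly after some $j^\infty$. Let $X(\omega)$ be the set of $j$ such that $j^\infty\,\mathrm{ext}$ is a subword of $\omega$; an admissible $\omega$ is *final* if $X(\omega)=\{1,\dots,n\}$. Let $\varepsilon$ be the empty word and $*$ concatenation. Define $a^i_\omega,\delta^i_\omega\in\mathbb Z^n$,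 $B_\omega\subseteq\mathbb Z^n$ and the subgroup $V_\omega\subseteq\mathbb Z^n$ recursively: $a^i_\varepsilon=\delta^i_\varepsilon=e_i$, $B_\varepsilon=\{0\}$, $V_\varepsilon=0$; $a^j_{\omega*j}=a^j_\omega+\delta^j_\omega$ and $a^i_{\omega*j}=a^i_\omega$ for $i\ne j$; $\delta^i_{\omega*j}=\delta^i_\omega$ if $i\in X(\omega)\cup\{j\}$ and $\delta^i_{\omega*j}=\delta^i_\omega-\delta^j_\omega$ otherwise; the letters $j^\infty$ and $\mathrm{ext}$ do not change $a^i,\delta^i$; $B_{\omega*j}=B_\omega+\{0,\delta^j_\omega\}$, $B_{\omega*j^\infty}=B_\omega+\mathbb Z_{\ge0}\,\delta^j_\omega$, $B_{\omega*j^\infty\mathrm{ext}}=B_\omega+\mathbb Z\,\delta^j_\omega$; $V_{\omega*j}=V_{\omega*j^\infty}=V_\omega$, $V_{\omega*j^\infty\mathrm{ext}}=V_\omega+\mathbb Z\,\delta^j_\omega$. Put $Z_\omega=-B_\omega$. For $P\in\mathbb Z^n$, say that $(b,p,q,z)$ *represents* $S(P;\omega)$ if $Z(z,q,p,b)=P+Z_\omega$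 and $B(z,q,p,b)=P+B_\omega$, and then let $S(P;\omega)$ denote $S^{pz}_{bq}$. **Theorem.** For all admissible $\omega$ and $P\in\mathbb Z^n$ there is $(b,p,q,z)$, independent of $E$, representing $S(P;\omega)$; any two such choices give naturally isomorphic groups, and the set of choices depends only on $P$ modulo $V_\omega$. Thus $S(P;\omega)$ is well defined up to natural isomorphism for $P\in\mathbb Z^n/V_\omega$ and every excisive exact couple system $E$ over $D(\mathbb Z^n)$. Moreover: (a) $S(P;\varepsilon)\cong E^p_q$ naturally, for any downsets $p,q$ with $p=q\,\dot\cup\,\{P\}$. (b) If $\omega$ is final, then $V_\omega=\mathbb Z^n$ and $S(P;\omega)\cong E^{\infty}_{-\infty}$ naturally. Let in addition $\omega$ be admissible, $P\in\mathbb Z^n/V_\omega$, and $j\in\{1,\dots,n\}$ such that $\omega*j$ is admissible. Then: (c) There are natural differentials $$\dots\xrightarrow{d}S(P+a^j_\omega;\omega)\xrightarrow{d}S(P;\omega)\xrightarrow{d}S(P-a^j_\omega;\omega)\xrightarrow{d}\dots,\qquad d\circ d=0,$$ namely the differentials of the spectral system for suitable representatives, and the homology at $S(P;\omega)$ is naturally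 isomorphic to $S(P;\omega*j)$. (d) $S(P;\omega*j^\infty)$ is a natural subquotient of $S(P;\omega*j^k)$ for all $k\ge0$, where $j^k$ denotes $k$ letters $j$. (e) There is a natural filtration $(F_i)_{i\in\mathbb Z}$ of $S(P;\omega*j^\infty\,\mathrm{ext})$ with $F_{i}\subseteq F_{i+1}$ for all $i$, such that $F_i/F_{i-1}\cong S(P+i\,\delta^j_\omega;\omega*j^\infty)$ naturally for all $i\in\mathbb Z$. -/

import Mathlib

open CategoryTheory CategoryTheory.Limits
open scoped Pointwise

universe u v

/-! ### Exact couple systems -/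

/-- An exact couple system over a poset `I` with minimum `⊥`: abelian groups `E^p_q = obj p q` for
`q ≤ p`, maps `ℓ` and `k`, such that the `ℓ` compose, the triangles
`E^q_⊥ → E^p_⊥ → E^p_q → E^q_⊥ → E^p_⊥` are exact, and `k` commutes with `ℓ`. -/
structure ExactCoupleSystem (I : Type v) [PartialOrder I] [OrderBot I] : Type (max v (u + 1)) where
  /-- the group `E^p_q` -/
  obj : ∀ (p q : I), q ≤ p → Type u
  /-- its group structure -/
  grp : ∀ (p q : I) (h : q ≤ p), AddCommGroup (obj p q h)
  /-- the map `E^p_q → E^{p'}_{q'}` for `(p, q) ≤ (p', q')` -/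
  ℓ : ∀ {p q p' q' : I} (h : q ≤ p) (h' : q' ≤ p') (_ : p ≤ p') (_ : q ≤ q'),
    obj p q h →+ obj p' q' h'
  /-- the map `E^p_q → E^q_⊥` -/
  k : ∀ {p q : I} (h : q ≤ p), obj p q h →+ obj q ⊥ bot_le
  ℓ_ℓ : ∀ {p q p' q' p'' q'' : I} (h : q ≤ p) (h' : q' ≤ p') (h'' : q'' ≤ p'')
    (hp : p ≤ p') (hq : q ≤ q') (hp' : p' ≤ p'') (hq' : q' ≤ q'') (x : obj p q h),
    ℓ h' h'' hp' hq' (ℓ h h' hp hq x) = ℓ h h'' (hp.trans hp') (hq.trans hq') x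
  exact_ℓ_ℓ : ∀ {p q : I} (h : q ≤ p),
    Function.Exact (ℓ (bot_le : ⊥ ≤ q) (bot_le : ⊥ ≤ p) h le_rfl)
      (ℓ (bot_le : ⊥ ≤ p) h le_rfl bot_le)
  exact_ℓ_k : ∀ {p q : I} (h : q ≤ p),
    Function.Exact (ℓ (bot_le : ⊥ ≤ p) h le_rfl bot_le) (k h)
  exact_k_ℓ : ∀ {p q : I} (h : q ≤ p),
    Function.Exact (k h) (ℓ (bot_le : ⊥ ≤ q) (bot_le : ⊥ ≤ p) h le_rfl)
  ℓ_k : ∀ {p q p' q' : I} (h : q ≤ p) (h' : q' ≤ p') (hp : p ≤ p') (hq : q ≤ q')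
    (x : obj p q h),
    ℓ (bot_le : ⊥ ≤ q) (bot_le : ⊥ ≤ q') hq le_rfl (k h x) = k h' (ℓ h h' hp hq x)

attribute [instance] ExactCoupleSystem.grp

namespace ExactCoupleSystem

section

variable {I : Type v} [PartialOrder I] [OrderBot I]

/-- A morphism of exact couple systems: homomorphisms `E^p_q → F^p_q` that commute with all `ℓ`
and `k`. -/
@[ext]
structure Hom (E F : ExactCoupleSystem.{u} I) where
  /-- the components -/
  app : ∀ (p q : I) (h : q ≤ p), E.obj p q h →+ F.obj p q h
  app_ℓ : ∀ {p q p' q' : I} (h : q ≤ p) (h' : q' ≤ p') (hp : p ≤ p') (hq : q ≤ q')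
    (x : E.obj p q h), app p' q' h' (E.ℓ h h' hp hq x) = F.ℓ h h' hp hq (app p q h x)
  app_k : ∀ {p q : I} (h : q ≤ p) (x : E.obj p q h),
    app q ⊥ bot_le (E.k h x) = F.k h (app p q h x)

instance : Category (ExactCoupleSystem.{u} I) where
  Hom := Hom
  id E :=
    { app := fun _ _ _ => AddMonoidHom.id _
      app_ℓ := fun _ _ _ _ _ => rfl
      app_k := fun _ _ => rfl }
  comp f g :=
    { app := fun p q h => (g.app p q h).comp (f.app p q h)
      app_ℓ := fun h h' hp hq x => by simp [f.app_ℓ, g.app_ℓ]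
      app_k := fun h x => by simp [f.app_k, g.app_k] }

/-- The functor `E ↦ E^p_q`. -/
def objFunctor (p q : I) (h : q ≤ p) : ExactCoupleSystem.{u} I ⥤ AddCommGrpCat.{u} where
  obj E := AddCommGrpCat.of (E.obj p q h)
  map f := AddCommGrpCat.ofHom (Hom.app f p q h)
  map_id _ := rfl
  map_comp _ _ := rfl

/-- The differential `d_{pqz} : E^p_q → E^q_z`, for `z ≤ q ≤ p`. -/
def d (E : ExactCoupleSystem.{u} I) {p q z : I} (hq : q ≤ p) (hz : z ≤ q) :
    E.obj p q hq →+ E.obj q z hz :=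
  (E.ℓ (bot_le : ⊥ ≤ q) hz le_rfl bot_le).comp (E.k hq)

lemma app_d {E F : ExactCoupleSystem.{u} I} (f : E ⟶ F) {p q z : I} (hq : q ≤ p) (hz : z ≤ q)
    (x : E.obj p q hq) : Hom.app f q z hz (E.d hq hz x) = F.d hq hz (Hom.app f p q hq x) := by
  simp only [d, AddMonoidHom.comp_apply]
  rw [Hom.app_ℓ, Hom.app_k]

/-- Elements in the image of `E^p_z → E^p_q` are cycles for `d_{pqz}`. -/
lemma d_ℓ (E : ExactCoupleSystem.{u} I) {p q z : I} (hq : q ≤ p) (hz : z ≤ q)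
    (x : E.obj p z (hz.trans hq)) :
    E.d hq hz (E.ℓ (hz.trans hq) hq le_rfl hz x) = 0 := by
  simp only [d, AddMonoidHom.comp_apply]
  rw [← E.ℓ_k (hz.trans hq) hq le_rfl hz x]
  exact (E.exact_ℓ_ℓ hz _).2 ⟨_, rfl⟩

end

/-- The excision property: `E^a_{a ⊓ b} → E^{a ⊔ b}_b` is an isomorphism for all `a`, `b`. -/
def Excisive {I : Type v} [Lattice I] [OrderBot I] (E : ExactCoupleSystem.{u} I) : Prop :=
  ∀ a b : I, Function.Bijective
    (E.ℓ (inf_le_left : a ⊓ b ≤ a) (le_sup_right : b ≤ a ⊔ b) le_sup_left inf_le_right)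

end ExactCoupleSystem

/-! ### Spectral systems -/

/-- The set `I_4` of all `(b, p, q, z)` with `z ≤ q ≤ p ≤ b`. -/
structure Quad (I : Type v) [PartialOrder I] where
  /-- the largest entry -/
  b : I
  /-- the second largest entry -/
  p : I
  /-- the second smallest entry -/
  q : I
  /-- the smallest entry -/
  z : I
  hpb : p ≤ b
  hqp : q ≤ p
  hzq : z ≤ q

namespace ExactCoupleSystem

variable {I : Type v} [PartialOrder I] [OrderBot I]

/-- `im (d_{bpq} : E^b_p → E^p_q)`, as a subgroup of `ker (d_{pqz} : E^p_q → E^q_z)`. -/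
def boundaries (E : ExactCoupleSystem.{u} I) (x : Quad I) :
    AddSubgroup (E.d x.hqp x.hzq).ker :=
  (E.d x.hpb x.hqp).range.addSubgroupOf (E.d x.hqp x.hzq).ker

/-- The `S`-term
`S^{pz}_{bq} = ker (d_{pqz} : E^p_q → E^q_z) / im (d_{bpq} : E^b_p → E^p_q)`. -/
abbrev S (E : ExactCoupleSystem.{u} I) (x : Quad I) : Type u :=
  (E.d x.hqp x.hzq).ker ⧸ E.boundaries x

/-- The map `ker d_{pqz} → ker d_{pqz}` induced by a morphism of exact couple systems. -/
def Hom.kerMap {E F : ExactCoupleSystem.{u} I} (f : E ⟶ F) (x : Quad I) :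
    (E.d x.hqp x.hzq).ker →+ (F.d x.hqp x.hzq).ker :=
  ((Hom.app f x.p x.q x.hqp).comp (AddSubgroup.subtype _)).codRestrict _ fun y => by
    have hy : E.d x.hqp x.hzq y.1 = 0 := y.2
    show F.d x.hqp x.hzq (Hom.app f x.p x.q x.hqp y.1) = 0
    rw [← app_d, hy, map_zero]

lemma Hom.boundaries_le {E F : ExactCoupleSystem.{u} I} (f : E ⟶ F) (x : Quad I) :
    E.boundaries x ≤ (F.boundaries x).comap (Hom.kerMap f x) := by
  rintro y ⟨w, hw⟩
  refine ⟨Hom.app f x.b x.p x.hpb w, ?_⟩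
  rw [← app_d, hw]
  rfl

/-- The functor `E ↦ S^{pz}_{bq}` on exact couple systems. -/
def SFunctor (x : Quad I) : ExactCoupleSystem.{u} I ⥤ AddCommGrpCat.{u} where
  obj E := AddCommGrpCat.of (E.S x)
  map f := AddCommGrpCat.ofHom
    (QuotientAddGroup.map _ _ (Hom.kerMap f x) (Hom.boundaries_le f x))
  map_id E := by
    ext y
    rfl
  map_comp f g := by
    ext y
    rfl

/-- The (surjective) map `E^p_z → S^{pz}_{bq}` that sends `ξ` to the class of the image of `ξ`
in `E^p_q`. -/
def toS (E : ExactCoupleSystem.{u} I) (x : Quad I) :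
    E.obj x.p x.z (x.hzq.trans x.hqp) →+ E.S x :=
  (QuotientAddGroup.mk' (E.boundaries x)).comp
    ((E.ℓ (x.hzq.trans x.hqp) x.hqp le_rfl x.hzq).codRestrict (E.d x.hqp x.hzq).ker
      (E.d_ℓ x.hqp x.hzq))

end ExactCoupleSystem

/-! ### Excisive exact couple systems over the lattice of downsets of `ℤⁿ` -/

/-- `ℤⁿ` with the componentwise order. -/
abbrev Zn (n : ℕ) : Type := Fin n → ℤ

/-- The lattice `D(ℤⁿ)` of downsets of `ℤⁿ`; here `⊥ = ∅` and `⊤ = ℤⁿ`. -/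
abbrev Downsets (n : ℕ) : Type := LowerSet (Zn n)

/-- The category of excisive exact couple systems over `D(ℤⁿ)`. -/
abbrev ExcisiveSystems (n : ℕ) : Type (u + 1) :=
  ObjectProperty.FullSubcategory
    (fun E : ExactCoupleSystem.{u} (Downsets n) => E.Excisive)

/-- The functor `E ↦ E^p_q` on excisive exact couple systems. -/
abbrev entry {n : ℕ} (p q : Downsets n) (h : q ≤ p) :
    ExcisiveSystems.{u} n ⥤ AddCommGrpCat.{u} :=
  ObjectProperty.ι _ ⋙ ExactCoupleSystem.objFunctor p q h

/-- The functor `E ↦ S^{pz}_{bq}` on excisive exact couple systems. Natural maps between `S`-terms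
are morphisms between such functors. -/
abbrev Sterm {n : ℕ} (x : Quad (Downsets n)) : ExcisiveSystems.{u} n ⥤ AddCommGrpCat.{u} :=
  ObjectProperty.ι _ ⋙ ExactCoupleSystem.SFunctor x

/-- A natural map `S^{pz}_{bq} → S^{p'z'}_{b'q'}` (where `z ≤ p'`, `q ≤ b'`) is the differential
of the spectral system if it is induced by the composition
`E^p_z → E^z_⊥ → E^{p'}_⊥ → E^{p'}_{z'}` of `k` and maps `ℓ`. As `E^p_z → S^{pz}_{bq}` is
surjective, there is at most one such map. -/
def IsSpectralDifferential {n : ℕ} (x y : Quad (Downsets n))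
    (η : Sterm.{u} x ⟶ Sterm.{u} y) : Prop :=
  ∃ (hz : x.z ≤ y.p) (_ : x.q ≤ y.b), ∀ (E : ExcisiveSystems.{u} n)
    (ξ : E.obj.obj x.p x.z (x.hzq.trans x.hqp)),
    (η.app E).hom (E.obj.toS x ξ) =
      E.obj.toS y (E.obj.ℓ bot_le (y.hzq.trans y.hqp) hz bot_le
        (E.obj.k (x.hzq.trans x.hqp) ξ))

/-- `F` is a natural subquotient of `G`: a quotient of a subfunctor of `G`. -/
def IsNaturalSubquotient {C D : Type*} [Category C] [Category D] (F G : C ⥤ D) : Prop :=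
  ∃ (M : C ⥤ D) (i : M ⟶ G) (π : M ⟶ F), Mono i ∧ Epi π

/-! ### The sets `Z(z,q,p,b)` and `B(z,q,p,b)` -/

/-- The graph on `ℤⁿ` in which two different elements are adjacent iff they are comparable. -/
def comparabilityGraph (n : ℕ) : SimpleGraph (Zn n) :=
  SimpleGraph.fromRel (· ≤ ·)

/-- The union of all connected components of `A` (as an induced subgraph of the comparability
graph) that intersect `C`. -/
def componentsMeeting {n : ℕ} (A C : Set (Zn n)) : Set (Zn n) :=
  {v | ∃ (hv : v ∈ A) (w : Zn n) (hw : w ∈ A), w ∈ C ∧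
    ((comparabilityGraph n).induce A).Reachable ⟨v, hv⟩ ⟨w, hw⟩}

/-- `Z(z,q,p,b)`: the union of all components of `p \ z` that intersect `p \ q`. -/
def Quad.zSet {n : ℕ} (x : Quad (Downsets n)) : Set (Zn n) :=
  componentsMeeting ((x.p : Set (Zn n)) \ x.z) ((x.p : Set (Zn n)) \ x.q)

/-- `B(z,q,p,b)`: the union of all components of `b \ q` that intersect `p \ q`. -/
def Quad.bSet {n : ℕ} (x : Quad (Downsets n)) : Set (Zn n) :=
  componentsMeeting ((x.b : Set (Zn n)) \ x.q) ((x.p : Set (Zn n)) \ x.q)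

/-! ### Admissible words -/

/-- The alphabet `{1, …, n, 1^∞, …, n^∞, ext}`. -/
inductive Letter (n : ℕ) : Type
  | fin (j : Fin n) : Letter n
  | inf (j : Fin n) : Letter n
  | ext : Letter n

/-- Finite words over the alphabet, read from left to right. -/
abbrev Word (n : ℕ) : Type := List (Letter n)

namespace Word

variable {n : ℕ}

/-- Admissible words: after `j^∞`, neither `j` nor `j^∞` appears; the only letter allowed directly
after `j^∞` is `ext`; and every `ext` comes directly after some `j^∞`. -/
def Admissible (ω : Word n) : Prop :=
  (∀ (σ τ : Word n) (j : Fin n), ω = σ ++ [Letter.inf j] ++ τ →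
    Letter.fin j ∉ τ ∧ Letter.inf j ∉ τ) ∧
  (∀ (σ τ : Word n) (j : Fin n) (l : Letter n), ω = σ ++ [Letter.inf j, l] ++ τ →
    l = Letter.ext) ∧
  (∀ σ τ : Word n, ω = σ ++ [Letter.ext] ++ τ →
    ∃ (σ' : Word n) (j : Fin n), σ = σ' ++ [Letter.inf j])

/-- The set `X(ω)` of all `j` for which `j^∞ ext` is a (contiguous) subword of `ω`. -/
def X (ω : Word n) : Set (Fin n) := {j | [Letter.inf j, Letter.ext] <:+: ω}

/-- Final words. -/
def Final (ω : Word n) : Prop := ω.Admissible ∧ ∀ j, j ∈ X ω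

open Classical in
/-- `δ^i_ω`, by recursion on the reversed word, whose first letter is the last letter of `ω`. -/
noncomputable def deltaRev : Word n → Fin n → Zn n
  | [], i => Pi.single i 1
  | Letter.fin j :: w, i =>
      if i = j ∨ i ∈ X w.reverse then deltaRev w i else deltaRev w i - deltaRev w j
  | Letter.inf _ :: w, i => deltaRev w i
  | Letter.ext :: w, i => deltaRev w i

/-- `δ^i_ω`: `δ^i_ε = e_i`; `δ^i_{ω*j} = δ^i_ω` if `i ∈ X(ω) ∪ {j}`, and `δ^i_ω - δ^j_ω` otherwise;
the letters `j^∞` and `ext` change nothing. -/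
noncomputable def delta (ω : Word n) (i : Fin n) : Zn n := deltaRev ω.reverse i

/-- `a^i_ω`, by recursion on the reversed word. -/
noncomputable def dirRev : Word n → Fin n → Zn n
  | [], i => Pi.single i 1
  | Letter.fin j :: w, i => if i = j then dirRev w i + deltaRev w i else dirRev w i
  | Letter.inf _ :: w, i => dirRev w i
  | Letter.ext :: w, i => dirRev w i

/-- `a^i_ω`: `a^i_ε = e_i`; `a^j_{ω*j} = a^j_ω + δ^j_ω` and `a^i_{ω*j} = a^i_ω` for `i ≠ j`;
the letters `j^∞` and `ext` change nothing. -/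
noncomputable def dir (ω : Word n) (i : Fin n) : Zn n := dirRev ω.reverse i

/-- `B_ω`, by recursion on the reversed word. The last clause only concerns words that are not
admissible. -/
noncomputable def BRev : Word n → Set (Zn n)
  | [] => {0}
  | Letter.fin j :: w => BRev w + {0, deltaRev w j}
  | Letter.inf j :: w => BRev w + Set.range (fun m : ℕ => m • deltaRev w j)
  | Letter.ext :: Letter.inf j :: w => BRev w + Set.range (fun m : ℤ => m • deltaRev w j)
  | Letter.ext :: w => BRev w

/-- `B_ω`: `B_ε = {0}`, `B_{ω*j} = B_ω + {0, δ^j_ω}`, `B_{ω*j^∞} = B_ω + ℤ_{≥0} δ^j_ω`, and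
`B_{ω*j^∞ ext} = B_ω + ℤ δ^j_ω`. -/
noncomputable def B (ω : Word n) : Set (Zn n) := BRev ω.reverse

/-- `Z_ω = - B_ω`. -/
noncomputable def Z (ω : Word n) : Set (Zn n) := -B ω

/-- `V_ω`, by recursion on the reversed word. The last clause only concerns words that are not
admissible. -/
noncomputable def VRev : Word n → AddSubgroup (Zn n)
  | [] => ⊥
  | Letter.fin _ :: w => VRev w
  | Letter.inf _ :: w => VRev w
  | Letter.ext :: Letter.inf j :: w => VRev w ⊔ AddSubgroup.zmultiples (deltaRev w j)
  | Letter.ext :: w => VRev w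

/-- The lattice `V_ω`: `V_ε = 0`, `V_{ω*j^∞ ext} = V_ω + ℤ δ^j_ω`; the letters `j` and `j^∞`
change nothing. -/
noncomputable def V (ω : Word n) : AddSubgroup (Zn n) := VRev ω.reverse

end Word

/-- `S^{pz}_{bq}` represents `S(P;ω) = S^{P + Z_ω}_{P + B_ω}`: one has `Z(z,q,p,b) = P + Z_ω` and
`B(z,q,p,b) = P + B_ω`. -/
def Quad.Represents {n : ℕ} (x : Quad (Downsets n)) (P : Zn n) (ω : Word n) : Prop :=
  x.zSet = P +ᵥ ω.Z ∧ x.bSet = P +ᵥ ω.B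

/-! ### Diagram chases in exact couple systems -/

namespace ExactCoupleSystem

section

variable {I : Type v} [PartialOrder I] [OrderBot I] (E : ExactCoupleSystem.{u} I)

/-! The algebraic half rests on one remark: S^{pz}_{bq} is the image of E^p_z → E^b_q
(`toS_eq_zero_iff`). For consecutive quadruples with z₁ = p₂, q₁ = b₂, z₂ = p₃, q₂ = b₃, diagram
chases identify the kernel of the outgoing differential with S^{p₂q₃}_{b₂q₂} and the homology in the
middle with S^{p₂q₃}_{p₁q₂} (`stermHomologyData`). An intermediate downset q ≤ y ≤ p yields a short
exact sequence of S-terms, hence filtrations (`exists_filtration`), and shrinking z while enlarging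
b yields a subquotient. Excision allows components of p \ z and b \ q that do not meet p \ q to be
discarded, and makes the rest depend on difference sets only (`nonempty_iso_of_zSet_eq_of_bSet_eq`).
It remains to find downsets with prescribed difference sets.

The combinatorial half reads words from the left. With ψ_i : e_k ↦ e_k + e_i for k ≠ i, e_i ↦ e_i,
prefixing the letter i turns B into ψ_i⁻¹(B + {0, e_i}), and prefixing i^∞ ext turns B into its
preimage under the projection killing coordinate i. Both maps preserve the order, unlike ψ_i⁻¹, so
order statements can be proved by induction on the first letter. A monotone functional, the height,
vanishes on V_ω and equals 1 on δ^k_ω for k ∉ X(ω). The set B_ω lies between height 0 and the height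
of a top element c; its extreme levels are V_ω and c + V_ω, and x ↦ c - x preserves it. The top
element of ω*j is a^j_ω.

Three facts carry the construction. The set B_ω + ℤc is convex (`periodic_convex`), whence so is B_ω
∪ -B_ω. An element of B_ω + δ^j_ω outside B_ω and comparable to some element of B_ω is a^j_ω modulo
V_ω (`mem_B_or_mem_V_of_comparable`). Finally, B_ω is connected (`comparablyConnected_B`).

Cutting a convex set by height gives downsets with the required differences. For the complex,
B_{ω*j} + ℤa with a = a^j_ω is cut at height < 0 to give q, adding V_ω gives p, and b = q + a, z = p
- a. Then b \ q is B_{ω*j} without its top level, and by incomparability its component through V_ω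
is B_ω. Homology replaces b by p + a and z by q - a, which restores all of B_{ω*j}. For j^∞ versus
j^k, the same p and q serve both terms. For the extension, p \ q = V_ω + ℤδ^j_ω is filtered by the
slices iδ^j_ω + V_ω; once the lower slices are removed, the component through slice i is iδ^j_ω +
B_{ω*j^∞}. -/

lemma obj_bot_eq_zero (x : E.obj ⊥ ⊥ le_rfl) : x = 0 := by
  have h1 : ∀ y : E.obj ⊥ ⊥ le_rfl, E.ℓ le_rfl le_rfl le_rfl le_rfl y = 0 := fun y => by
    have h := (E.exact_ℓ_ℓ (le_refl (⊥ : I))).apply_apply_eq_zero y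
    rwa [E.ℓ_ℓ] at h
  obtain ⟨y, hy⟩ := (E.exact_ℓ_ℓ (le_refl (⊥ : I)) x).1 (h1 x)
  rw [← hy]
  exact h1 y

lemma ℓ_self_bot {p : I} (x : E.obj p ⊥ bot_le) : E.ℓ bot_le bot_le le_rfl le_rfl x = x := by
  have inj : ∀ y : E.obj p ⊥ bot_le, E.ℓ bot_le bot_le le_rfl le_rfl y = 0 → y = 0 := fun y hy => by
    obtain ⟨w, rfl⟩ := (E.exact_ℓ_ℓ (bot_le : ⊥ ≤ p) y).1 hy
    rw [E.obj_bot_eq_zero w, map_zero]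
  rw [← sub_eq_zero]
  apply inj
  rw [map_sub, E.ℓ_ℓ, sub_self]

-- The axioms only make this endomorphism idempotent. On E^p_⊥ it is also injective, because its
-- kernel comes from E^⊥_⊥ = 0, so it is the identity there. In general the defect `ℓ x - x` is
-- killed by `k`, hence comes from E^p_⊥; on such elements `ℓ` acts trivially, yet it annihilates
-- the defect.
@[simp]
lemma ℓ_self {p q : I} (h : q ≤ p) (x : E.obj p q h) : E.ℓ h h le_rfl le_rfl x = x := by
  have hk : E.k h (E.ℓ h h le_rfl le_rfl x - x) = 0 := by
    rw [map_sub, ← E.ℓ_k, E.ℓ_self_bot, sub_self]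
  obtain ⟨w, hw⟩ := (E.exact_ℓ_k h _).1 hk
  have h0 : E.ℓ h h le_rfl le_rfl (E.ℓ h h le_rfl le_rfl x - x) = 0 := by
    rw [map_sub, E.ℓ_ℓ, sub_self]
  rw [← hw, E.ℓ_ℓ, hw] at h0
  exact sub_eq_zero.1 h0

lemma obj_self_eq_zero {p : I} (x : E.obj p p le_rfl) : x = 0 := by
  have h1 : E.k le_rfl x = 0 := by
    have := (E.exact_k_ℓ (le_refl p)).apply_apply_eq_zero x
    rwa [E.ℓ_self_bot] at this
  obtain ⟨w, rfl⟩ := (E.exact_ℓ_k _ _).1 h1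
  have := (E.exact_ℓ_ℓ (le_refl p)).apply_apply_eq_zero w
  rwa [E.ℓ_self_bot] at this

lemma ℓ_eq_zero {p q p' q' : I} (h : q ≤ p) (h' : q' ≤ p') (hp : p ≤ p') (hq : q ≤ q')
    (hpq : p ≤ q') (x : E.obj p q h) : E.ℓ h h' hp hq x = 0 := by
  rw [← E.ℓ_ℓ h (le_refl q') h' hpq hq h' le_rfl, E.obj_self_eq_zero (E.ℓ h _ _ _ x), map_zero]

lemma exact_ℓ_ℓ_triple {p q z : I} (hq : q ≤ p) (hz : z ≤ q) :
    Function.Exact (E.ℓ hz (hz.trans hq) hq le_rfl) (E.ℓ (hz.trans hq) hq le_rfl hz) := by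
  intro x
  constructor
  · intro hx
    have hkx : E.ℓ bot_le bot_le hz le_rfl (E.k _ x) = 0 := by
      rw [E.ℓ_k _ hq le_rfl hz, hx, map_zero]
    obtain ⟨v, hv⟩ := (E.exact_k_ℓ hz _).1 hkx
    have h0 : E.k _ (x - E.ℓ hz (hz.trans hq) hq le_rfl v) = 0 := by
      rw [map_sub, ← E.ℓ_k, hv, E.ℓ_self, sub_self]
    obtain ⟨w, hw⟩ := (E.exact_ℓ_k _ _).1 h0
    have hw0 : E.ℓ bot_le hq le_rfl bot_le w = 0 := by
      rw [← E.ℓ_ℓ bot_le (hz.trans hq) hq le_rfl bot_le le_rfl hz, hw, map_sub, hx, E.ℓ_ℓ,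
        E.ℓ_eq_zero hz hq hq hz le_rfl, sub_self]
    obtain ⟨t, rfl⟩ := (E.exact_ℓ_ℓ hq _).1 hw0
    refine ⟨E.ℓ bot_le hz le_rfl bot_le t + v, ?_⟩
    rw [E.ℓ_ℓ] at hw
    rw [map_add, E.ℓ_ℓ, hw, sub_add_cancel]
  · rintro ⟨y, rfl⟩
    rw [E.ℓ_ℓ, E.ℓ_eq_zero _ _ _ _ le_rfl]

lemma exact_ℓ_d {p q z : I} (hq : q ≤ p) (hz : z ≤ q) :
    Function.Exact (E.ℓ (hz.trans hq) hq le_rfl hz) (E.d hq hz) := by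
  intro x
  constructor
  · intro hx
    obtain ⟨w, hw⟩ := (E.exact_ℓ_ℓ hz _).1 hx
    have hw0 : E.ℓ bot_le bot_le (hz.trans hq) le_rfl w = 0 := by
      rw [← E.ℓ_ℓ bot_le (bot_le : ⊥ ≤ q) bot_le hz le_rfl hq le_rfl, hw]
      exact (E.exact_k_ℓ hq).apply_apply_eq_zero x
    obtain ⟨v, rfl⟩ := (E.exact_k_ℓ (hz.trans hq) _).1 hw0
    have h0 : E.k hq (x - E.ℓ (hz.trans hq) hq le_rfl hz v) = 0 := by
      rw [map_sub, ← E.ℓ_k, hw, sub_self]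
    obtain ⟨t, ht⟩ := (E.exact_ℓ_k _ _).1 h0
    refine ⟨E.ℓ bot_le (hz.trans hq) le_rfl bot_le t + v, ?_⟩
    rw [map_add, E.ℓ_ℓ, ht, sub_add_cancel]
  · rintro ⟨y, rfl⟩
    exact E.d_ℓ hq hz y

lemma exact_d_ℓ {p q z : I} (hq : q ≤ p) (hz : z ≤ q) :
    Function.Exact (E.d hq hz) (E.ℓ hz (hz.trans hq) hq le_rfl) := by
  intro x
  constructor
  · intro hx
    have hk : E.k hz x = 0 := by
      have := E.ℓ_k hz (hz.trans hq) hq le_rfl x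
      rwa [hx, map_zero, E.ℓ_self] at this
    obtain ⟨w, rfl⟩ := (E.exact_ℓ_k _ _).1 hk
    have h1 : E.ℓ bot_le (hz.trans hq) le_rfl bot_le
        (E.ℓ bot_le (bot_le : ⊥ ≤ p) hq le_rfl w) = 0 := by
      rw [E.ℓ_ℓ] at hx ⊢
      exact hx
    obtain ⟨t, ht⟩ := (E.exact_ℓ_ℓ (hz.trans hq) _).1 h1
    have h2 : E.ℓ bot_le bot_le hq le_rfl (w - E.ℓ bot_le bot_le hz le_rfl t) = 0 := by
      rw [map_sub, E.ℓ_ℓ, ht, sub_self]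
    obtain ⟨y, hy⟩ := (E.exact_k_ℓ hq _).1 h2
    refine ⟨y, ?_⟩
    simp only [d, AddMonoidHom.comp_apply]
    rw [hy, map_sub, (E.exact_ℓ_ℓ hz).apply_apply_eq_zero, sub_zero]
  · rintro ⟨y, rfl⟩
    simp only [d, AddMonoidHom.comp_apply]
    rw [E.ℓ_ℓ, ← E.ℓ_ℓ bot_le (bot_le : ⊥ ≤ p) _ hq le_rfl le_rfl bot_le,
      (E.exact_k_ℓ hq).apply_apply_eq_zero, map_zero]

lemma toS_surjective (x : Quad I) : Function.Surjective (E.toS x) := by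
  intro y
  obtain ⟨⟨w, hw⟩, rfl⟩ := QuotientAddGroup.mk'_surjective _ y
  obtain ⟨v, rfl⟩ := (E.exact_ℓ_d x.hqp x.hzq w).1 hw
  exact ⟨v, rfl⟩

/-- The boundaries are the kernel of E^p_q → E^b_q, by `exact_d_ℓ`. Thus S^{pz}_{bq} is the image of
E^p_z in E^b_q; all later computations with S-terms compare images in E^b_q. -/
lemma toS_eq_zero_iff (x : Quad I) (ξ : E.obj x.p x.z (x.hzq.trans x.hqp)) :
    E.toS x ξ = 0 ↔ E.ℓ _ (x.hqp.trans x.hpb) x.hpb x.hzq ξ = 0 := by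
  have h1 : E.toS x ξ = 0 ↔
      E.ℓ (x.hzq.trans x.hqp) x.hqp le_rfl x.hzq ξ ∈ (E.d x.hpb x.hqp).range :=
    QuotientAddGroup.eq_zero_iff _
  rw [h1, ← E.ℓ_ℓ _ x.hqp _ le_rfl x.hzq x.hpb le_rfl]
  exact (E.exact_d_ℓ x.hpb x.hqp _).symm

lemma toS_eq_iff (x : Quad I) (ξ η : E.obj x.p x.z (x.hzq.trans x.hqp)) :
    E.toS x ξ = E.toS x η ↔
      E.ℓ _ (x.hqp.trans x.hpb) x.hpb x.hzq ξ = E.ℓ _ (x.hqp.trans x.hpb) x.hpb x.hzq η := by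
  rw [← sub_eq_zero, ← map_sub, toS_eq_zero_iff, map_sub, sub_eq_zero]

lemma SFunctor_map_toS {E F : ExactCoupleSystem.{u} I} (f : E ⟶ F) (x : Quad I)
    (ξ : E.obj x.p x.z (x.hzq.trans x.hqp)) :
    ((SFunctor x).map f).hom (E.toS x ξ) = F.toS x (Hom.app f _ _ _ ξ) := by
  change QuotientAddGroup.mk _ = QuotientAddGroup.mk _
  congr 1
  exact Subtype.ext (Hom.app_ℓ f _ _ _ _ _)

end

/-! ### Consequences of excision -/

section Excision

variable {I : Type v} [Lattice I] [OrderBot I] {E : ExactCoupleSystem.{u} I}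

/-- The downset `a` is a complement of `z'` over `z` inside `p`. The excision isomorphism E^a_z →
E^p_{z'} factors through E^p_z. -/
lemma Excisive.surjective_of_sup (hE : E.Excisive) {p z z' : I} (hz : z ≤ z') (hz' : z' ≤ p)
    (a : I) (ha : a ⊔ z' = p) (ha' : a ⊓ z' = z) :
    Function.Surjective (E.ℓ (hz.trans hz') hz' le_rfl hz) := by
  subst ha ha'
  intro y
  obtain ⟨w, rfl⟩ := (hE a z').2 y
  exact ⟨E.ℓ inf_le_left _ le_sup_left le_rfl w, E.ℓ_ℓ ..⟩

lemma Excisive.injective_of_inf (hE : E.Excisive) {b b' q : I} (hq : q ≤ b') (hb : b' ≤ b)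
    (a : I) (ha : b' ⊔ a = b) (ha' : b' ⊓ a = q) :
    Function.Injective (E.ℓ hq (hq.trans hb) hb le_rfl) := by
  subst ha ha'
  intro y y' hy
  apply (hE b' a).1
  rw [← E.ℓ_ℓ _ (inf_le_left.trans le_sup_left) _ le_sup_left le_rfl le_rfl inf_le_right, hy, E.ℓ_ℓ]

lemma Excisive.bijective_of (hE : E.Excisive) {p z p' z' : I} (h : z ≤ p) (h' : z' ≤ p')
    (hp : p ≤ p') (hz : z ≤ z') (hs : p ⊔ z' = p') (hi : p ⊓ z' = z) :
    Function.Bijective (E.ℓ h h' hp hz) := by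
  subst hs hi
  exact hE p z'

end Excision

end ExactCoupleSystem

/-! ### Natural maps between `S`-terms -/

section StermMaps

open ExactCoupleSystem

variable {n : ℕ}

/-- The component of a natural map between `S`-terms. -/
def stermApp {x y : Quad (Downsets n)} (η : Sterm.{u} x ⟶ Sterm.{u} y)
    (E : ExcisiveSystems.{u} n) : E.obj.S x →+ E.obj.S y :=
  (η.app E).hom

@[simp]
lemma stermApp_comp {x y w : Quad (Downsets n)} (η : Sterm.{u} x ⟶ Sterm.{u} y)
    (θ : Sterm.{u} y ⟶ Sterm.{u} w) (E : ExcisiveSystems.{u} n) (s : E.obj.S x) :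
    stermApp (η ≫ θ) E s = stermApp θ E (stermApp η E s) := rfl

@[simp]
lemma stermApp_zero {x y : Quad (Downsets n)} (E : ExcisiveSystems.{u} n) (s : E.obj.S x) :
    stermApp (0 : Sterm.{u} x ⟶ Sterm.{u} y) E s = 0 := rfl

lemma sterm_hom_ext {x y : Quad (Downsets n)} {f g : Sterm.{u} x ⟶ Sterm.{u} y}
    (h : ∀ E ξ, stermApp f E (E.obj.toS x ξ) = stermApp g E (E.obj.toS x ξ)) : f = g := by
  ext E s
  obtain ⟨ξ, rfl⟩ := E.obj.toS_surjective x s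
  exact h E ξ

/-- The natural map between `S`-terms induced by natural maps `E^p_z → E^{p'}_{z'}`. -/
noncomputable def stermDesc (x y : Quad (Downsets n))
    (α : ∀ E : ExcisiveSystems.{u} n,
      E.obj.obj x.p x.z (x.hzq.trans x.hqp) →+ E.obj.obj y.p y.z (y.hzq.trans y.hqp))
    (nat : ∀ (E F : ExcisiveSystems.{u} n) (f : E ⟶ F) ξ,
      Hom.app f.hom _ _ _ (α E ξ) = α F (Hom.app f.hom _ _ _ ξ))
    (h : ∀ (E : ExcisiveSystems.{u} n) ξ, E.obj.toS x ξ = 0 → E.obj.toS y (α E ξ) = 0) :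
    Sterm.{u} x ⟶ Sterm.{u} y where
  app E := AddCommGrpCat.ofHom
    ((E.obj.toS x).liftOfSurjective (E.obj.toS_surjective x) ⟨(E.obj.toS y).comp (α E), h E⟩)
  naturality E F f := by
    ext s
    obtain ⟨ξ, rfl⟩ := E.obj.toS_surjective x s
    let g : ∀ E : ExcisiveSystems.{u} n, E.obj.S x →+ E.obj.S y := fun E =>
      (E.obj.toS x).liftOfSurjective (E.obj.toS_surjective x) ⟨(E.obj.toS y).comp (α E), h E⟩
    have key : ∀ (E : ExcisiveSystems.{u} n) ξ, g E (E.obj.toS x ξ) = E.obj.toS y (α E ξ) :=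
      fun E ξ => AddMonoidHom.liftOfRightInverse_comp_apply _ _ _
        ⟨(E.obj.toS y).comp (α E), h E⟩ ξ
    change g F (((SFunctor x).map f.hom).hom (E.obj.toS x ξ)) =
      ((SFunctor y).map f.hom).hom (g E (E.obj.toS x ξ))
    rw [SFunctor_map_toS, key, key, SFunctor_map_toS, nat]

lemma stermDesc_toS (x y : Quad (Downsets n))
    (α : ∀ E : ExcisiveSystems.{u} n,
      E.obj.obj x.p x.z (x.hzq.trans x.hqp) →+ E.obj.obj y.p y.z (y.hzq.trans y.hqp))
    (nat) (h) (E : ExcisiveSystems.{u} n)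
    (ξ : E.obj.obj x.p x.z (x.hzq.trans x.hqp)) :
    stermApp (stermDesc x y α nat h) E (E.obj.toS x ξ) = E.obj.toS y (α E ξ) :=
  AddMonoidHom.liftOfRightInverse_comp_apply _ _ _ ⟨(E.obj.toS y).comp (α E), h E⟩ ξ

/-- The map between `S`-terms induced by `ℓ`. -/
noncomputable def stermMap (x y : Quad (Downsets n)) (hp : x.p ≤ y.p) (hz : x.z ≤ y.z)
    (hb : x.b ≤ y.b) (hq : x.q ≤ y.q) : Sterm.{u} x ⟶ Sterm.{u} y :=
  stermDesc x y (fun E => E.obj.ℓ _ _ hp hz)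
    (fun E F f ξ => Hom.app_ℓ f.hom _ _ _ _ ξ)
    (fun E ξ => by
      rw [toS_eq_zero_iff, toS_eq_zero_iff]
      intro h
      rw [E.obj.ℓ_ℓ, ← E.obj.ℓ_ℓ _ (x.hqp.trans x.hpb) _ x.hpb x.hzq hb hq, h, map_zero])

@[simp]
lemma stermMap_toS (x y : Quad (Downsets n)) (hp hz hb hq) (E : ExcisiveSystems.{u} n) (ξ) :
    stermApp (stermMap x y hp hz hb hq) E (E.obj.toS x ξ) = E.obj.toS y (E.obj.ℓ _ _ hp hz ξ) :=
  stermDesc_toS ..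

/-- The differential of the spectral system. -/
noncomputable def stermD (x y : Quad (Downsets n)) (hz : x.z ≤ y.p) (hq : x.q ≤ y.b) :
    Sterm.{u} x ⟶ Sterm.{u} y :=
  stermDesc x y (fun E => (E.obj.ℓ bot_le (y.hzq.trans y.hqp) hz bot_le).comp
      (E.obj.k (x.hzq.trans x.hqp)))
    (fun E F f ξ => by
      simp only [AddMonoidHom.comp_apply]
      rw [Hom.app_ℓ, Hom.app_k])
    (fun E ξ => by
      simp only [AddMonoidHom.comp_apply]
      rw [toS_eq_zero_iff, toS_eq_zero_iff]
      intro h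
      rw [E.obj.ℓ_ℓ, ← E.obj.ℓ_ℓ bot_le (bot_le : ⊥ ≤ x.q) _ x.hzq le_rfl hq bot_le,
        E.obj.ℓ_k _ (x.hqp.trans x.hpb) x.hpb x.hzq, h, map_zero, map_zero])

@[simp]
lemma stermD_toS (x y : Quad (Downsets n)) (hz hq) (E : ExcisiveSystems.{u} n) (ξ) :
    stermApp (stermD x y hz hq) E (E.obj.toS x ξ) =
      E.obj.toS y (E.obj.ℓ bot_le (y.hzq.trans y.hqp) hz bot_le
        (E.obj.k (x.hzq.trans x.hqp) ξ)) :=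
  stermDesc_toS ..

lemma isSpectralDifferential_stermD (x y : Quad (Downsets n)) (hz hq) :
    IsSpectralDifferential.{u} x y (stermD x y hz hq) :=
  ⟨hz, hq, fun _ _ => stermD_toS ..⟩

lemma mono_of_injective {F G : ExcisiveSystems.{u} n ⥤ AddCommGrpCat.{u}} (f : F ⟶ G)
    (h : ∀ E, Function.Injective (f.app E).hom) : Mono f := by
  rw [NatTrans.mono_iff_mono_app]
  exact fun E => (AddCommGrpCat.mono_iff_injective _).2 (h E)

lemma epi_of_surjective {F G : ExcisiveSystems.{u} n ⥤ AddCommGrpCat.{u}} (f : F ⟶ G)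
    (h : ∀ E, Function.Surjective (f.app E).hom) : Epi f := by
  rw [NatTrans.epi_iff_epi_app]
  exact fun E => (AddCommGrpCat.epi_iff_surjective _).2 (h E)

lemma isIso_of_bijective {F G : ExcisiveSystems.{u} n ⥤ AddCommGrpCat.{u}} (f : F ⟶ G)
    (h : ∀ E, Function.Bijective (f.app E).hom) : IsIso f := by
  have := mono_of_injective f fun E => (h E).1
  have := epi_of_surjective f fun E => (h E).2
  exact isIso_of_mono_of_epi f

/-- Evaluation functors preserve homology, so exactness of natural maps may be checked on the
elements of each group. -/
lemma exact_of_function_exact (S : ShortComplex (ExcisiveSystems.{u} n ⥤ AddCommGrpCat.{u}))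
    (h : ∀ E, Function.Exact (S.f.app E).hom (S.g.app E).hom) : S.Exact := by
  rw [ShortComplex.exact_iff_isZero_homology, Functor.isZero_iff]
  intro E
  have : (S.map ((evaluation _ _).obj E)).Exact :=
    (ShortComplex.ab_exact_iff_function_exact _).2 (h E)
  exact ((ShortComplex.exact_iff_isZero_homology _).1 this).of_iso
    (S.mapHomologyIso ((evaluation _ _).obj E)).symm

lemma stermMap_injective (x y : Quad (Downsets n)) (hp : x.p ≤ y.p) (hz : x.z ≤ y.z)
    (hb : x.b ≤ y.b) (hq : x.q ≤ y.q) (E : ExcisiveSystems.{u} n)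
    (h : ∀ ξ, E.obj.ℓ (x.hzq.trans x.hqp) (y.hqp.trans y.hpb) (hp.trans y.hpb) (hz.trans y.hzq) ξ
      = 0 → E.obj.ℓ (x.hzq.trans x.hqp) (x.hqp.trans x.hpb) x.hpb x.hzq ξ = 0) :
    Function.Injective (stermApp (stermMap.{u} x y hp hz hb hq) E) := by
  rw [injective_iff_map_eq_zero]
  intro s hs
  obtain ⟨ξ, rfl⟩ := E.obj.toS_surjective x s
  rw [stermMap_toS, toS_eq_zero_iff, E.obj.ℓ_ℓ] at hs
  exact (E.obj.toS_eq_zero_iff _ _).2 (h ξ hs)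

lemma stermMap_surjective (x y : Quad (Downsets n)) (hp : x.p ≤ y.p) (hz : x.z ≤ y.z)
    (hb : x.b ≤ y.b) (hq : x.q ≤ y.q) (E : ExcisiveSystems.{u} n)
    (h : Function.Surjective
      (E.obj.ℓ (x.hzq.trans x.hqp) (y.hzq.trans y.hqp) hp hz)) :
    Function.Surjective (stermApp (stermMap.{u} x y hp hz hb hq) E) := by
  intro s
  obtain ⟨ξ, rfl⟩ := E.obj.toS_surjective y s
  obtain ⟨ζ, rfl⟩ := h ξ
  exact ⟨E.obj.toS x ζ, stermMap_toS ..⟩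

/-- `S`-terms with the same `p`, `q`, and with smaller `z`. -/
lemma mono_stermMap_of_q_eq (x y : Quad (Downsets n)) (hp : x.p ≤ y.p) (hz hb hq)
    (hb' : y.b ≤ x.b) (hq' : y.q ≤ x.q) : Mono (stermMap.{u} x y hp hz hb hq) :=
  mono_of_injective _ fun E => stermMap_injective _ _ _ _ _ _ _ fun ξ h => by
    have := congrArg (E.obj.ℓ (y.hqp.trans y.hpb) (x.hqp.trans x.hpb) hb' hq') h
    rwa [E.obj.ℓ_ℓ, map_zero] at this

lemma epi_stermMap_of_p_eq (x y : Quad (Downsets n)) (hp hz hb hq)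
    (hp' : y.p ≤ x.p) (hz' : y.z ≤ x.z) : Epi (stermMap.{u} x y hp hz hb hq) :=
  epi_of_surjective _ fun E => stermMap_surjective _ _ _ _ _ _ _ fun ξ =>
    ⟨E.obj.ℓ _ _ hp' hz' ξ, by rw [E.obj.ℓ_ℓ, ℓ_self]⟩

lemma stermMap_comp (x y w : Quad (Downsets n)) (hp hz hb hq) (hp' hz' hb' hq') :
    stermMap.{u} x y hp hz hb hq ≫ stermMap y w hp' hz' hb' hq' =
      stermMap x w (hp.trans hp') (hz.trans hz') (hb.trans hb') (hq.trans hq') :=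
  sterm_hom_ext fun E ξ => by
    simp [E.obj.ℓ_ℓ]

/-- `S^{pq}_{pq} = E^p_q`. -/
noncomputable def stermIsoEntry (p q : Downsets n) (h : q ≤ p) :
    Sterm.{u} ⟨p, p, q, q, le_rfl, h, le_rfl⟩ ≅ entry.{u} p q h := by
  let x : Quad (Downsets n) := ⟨p, p, q, q, le_rfl, h, le_rfl⟩
  let f : entry.{u} p q h ⟶ Sterm.{u} x :=
    { app := fun E => AddCommGrpCat.ofHom (E.obj.toS x)
      naturality := fun E F g => by
        ext ξ
        exact (SFunctor_map_toS g.hom x ξ).symm }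
  have : IsIso f := isIso_of_bijective f fun E => by
    refine ⟨(injective_iff_map_eq_zero _).2 fun ξ hξ => ?_, E.obj.toS_surjective x⟩
    exact (E.obj.ℓ_self h ξ).symm.trans ((E.obj.toS_eq_zero_iff x ξ).1 hξ)
  exact (asIso f).symm

end StermMaps

/-! ### Homology of the differentials of the spectral system -/

section Homology

open ExactCoupleSystem

variable {n : ℕ}

lemma stermD_comp_stermD (x y w : Quad (Downsets n)) (hz hq hz' hq') :
    stermD.{u} x y hz hq ≫ stermD y w hz' hq' = 0 :=
  sterm_hom_ext fun E ξ => by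
    rw [stermApp_comp, stermApp_zero, stermD_toS, stermD_toS]
    have : E.obj.k (y.hzq.trans y.hqp) (E.obj.ℓ bot_le (y.hzq.trans y.hqp) hz bot_le
        (E.obj.k (x.hzq.trans x.hqp) ξ)) = 0 := by
      rw [← E.obj.ℓ_ℓ bot_le (bot_le : ⊥ ≤ y.p) _ hz le_rfl le_rfl bot_le]
      exact (E.obj.exact_ℓ_k _).apply_apply_eq_zero _
    rw [this, map_zero, map_zero]

variable {x₁ x₂ x₃ : Quad (Downsets n)}

/-- The quadruple representing the kernel of `S^{p₂z₂}_{b₂q₂} → S^{p₃z₃}_{b₃q₃}`. -/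
abbrev kerQuad (x₂ x₃ : Quad (Downsets n)) (hz : x₂.z = x₃.p) : Quad (Downsets n) :=
  ⟨x₂.b, x₂.p, x₂.q, x₃.q, x₂.hpb, x₂.hqp, x₃.hqp.trans (hz.symm.le.trans x₂.hzq)⟩

/-- The quadruple representing the homology of
`S^{p₁z₁}_{b₁q₁} → S^{p₂z₂}_{b₂q₂} → S^{p₃z₃}_{b₃q₃}`. -/
abbrev homologyQuad (x₁ x₂ x₃ : Quad (Downsets n)) (hz : x₂.z = x₃.p) (hq₁ : x₁.q = x₂.b) :
    Quad (Downsets n) :=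
  ⟨x₁.p, x₂.p, x₂.q, x₃.q, x₂.hpb.trans (hq₁.symm.le.trans x₁.hqp), x₂.hqp,
    x₃.hqp.trans (hz.symm.le.trans x₂.hzq)⟩

/-- Replacing z₂ by the smaller q₃ keeps exactly the classes having a lift to E^{p₂}_{q₃}; a class
in the kernel of the differential acquires such a lift after a correction by E^{q₂}_{z₂}, which
vanishes in E^{b₂}_{q₂}. -/
lemma exact_kerQuad (hz : x₂.z = x₃.p) (hq : x₂.q = x₃.b) (E : ExcisiveSystems.{u} n) :
    Function.Exact (stermApp (stermMap (kerQuad x₂ x₃ hz) x₂ le_rfl (x₃.hqp.trans hz.symm.le)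
        le_rfl le_rfl) E) (stermApp (stermD x₂ x₃ hz.le hq.le) E) := by
  obtain ⟨b, p, q, z, hpb, hqp, hzq⟩ := x₂
  obtain ⟨b', p', q', z', hpb', hqp', hzq'⟩ := x₃
  dsimp only at hz hq
  subst hz hq
  intro s
  obtain ⟨ξ, rfl⟩ := E.obj.toS_surjective _ s
  rw [stermD_toS, toS_eq_zero_iff]
  dsimp only
  rw [E.obj.ℓ_ℓ]
  constructor
  · intro h
    have h' : E.obj.ℓ hqp' (hqp'.trans hzq) hzq le_rfl (E.obj.d (hzq.trans hqp) hqp' ξ) = 0 := by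
      simp only [ExactCoupleSystem.d, AddMonoidHom.comp_apply]
      rw [E.obj.ℓ_ℓ]
      exact h
    -- Subtracting the image of `η` removes the obstruction to lifting `ξ`, and does not change its
    -- class since that image dies in E^b_q.
    obtain ⟨η, hη⟩ := (E.obj.exact_d_ℓ hzq hqp' _).1 h'
    have h0 : E.obj.d (hzq.trans hqp) hqp' (ξ - E.obj.ℓ hzq (hzq.trans hqp) hqp le_rfl η) = 0 := by
      rw [map_sub, ← hη]
      simp only [ExactCoupleSystem.d, AddMonoidHom.comp_apply]
      rw [← E.obj.ℓ_k hzq (hzq.trans hqp) hqp le_rfl, ℓ_self, sub_self]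
    obtain ⟨ζ, hζ⟩ := (E.obj.exact_ℓ_d _ _ _).1 h0
    refine ⟨E.obj.toS _ ζ, ?_⟩
    rw [stermMap_toS]
    dsimp only
    rw [hζ, map_sub, sub_eq_self, toS_eq_zero_iff]
    dsimp only
    rw [E.obj.ℓ_ℓ, E.obj.ℓ_eq_zero _ _ _ _ le_rfl]
  · rintro ⟨t, ht⟩
    obtain ⟨ζ, rfl⟩ := E.obj.toS_surjective _ t
    rw [stermMap_toS] at ht
    dsimp only at ht
    rw [toS_eq_iff] at ht
    dsimp only at ht
    rw [E.obj.ℓ_ℓ] at ht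
    have hk : ∀ ξ : E.obj.obj p z (hzq.trans hqp), E.obj.ℓ bot_le (hqp'.trans hzq) hzq bot_le
        (E.obj.k (hzq.trans hqp) ξ) = E.obj.ℓ bot_le (hqp'.trans hzq) le_rfl bot_le
        (E.obj.k (hqp.trans hpb) (E.obj.ℓ (hzq.trans hqp) (hqp.trans hpb) hpb hzq ξ)) := by
      intro ξ
      rw [← E.obj.ℓ_k _ _ hpb hzq, E.obj.ℓ_ℓ]
    rw [hk, ← ht, ← E.obj.ℓ_k _ _ hpb (hqp'.trans hzq), E.obj.ℓ_ℓ, 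
      ← E.obj.ℓ_ℓ bot_le (bot_le : ⊥ ≤ q) _ (hqp'.trans hzq) le_rfl le_rfl bot_le]
    exact (E.obj.exact_ℓ_ℓ (hqp'.trans hzq)).apply_apply_eq_zero _

lemma exact_homologyQuad (hz₁ : x₁.z = x₂.p) (hq₁ : x₁.q = x₂.b) (hz : x₂.z = x₃.p)
    (E : ExcisiveSystems.{u} n) :
    Function.Exact (stermApp (stermD x₁ (kerQuad x₂ x₃ hz) hz₁.le hq₁.le) E)
      (stermApp (stermMap (kerQuad x₂ x₃ hz) (homologyQuad x₁ x₂ x₃ hz hq₁) le_rfl le_rfl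
        (hq₁.symm.le.trans x₁.hqp) le_rfl) E) := by
  obtain ⟨b, p, q, z, hpb, hqp, hzq⟩ := x₂
  obtain ⟨b', p', q', z', hpb', hqp', hzq'⟩ := x₃
  obtain ⟨b₁, p₁, q₁, z₁, hpb₁, hqp₁, hzq₁⟩ := x₁
  dsimp only at hz hz₁ hq₁
  subst hz hz₁ hq₁
  intro s
  obtain ⟨ξ, rfl⟩ := E.obj.toS_surjective _ s
  rw [stermMap_toS, toS_eq_zero_iff]
  dsimp only
  rw [ℓ_self]
  constructor
  · intro h
    have h1 : E.obj.ℓ hqp (hqp.trans (hzq₁.trans hqp₁)) (hzq₁.trans hqp₁) le_rfl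
        (E.obj.ℓ (hqp'.trans (hzq.trans hqp)) hqp le_rfl (hqp'.trans hzq) ξ) = 0 := by
      rw [E.obj.ℓ_ℓ]; exact h
    obtain ⟨η, hη⟩ := (E.obj.exact_d_ℓ _ _ _).1 h1
    refine ⟨E.obj.toS _ η, ?_⟩
    rw [stermD_toS, toS_eq_iff]
    dsimp only
    rw [← E.obj.ℓ_ℓ _ hqp _ le_rfl (hqp'.trans hzq) hzq₁ le_rfl ξ, ← hη]
    simp only [ExactCoupleSystem.d, AddMonoidHom.comp_apply]
    rw [E.obj.ℓ_ℓ, E.obj.ℓ_ℓ]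
  · rintro ⟨t, ht⟩
    obtain ⟨ζ, rfl⟩ := E.obj.toS_surjective _ t
    rw [stermD_toS, toS_eq_iff] at ht
    dsimp only at ht
    have h := congrArg (E.obj.ℓ (hqp.trans hzq₁) (hqp.trans (hzq₁.trans hqp₁)) hqp₁ le_rfl) ht
    rw [E.obj.ℓ_ℓ, E.obj.ℓ_ℓ, E.obj.ℓ_ℓ,
      ← E.obj.ℓ_ℓ bot_le (bot_le : ⊥ ≤ p₁) _ (hzq₁.trans hqp₁) le_rfl le_rfl bot_le,
      (E.obj.exact_k_ℓ _).apply_apply_eq_zero, map_zero] at h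
    exact h.symm

/-- Cokernels only depend on the morphism up to equality. -/
def isColimitCokernelCoforkOfEq {A B D : ExcisiveSystems.{u} n ⥤ AddCommGrpCat.{u}} {f g : A ⟶ B}
    {π : B ⟶ D} (h : g = f) (w : f ≫ π = 0) (w' : g ≫ π = 0)
    (hc : IsColimit (CokernelCofork.ofπ π w)) : IsColimit (CokernelCofork.ofπ π w') := by
  subst h
  exact hc

/-- The homology of the differentials of the spectral system. -/
noncomputable def stermHomologyData (hz₁ : x₁.z = x₂.p) (hq₁ : x₁.q = x₂.b) (hz : x₂.z = x₃.p)
    (hq : x₂.q = x₃.b) :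
    (ShortComplex.mk _ _
      (stermD_comp_stermD.{u} x₁ x₂ x₃ hz₁.le hq₁.le hz.le hq.le)).LeftHomologyData := by
  let i := stermMap.{u} (kerQuad x₂ x₃ hz) x₂ le_rfl (x₃.hqp.trans hz.symm.le) le_rfl le_rfl
  let π := stermMap.{u} (kerQuad x₂ x₃ hz) (homologyQuad x₁ x₂ x₃ hz hq₁) le_rfl le_rfl
        (hq₁.symm.le.trans x₁.hqp) le_rfl
  let f' := stermD.{u} x₁ (kerQuad x₂ x₃ hz) hz₁.le hq₁.le
  have wi : i ≫ stermD.{u} x₂ x₃ hz.le hq.le = 0 := by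
    ext E s
    exact (exact_kerQuad hz hq E).apply_apply_eq_zero s
  have wf : f' ≫ π = 0 := by
    ext E s
    exact (exact_homologyQuad hz₁ hq₁ hz E).apply_apply_eq_zero s
  have : Mono i := mono_stermMap_of_q_eq _ _ _ _ _ _ le_rfl le_rfl
  have : Epi π := epi_stermMap_of_p_eq _ _ _ _ _ _ le_rfl le_rfl
  have hi := (exact_of_function_exact (ShortComplex.mk i _ wi) (exact_kerQuad hz hq)).fIsKernel
  have hπ := (exact_of_function_exact (ShortComplex.mk f' π wf)
    (exact_homologyQuad hz₁ hq₁ hz)).gIsCokernel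
  -- The map into the kernel is again a differential of the spectral system, so its cokernel is
  -- given by `exact_homologyQuad`.
  have hf : hi.lift (KernelFork.ofι (stermD.{u} x₁ x₂ hz₁.le hq₁.le)
      (stermD_comp_stermD.{u} x₁ x₂ x₃ hz₁.le hq₁.le hz.le hq.le)) = f' := by
    rw [← cancel_mono i]
    refine (Fork.IsLimit.lift_ι hi).trans (sterm_hom_ext fun E ξ => ?_)
    refine (stermD_toS x₁ x₂ hz₁.le hq₁.le E ξ).trans ?_
    rw [stermApp_comp, stermD_toS, stermMap_toS, E.obj.ℓ_ℓ]
  have wπ : hi.lift (KernelFork.ofι (stermD.{u} x₁ x₂ hz₁.le hq₁.le)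
      (stermD_comp_stermD.{u} x₁ x₂ x₃ hz₁.le hq₁.le hz.le hq.le)) ≫ π = 0 := by
    rw [hf, wf]
  exact
    { K := Sterm.{u} (kerQuad x₂ x₃ hz)
      H := Sterm.{u} (homologyQuad x₁ x₂ x₃ hz hq₁)
      i := i
      π := π
      wi := wi
      hi := hi
      wπ := wπ
      hπ := isColimitCokernelCoforkOfEq hf _ _ hπ }

end Homology

/-! ### Components of the comparability graph -/

section Components

variable {n : ℕ}

lemma componentsMeeting_subset (A C : Set (Zn n)) : componentsMeeting A C ⊆ A :=
  fun _ ⟨hv, _⟩ => hv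

lemma subset_componentsMeeting {A C : Set (Zn n)} (h : C ⊆ A) : C ⊆ componentsMeeting A C :=
  fun v hv => ⟨h hv, v, h hv, hv, .rfl⟩

lemma reachable_of_comparable {A : Set (Zn n)} {v w : Zn n} (hv : v ∈ A) (hw : w ∈ A)
    (h : v ≤ w ∨ w ≤ v) :
    ((comparabilityGraph n).induce A).Reachable ⟨v, hv⟩ ⟨w, hw⟩ := by
  rcases eq_or_ne v w with rfl | hne
  · rfl
  · exact SimpleGraph.Adj.reachable ((SimpleGraph.fromRel_adj _ _ _).2 ⟨hne, h⟩)

lemma mem_componentsMeeting_of_comparable {A C : Set (Zn n)} {v w : Zn n}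
    (hv : v ∈ componentsMeeting A C) (hw : w ∈ A) (h : v ≤ w ∨ w ≤ v) :
    w ∈ componentsMeeting A C := by
  obtain ⟨hv, u, hu, huC, hr⟩ := hv
  exact ⟨hw, u, hu, huC, (reachable_of_comparable hw hv h.symm).trans hr⟩

/-- A set of lattice points is connected if any two of its points are joined by a chain of
successively comparable points in the set. -/
def ComparablyConnected (T : Set (Zn n)) : Prop :=
  ∀ v ∈ T, ∀ w ∈ T, Relation.ReflTransGen (fun v w => v ∈ T ∧ w ∈ T ∧ (v ≤ w ∨ w ≤ v)) v w

/-- Connectedness and closure under comparability make `T` a single component of `A`; every point of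
`C` lies in it. -/
lemma componentsMeeting_eq {A C T : Set (Zn n)} (hCT : C ⊆ T) (hTA : T ⊆ A)
    (hC : C.Nonempty) (hT : ComparablyConnected T)
    (h : ∀ v ∈ T, ∀ w ∈ A, v ≤ w ∨ w ≤ v → w ∈ T) : componentsMeeting A C = T := by
  ext v
  constructor
  · rintro ⟨hv, w, hw, hwC, hr⟩
    obtain ⟨c⟩ := hr.symm
    have key : ∀ (a b : A) (_ : ((comparabilityGraph n).induce A).Walk a b), a.1 ∈ T → b.1 ∈ T := by
      intro a b c
      induction c with
      | nil => exact id
      | cons hadj _ ih =>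
        intro ha
        exact ih (h _ ha _ (Subtype.mem _) ((SimpleGraph.fromRel_adj _ _ _).1 hadj).2)
    exact key _ _ c (hCT hwC)
  · intro hv
    obtain ⟨w, hw⟩ := hC
    have key : ∀ w, Relation.ReflTransGen (fun v w => v ∈ T ∧ w ∈ T ∧ (v ≤ w ∨ w ≤ v)) v w →
        ∃ hw : w ∈ A, ((comparabilityGraph n).induce A).Reachable ⟨v, hTA hv⟩ ⟨w, hw⟩ := by
      intro w hvw
      induction hvw with
      | refl => exact ⟨hTA hv, .rfl⟩
      | tail _ hab ih =>
        obtain ⟨ha, hr⟩ := ih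
        exact ⟨hTA hab.2.1, hr.trans (reachable_of_comparable _ _ hab.2.2)⟩
    obtain ⟨hw', hr⟩ := key w (hT v hv w (hCT hw))
    exact ⟨hTA hv, w, hw', hw, hr⟩

lemma componentsMeeting_self (A : Set (Zn n)) : componentsMeeting A A = A :=
  (componentsMeeting_subset A A).antisymm (subset_componentsMeeting subset_rfl)

end Components

/-! ### Dependence of S-terms on Z(z,q,p,b) and B(z,q,p,b) only -/

section Uniqueness

open ExactCoupleSystem

variable {n : ℕ}

lemma Quad.diff_subset_zSet (x : Quad (Downsets n)) : (x.p : Set (Zn n)) \ x.q ⊆ x.zSet :=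
  subset_componentsMeeting (Set.sdiff_subset_sdiff_right x.hzq)

lemma Quad.diff_subset_bSet (x : Quad (Downsets n)) : (x.p : Set (Zn n)) \ x.q ⊆ x.bSet :=
  subset_componentsMeeting (Set.sdiff_subset_sdiff_left x.hpb)

/-- The downset `p \ Z(z,q,p,b)`. -/
def Quad.reducedZ (x : Quad (Downsets n)) : Downsets n where
  carrier := (x.p : Set (Zn n)) \ x.zSet
  lower' := fun v w hwv hv => by
    refine ⟨x.p.lower hwv hv.1, fun hw => hv.2 ?_⟩
    have hvz : v ∉ x.z := fun h => (componentsMeeting_subset _ _ hw).2 (x.z.lower hwv h)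
    exact mem_componentsMeeting_of_comparable hw ⟨hv.1, hvz⟩ (Or.inl hwv)

/-- The downset `q ∪ B(z,q,p,b)`. -/
def Quad.reducedB (x : Quad (Downsets n)) : Downsets n where
  carrier := (x.q : Set (Zn n)) ∪ x.bSet
  lower' := fun v w hwv hv => by
    by_cases hw : w ∈ x.q
    · exact Or.inl hw
    rcases hv with hv | hv
    · exact Or.inl (x.q.lower hwv hv)
    · exact Or.inr (mem_componentsMeeting_of_comparable hv
        ⟨x.b.lower hwv (componentsMeeting_subset _ _ hv).1, hw⟩ (Or.inr hwv))

/-- The complement in `p` of the components not in `Z(z,q,p,b)`. -/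
def Quad.complementZ (x : Quad (Downsets n)) : Downsets n where
  carrier := (x.z : Set (Zn n)) ∪ x.zSet
  lower' := fun v w hwv hv => by
    by_cases hw : w ∈ x.z
    · exact Or.inl hw
    rcases hv with hv | hv
    · exact Or.inl (x.z.lower hwv hv)
    · exact Or.inr (mem_componentsMeeting_of_comparable hv
        ⟨x.p.lower hwv (componentsMeeting_subset _ _ hv).1, hw⟩ (Or.inr hwv))

/-- The complement in `b` of `B(z,q,p,b)`. -/
def Quad.complementB (x : Quad (Downsets n)) : Downsets n where
  carrier := (x.b : Set (Zn n)) \ x.bSet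
  lower' := fun v w hwv hv => by
    refine ⟨x.b.lower hwv hv.1, fun hw => hv.2 ?_⟩
    have hvq : v ∉ x.q := fun h => (componentsMeeting_subset _ _ hw).2 (x.q.lower hwv h)
    exact mem_componentsMeeting_of_comparable hw ⟨hv.1, hvq⟩ (Or.inl hwv)

lemma Quad.mem_reducedZ (x : Quad (Downsets n)) (v : Zn n) :
    v ∈ x.reducedZ ↔ v ∈ x.p ∧ v ∉ x.zSet := Iff.rfl

lemma Quad.mem_reducedB (x : Quad (Downsets n)) (v : Zn n) :
    v ∈ x.reducedB ↔ v ∈ x.q ∨ v ∈ x.bSet := Iff.rfl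

lemma Quad.mem_complementZ (x : Quad (Downsets n)) (v : Zn n) :
    v ∈ x.complementZ ↔ v ∈ x.z ∨ v ∈ x.zSet := Iff.rfl

lemma Quad.mem_complementB (x : Quad (Downsets n)) (v : Zn n) :
    v ∈ x.complementB ↔ v ∈ x.b ∧ v ∉ x.bSet := Iff.rfl

lemma Quad.mem_zSet (x : Quad (Downsets n)) {v : Zn n} (h : v ∈ x.zSet) : v ∈ x.p ∧ v ∉ x.z :=
  componentsMeeting_subset _ _ h

lemma Quad.mem_bSet (x : Quad (Downsets n)) {v : Zn n} (h : v ∈ x.bSet) : v ∈ x.b ∧ v ∉ x.q :=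
  componentsMeeting_subset _ _ h

/-- The quadruple with `z` enlarged such that `p \ z = Z(z,q,p,b)`. -/
def Quad.reduceZ (x : Quad (Downsets n)) : Quad (Downsets n) where
  b := x.b
  p := x.p
  q := x.q
  z := x.reducedZ
  hpb := x.hpb
  hqp := x.hqp
  hzq := fun v hv => by
    by_contra h
    exact hv.2 (x.diff_subset_zSet ⟨hv.1, h⟩)

/-- The quadruple with `z` enlarged and `b` diminished such that `p \ z = Z(z,q,p,b)` and
`b \ q = B(z,q,p,b)`. -/
def Quad.reduce (x : Quad (Downsets n)) : Quad (Downsets n) where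
  b := x.reducedB
  p := x.p
  q := x.q
  z := x.reducedZ
  hpb := fun v hv => by
    by_cases h : v ∈ x.q
    · exact Or.inl h
    · exact Or.inr (x.diff_subset_bSet ⟨hv, h⟩)
  hqp := x.hqp
  hzq := x.reduceZ.hzq

lemma nonempty_iso_of_bijective {x y : Quad (Downsets n)} (f : Sterm.{u} x ⟶ Sterm.{u} y)
    (h : ∀ E, Function.Bijective (stermApp f E)) : Nonempty (Sterm.{u} x ≅ Sterm.{u} y) :=
  have := isIso_of_bijective f h
  ⟨asIso f⟩

/-- No element of `zSet` is comparable to the rest of p \ z, so z ∪ `zSet` and p \ `zSet` are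
downsets with join p and meet z. Excision makes E^p_z surject onto the corresponding group for the
larger z; injectivity is automatic as both terms are images in the same E^b_q. -/
lemma nonempty_iso_reduceZ (x : Quad (Downsets n)) :
    Nonempty (Sterm.{u} x ≅ Sterm.{u} x.reduceZ) := by
  have hz : x.z ≤ x.reducedZ := fun v hv =>
    ⟨(x.hzq.trans x.hqp) hv, fun h => (x.mem_zSet h).2 hv⟩
  refine nonempty_iso_of_bijective (stermMap x x.reduceZ le_rfl hz le_rfl le_rfl) fun E =>
    ⟨stermMap_injective _ _ _ _ _ _ _ fun _ => id, stermMap_surjective _ _ _ _ _ _ _ ?_⟩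
  refine E.property.surjective_of_sup hz (fun v hv => hv.1) x.complementZ ?_ ?_
  · ext v
    have := @x.mem_zSet _ v
    have := (x.hzq.trans x.hqp : x.z ≤ x.p) (a := v)
    simp only [LowerSet.mem_sup_iff, x.mem_complementZ, x.mem_reducedZ, SetLike.mem_coe] at *
    tauto
  · ext v
    have := @x.mem_zSet _ v
    have := (x.hzq.trans x.hqp : x.z ≤ x.p) (a := v)
    simp only [SetLike.mem_coe, LowerSet.mem_inf_iff, x.mem_complementZ, x.mem_reducedZ] at *
    tauto

/-- The change of b is dual to that of z: the source E^p_z stays fixed and E^{b'}_q → E^b_q is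
injective, because q ∪ `bSet` has the complement b \ `bSet` over q. -/
lemma nonempty_iso_reduce (x : Quad (Downsets n)) :
    Nonempty (Sterm.{u} x.reduce ≅ Sterm.{u} x) := by
  obtain ⟨e⟩ := nonempty_iso_reduceZ.{u} x
  suffices Nonempty (Sterm.{u} x.reduce ≅ Sterm.{u} x.reduceZ) from ⟨this.some ≪≫ e.symm⟩
  have hb : x.reducedB ≤ x.b := fun v hv => by
    rcases hv with hv | hv
    · exact (x.hqp.trans x.hpb) hv
    · exact (x.mem_bSet hv).1
  refine nonempty_iso_of_bijective (stermMap x.reduce x.reduceZ le_rfl le_rfl hb le_rfl) fun E =>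
    ⟨stermMap_injective _ _ _ _ _ _ _ fun ξ hξ => ?_,
      stermMap_surjective _ _ _ _ _ _ _ fun ξ => ⟨ξ, E.obj.ℓ_self _ ξ⟩⟩
  have inj : Function.Injective (E.obj.ℓ (q := x.reduce.q) (p := x.reduce.b)
      (x.reduce.hqp.trans x.reduce.hpb) (x.hqp.trans x.hpb) hb le_rfl) :=
    E.property.injective_of_inf (q := x.q) (b' := x.reducedB) (b := x.b)
    (x.reduce.hqp.trans x.reduce.hpb) hb x.complementB
    (by
      ext v
      have := @x.mem_bSet _ v
      have := (x.hqp.trans x.hpb : x.q ≤ x.b) (a := v)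
      simp only [SetLike.mem_coe, LowerSet.mem_sup_iff, x.mem_complementB, x.mem_reducedB] at *
      tauto)
    (by
      ext v
      have := @x.mem_bSet _ v
      have := (x.hqp.trans x.hpb : x.q ≤ x.b) (a := v)
      simp only [SetLike.mem_coe, LowerSet.mem_inf_iff, x.mem_complementB, x.mem_reducedB] at *
      tauto)
  exact (injective_iff_map_eq_zero _).1 inj _ ((E.obj.ℓ_ℓ ..).trans hξ)

/-- The componentwise infimum of two quadruples. -/
def Quad.inf (x y : Quad (Downsets n)) : Quad (Downsets n) :=
  ⟨x.b ⊓ y.b, x.p ⊓ y.p, x.q ⊓ y.q, x.z ⊓ y.z, inf_le_inf x.hpb y.hpb, inf_le_inf x.hqp y.hqp,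
    inf_le_inf x.hzq y.hzq⟩

lemma nonempty_iso_of_le {x y : Quad (Downsets n)} (hp : x.p ≤ y.p) (hz : x.z ≤ y.z)
    (hb : x.b ≤ y.b) (hq : x.q ≤ y.q) (hpz : (x.p : Set (Zn n)) \ x.z = (y.p : Set (Zn n)) \ y.z)
    (hbq : (x.b : Set (Zn n)) \ x.q = (y.b : Set (Zn n)) \ y.q) :
    Nonempty (Sterm.{u} x ≅ Sterm.{u} y) := by
  have key : ∀ {a c a' c' : Downsets n} (h : c ≤ a) (h' : c' ≤ a') (ha : a ≤ a') (hc : c ≤ c'),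
      (a : Set (Zn n)) \ c = (a' : Set (Zn n)) \ c' → ∀ E : ExcisiveSystems.{u} n,
      Function.Bijective (E.obj.ℓ h h' ha hc) := by
    intro a c a' c' h h' ha hc hac E
    have hv : ∀ v, (v ∈ a ∧ v ∉ c ↔ v ∈ a' ∧ v ∉ c') := fun v => by
      simpa only [Set.mem_sdiff, SetLike.mem_coe] using Set.ext_iff.1 hac v
    refine E.property.bijective_of h h' ha hc ?_ ?_
    · ext v
      have := hv v
      have := ha (a := v)
      have := h' (a := v)
      simp only [SetLike.mem_coe, LowerSet.mem_sup_iff] at *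
      tauto
    · ext v
      have := hv v
      have := h (a := v)
      have := hc (a := v)
      simp only [SetLike.mem_coe, LowerSet.mem_inf_iff] at *
      tauto
  refine nonempty_iso_of_bijective (stermMap x y hp hz hb hq) fun E =>
    ⟨stermMap_injective _ _ _ _ _ _ _ fun ξ hξ => ?_,
      stermMap_surjective _ _ _ _ _ _ _ (key _ _ _ _ hpz E).2⟩
  apply (injective_iff_map_eq_zero _).1
    (key (x.hqp.trans x.hpb) (y.hqp.trans y.hpb) hb hq hbq E).1
  rw [E.obj.ℓ_ℓ]
  exact hξ

/-- The two quadruples need not be comparable; their componentwise meet has the same differences and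
maps to both. -/
lemma nonempty_iso_of_diff_eq {x y : Quad (Downsets n)}
    (hpz : (x.p : Set (Zn n)) \ x.z = (y.p : Set (Zn n)) \ y.z)
    (hbq : (x.b : Set (Zn n)) \ x.q = (y.b : Set (Zn n)) \ y.q) :
    Nonempty (Sterm.{u} x ≅ Sterm.{u} y) := by
  have key : ∀ {a c a' c' : Downsets n}, (a : Set (Zn n)) \ c = (a' : Set (Zn n)) \ c' →
      ((a ⊓ a' : Downsets n) : Set (Zn n)) \ (c ⊓ c' : Downsets n) = (a : Set (Zn n)) \ c := by
    intro a c a' c' h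
    ext v
    have := Set.ext_iff.1 h v
    simp only [Set.mem_sdiff, SetLike.mem_coe, LowerSet.mem_inf_iff] at *
    tauto
  obtain ⟨e⟩ := nonempty_iso_of_le.{u} (x := x.inf y) (y := x) inf_le_left inf_le_left inf_le_left
    inf_le_left (key hpz) (key hbq)
  obtain ⟨e'⟩ := nonempty_iso_of_le.{u} (x := x.inf y) (y := y) inf_le_right inf_le_right
    inf_le_right inf_le_right ((key hpz).trans hpz) ((key hbq).trans hbq)
  exact ⟨e.symm ≪≫ e'⟩

/-- `S`-terms of excisive exact couple systems only depend on `Z(z,q,p,b)` and `B(z,q,p,b)`. -/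
lemma nonempty_iso_of_zSet_eq_of_bSet_eq {x y : Quad (Downsets n)} (hz : x.zSet = y.zSet)
    (hb : x.bSet = y.bSet) : Nonempty (Sterm.{u} x ≅ Sterm.{u} y) := by
  obtain ⟨e⟩ := nonempty_iso_reduce.{u} x
  obtain ⟨e'⟩ := nonempty_iso_reduce.{u} y
  have hz' : ∀ x : Quad (Downsets n),
      (x.reduce.p : Set (Zn n)) \ x.reduce.z = x.zSet := fun x => by
    ext v
    have := @x.mem_zSet _ v
    change v ∈ x.p ∧ ¬(v ∈ x.p ∧ v ∉ x.zSet) ↔ _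
    tauto
  have hb' : ∀ x : Quad (Downsets n),
      (x.reduce.b : Set (Zn n)) \ x.reduce.q = x.bSet := fun x => by
    ext v
    have := @x.mem_bSet _ v
    change (v ∈ x.q ∨ v ∈ x.bSet) ∧ v ∉ x.q ↔ _
    tauto
  obtain ⟨e''⟩ := nonempty_iso_of_diff_eq.{u} (x := x.reduce) (y := y.reduce)
    ((hz' x).trans (hz.trans (hz' y).symm)) ((hb' x).trans (hb.trans (hb' y).symm))
  exact ⟨e.symm ≪≫ e'' ≪≫ e'⟩

lemma Quad.Represents.nonempty_iso {x y : Quad (Downsets n)} {P : Zn n} {ω : Word n}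
    (hx : x.Represents P ω) (hy : y.Represents P ω) : Nonempty (Sterm.{u} x ≅ Sterm.{u} y) :=
  nonempty_iso_of_zSet_eq_of_bSet_eq (hx.1.trans hy.1.symm) (hx.2.trans hy.2.symm)

end Uniqueness

/-! ### Filtrations of S-terms by intermediate downsets -/

section Filtration

open ExactCoupleSystem

variable {n : ℕ}

/-- `0 → S^{yz}_{bq} → S^{pz}_{bq} → S^{pz}_{by} → 0` is exact. -/
lemma exact_stermMap_stermMap {b p y q z : Downsets n} (hpb : p ≤ b) (hyp : y ≤ p) (hqy : q ≤ y)
    (hzq : z ≤ q) (E : ExcisiveSystems.{u} n) :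
    Function.Exact
      (stermApp (stermMap ⟨b, y, q, z, hyp.trans hpb, hqy, hzq⟩
        ⟨b, p, q, z, hpb, hqy.trans hyp, hzq⟩ hyp le_rfl le_rfl le_rfl) E)
      (stermApp (stermMap ⟨b, p, q, z, hpb, hqy.trans hyp, hzq⟩
        ⟨b, p, y, z, hpb, hyp, hzq.trans hqy⟩ le_rfl le_rfl le_rfl hqy) E) := by
  intro s
  obtain ⟨ξ, rfl⟩ := E.obj.toS_surjective _ s
  rw [stermMap_toS, toS_eq_zero_iff]
  dsimp only
  rw [ℓ_self]
  constructor
  · intro h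
    rw [← E.obj.ℓ_ℓ _ (hzq.trans (hqy.trans (hyp.trans hpb))) _ hpb le_rfl le_rfl
      (hzq.trans hqy)] at h
    obtain ⟨η, hη⟩ := (E.obj.exact_ℓ_ℓ_triple (hyp.trans hpb) (hzq.trans hqy) _).1 h
    refine ⟨E.obj.toS _ η, ?_⟩
    rw [stermMap_toS, toS_eq_iff]
    dsimp only
    rw [E.obj.ℓ_ℓ, ← E.obj.ℓ_ℓ _ (hzq.trans (hqy.trans (hyp.trans hpb))) _ (hyp.trans hpb) le_rfl
      le_rfl hzq, hη, E.obj.ℓ_ℓ]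
  · rintro ⟨t, ht⟩
    obtain ⟨ζ, rfl⟩ := E.obj.toS_surjective _ t
    rw [stermMap_toS, toS_eq_iff] at ht
    dsimp only at ht
    have h := congrArg (E.obj.ℓ (hqy.trans (hyp.trans hpb)) (hyp.trans hpb) le_rfl hqy) ht
    rw [E.obj.ℓ_ℓ, E.obj.ℓ_ℓ, E.obj.ℓ_ℓ] at h
    rw [← h, E.obj.ℓ_eq_zero _ _ _ _ le_rfl]

lemma nonempty_cokernel_stermMap_iso {b p y q z : Downsets n} (hpb : p ≤ b) (hyp : y ≤ p)
    (hqy : q ≤ y) (hzq : z ≤ q) :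
    Nonempty (cokernel (stermMap.{u} ⟨b, y, q, z, hyp.trans hpb, hqy, hzq⟩
        ⟨b, p, q, z, hpb, hqy.trans hyp, hzq⟩ hyp le_rfl le_rfl le_rfl) ≅
      Sterm.{u} ⟨b, p, y, z, hpb, hyp, hzq.trans hqy⟩) := by
  let f := stermMap.{u} ⟨b, y, q, z, hyp.trans hpb, hqy, hzq⟩
        ⟨b, p, q, z, hpb, hqy.trans hyp, hzq⟩ hyp le_rfl le_rfl le_rfl
  let g := stermMap.{u} ⟨b, p, q, z, hpb, hqy.trans hyp, hzq⟩
        ⟨b, p, y, z, hpb, hyp, hzq.trans hqy⟩ le_rfl le_rfl le_rfl hqy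
  have w : f ≫ g = 0 := by
    ext E s
    exact (exact_stermMap_stermMap hpb hyp hqy hzq E).apply_apply_eq_zero s
  have : Epi g := epi_stermMap_of_p_eq _ _ _ _ _ _ le_rfl le_rfl
  have hg := (exact_of_function_exact (ShortComplex.mk f g w)
    (exact_stermMap_stermMap hpb hyp hqy hzq)).gIsCokernel
  exact ⟨(cokernelIsCokernel f).coconePointUniqueUpToIso hg⟩

lemma nonempty_cokernel_ofLE_iso {A B D : ExcisiveSystems.{u} n ⥤ AddCommGrpCat.{u}}
    (f : A ⟶ D) (g : B ⟶ D) [Mono f] [Mono g] (h : A ⟶ B) (w : h ≫ g = f)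
    (hle : Subobject.mk f ≤ Subobject.mk g) :
    Nonempty (cokernel (Subobject.ofLE _ _ hle) ≅ cokernel h) :=
  ⟨cokernel.mapIso _ _ (Subobject.underlyingIso f) (Subobject.underlyingIso g) (by
    rw [← cancel_mono g]
    simp [w])⟩

/-- A filtration of an `S`-term by an increasing sequence of intermediate downsets. -/
lemma exists_filtration {b p q z : Downsets n} (hpb : p ≤ b) (hqp : q ≤ p) (hzq : z ≤ q)
    {G : ExcisiveSystems.{u} n ⥤ AddCommGrpCat.{u}}
    (e : Sterm.{u} ⟨b, p, q, z, hpb, hqp, hzq⟩ ≅ G) (r : ℤ →o Downsets n) (hr : ∀ i, r i ≤ p)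
    (hr' : ∀ i, q ≤ r i) :
    ∃ F : ℤ →o Subobject G, ∀ i : ℤ,
      Nonempty (cokernel (Subobject.ofLE (F (i - 1)) (F i)
          (F.monotone (sub_le_self i zero_le_one))) ≅
        Sterm.{u} ⟨b, r i, r (i - 1), z, (hr i).trans hpb, r.monotone (sub_le_self i zero_le_one),
          hzq.trans (hr' _)⟩) := by
  let f : ∀ i, Sterm.{u} ⟨b, r i, q, z, (hr i).trans hpb, hr' i, hzq⟩ ⟶ G := fun i =>
    stermMap _ ⟨b, p, q, z, hpb, hqp, hzq⟩ (hr i) le_rfl le_rfl le_rfl ≫ e.hom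
  have hf : ∀ i, Mono (f i) := fun i =>
    have := mono_stermMap_of_q_eq.{u} ⟨b, r i, q, z, (hr i).trans hpb, hr' i, hzq⟩
      ⟨b, p, q, z, hpb, hqp, hzq⟩ (hr i) le_rfl le_rfl le_rfl le_rfl le_rfl
    mono_comp _ _
  have hfg : ∀ i j (h : i ≤ j), stermMap
      ⟨b, r i, q, z, (hr i).trans hpb, hr' i, hzq⟩ ⟨b, r j, q, z, (hr j).trans hpb, hr' j, hzq⟩
      (r.monotone h) le_rfl le_rfl le_rfl ≫ f j = f i := by
    intro i j h
    simp only [f, ← Category.assoc, stermMap_comp]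
  refine ⟨⟨fun i => Subobject.mk (f i), fun i j h => ?_⟩, fun i => ?_⟩
  · exact Subobject.mk_le_mk_of_comm _ (hfg i j h)
  · obtain ⟨e₁⟩ := nonempty_cokernel_ofLE_iso (f (i - 1)) (f i) _
      (hfg (i - 1) i (sub_le_self i zero_le_one))
      (Subobject.mk_le_mk_of_comm _ (hfg (i - 1) i (sub_le_self i zero_le_one)))
    obtain ⟨e₂⟩ := nonempty_cokernel_stermMap_iso.{u} ((hr i).trans hpb)
      (r.monotone (sub_le_self i zero_le_one)) (hr' _) hzq
    exact ⟨e₁ ≪≫ e₂⟩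

end Filtration

/-! ### The combinatorics of words -/

/-- The letters `j` and the pairs of letters `j^∞ ext`. -/
inductive Step (n : ℕ) : Type
  | fin (j : Fin n) : Step n
  | ext (j : Fin n) : Step n

namespace Step

/-! ### Linear maps on ℤⁿ attached to single letters -/

section Elementary

variable {n : ℕ}

/-- The standard basis vectors. -/
abbrev unitVec (i : Fin n) : Zn n := Pi.single i 1

/-- The sum of the coordinates. -/
def deg (n : ℕ) : Zn n →+ ℤ where
  toFun x := ∑ k, x k
  map_zero' := by simp
  map_add' x y := by simp [Finset.sum_add_distrib]

lemma deg_apply (x : Zn n) : deg n x = ∑ k, x k := rfl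

lemma deg_nonneg {x : Zn n} (h : 0 ≤ x) : 0 ≤ deg n x := by
  rw [deg_apply]
  exact Finset.sum_nonneg fun k _ => h k

lemma eq_zero_of_deg_eq_zero {x : Zn n} (h : 0 ≤ x) (h' : deg n x = 0) : x = 0 := by
  rw [deg_apply] at h'
  funext k
  exact (Finset.sum_eq_zero_iff_of_nonneg fun k _ => h k).1 h' k (Finset.mem_univ k)

lemma deg_unitVec (i : Fin n) : deg n (unitVec i) = 1 := by
  simp [deg]

lemma unitVec_nonneg (i : Fin n) : (0 : Zn n) ≤ unitVec i :=
  Pi.single_nonneg.2 zero_le_one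

/-- The linear map that sends `e_i` to `e_i` and `e_k` to `e_k + e_i` for `k ≠ i`. -/
def psi (i : Fin n) : Zn n →+ Zn n where
  toFun x := x + (deg n x - x i) • unitVec i
  map_zero' := by simp
  map_add' x y := by
    rw [map_add, Pi.add_apply]
    module

/-- The inverse of `psi i`. -/
def phi (i : Fin n) : Zn n →+ Zn n where
  toFun x := x - (deg n x - x i) • unitVec i
  map_zero' := by simp
  map_add' x y := by
    rw [map_add, Pi.add_apply]
    module

/-- The linear map that annihilates the coordinate `i`. -/
def killCoord (i : Fin n) : Zn n →+ Zn n where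
  toFun x := x - x i • unitVec i
  map_zero' := by simp
  map_add' x y := by
    rw [Pi.add_apply]
    module

lemma psi_apply (i : Fin n) (x : Zn n) : psi i x = x + (deg n x - x i) • unitVec i := rfl

lemma phi_apply (i : Fin n) (x : Zn n) : phi i x = x - (deg n x - x i) • unitVec i := rfl

lemma killCoord_apply (i : Fin n) (x : Zn n) : killCoord i x = x - x i • unitVec i := rfl

@[simp]
lemma psi_phi (i : Fin n) (x : Zn n) : psi i (phi i x) = x := by
  have : deg n (phi i x) - phi i x i = deg n x - x i := by
    rw [phi_apply, map_sub, map_zsmul, deg_unitVec]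
    simp
  rw [psi_apply, this, phi_apply]
  abel

@[simp]
lemma phi_psi (i : Fin n) (x : Zn n) : phi i (psi i x) = x := by
  have : deg n (psi i x) - psi i x i = deg n x - x i := by
    rw [psi_apply, map_add, map_zsmul, deg_unitVec]
    simp
  rw [phi_apply, this, psi_apply]
  abel

@[simp]
lemma psi_unitVec_self (i : Fin n) : psi i (unitVec i) = unitVec i := by
  simp [psi_apply, deg_unitVec]

lemma psi_unitVec_of_ne {i k : Fin n} (h : k ≠ i) :
    psi i (unitVec k) = unitVec k + unitVec i := by
  simp [psi_apply, deg_unitVec, h.symm]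

@[simp]
lemma killCoord_unitVec_self (i : Fin n) : killCoord i (unitVec i) = 0 := by
  simp [killCoord_apply]

lemma killCoord_eq_self {i : Fin n} {x : Zn n} (h : x i = 0) : killCoord i x = x := by
  simp [killCoord_apply, h]

lemma killCoord_unitVec_of_ne {i k : Fin n} (h : k ≠ i) : killCoord i (unitVec k) = unitVec k :=
  killCoord_eq_self (by simp [h.symm])

lemma psi_apply_of_ne {i k : Fin n} (h : k ≠ i) (x : Zn n) : psi i x k = x k := by
  simp [psi_apply, h]

lemma psi_apply_self (i : Fin n) (x : Zn n) : psi i x i = deg n x := by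
  simp [psi_apply]

lemma phi_apply_of_ne {i k : Fin n} (h : k ≠ i) (x : Zn n) : phi i x k = x k := by
  simp [phi_apply, h]

lemma killCoord_apply_of_ne {i k : Fin n} (h : k ≠ i) (x : Zn n) : killCoord i x k = x k := by
  simp [killCoord_apply, h]

/-- The coordinate `i` of `psi i x` is the sum of all coordinates of `x`. -/
lemma psi_sub_smul_nonneg {i : Fin n} {x : Zn n} (h : 0 ≤ x) {m : ℤ} (hm : m ≤ deg n x) :
    0 ≤ psi i x - m • unitVec i := by
  intro k
  by_cases hk : k = i
  · subst hk
    simpa [psi_apply_self] using hm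
  · simpa [psi_apply_of_ne hk, hk] using h k

lemma psi_nonneg {i : Fin n} {x : Zn n} (h : 0 ≤ x) : 0 ≤ psi i x := by
  simpa using psi_sub_smul_nonneg (i := i) h (deg_nonneg h)

lemma killCoord_nonneg {i : Fin n} {x : Zn n} (h : 0 ≤ x) : 0 ≤ killCoord i x := by
  intro k
  by_cases hk : k = i
  · subst hk
    simp [killCoord_apply]
  · simpa [killCoord_apply_of_ne hk] using h k

lemma killCoord_mono {i : Fin n} {x y : Zn n} (h : x ≤ y) : killCoord i x ≤ killCoord i y := by
  rw [← sub_nonneg, ← map_sub]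
  exact killCoord_nonneg (sub_nonneg.2 h)

lemma one_le_deg_of_lt {x y : Zn n} (h : x < y) : 1 ≤ deg n (y - x) := by
  have h0 := sub_nonneg.2 h.le
  have h1 := deg_nonneg h0
  rcases eq_or_lt_of_le h1 with h2 | h2
  · exact absurd (sub_eq_zero.1 (eq_zero_of_deg_eq_zero h0 h2.symm)) h.ne'
  · omega

/-- A strict inequality raises the total degree by at least 1, and coordinate i of `psi i` is the
total degree. The spare unit vector absorbs the alternative between `psi i x` and `psi i x - unitVec
i` in the recursion for `B`. -/
lemma psi_add_le_psi {i : Fin n} {x y : Zn n} (h : x < y) :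
    psi i x + unitVec i ≤ psi i y := by
  have := psi_sub_smul_nonneg (i := i) (sub_nonneg.2 h.le) (one_le_deg_of_lt h)
  rw [map_sub, one_smul, sub_sub, sub_nonneg] at this
  exact this

end Elementary

/-! ### Recursion on words from the left -/

variable {n : ℕ}

/-- A monotone functional, with value `1` on all `δ^k_ω` for `k ∉ X(ω)`, and `0` on `V_ω`. -/
def height : List (Step n) → Zn n →+ ℤ
  | [] => deg n
  | fin i :: w => (height w).comp (psi i)
  | ext i :: w => (height w).comp (killCoord i)

/-- The lattice `V_ω`, by recursion on `ω` from the left. -/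
def V : List (Step n) → AddSubgroup (Zn n)
  | [] => ⊥
  | fin i :: w => (V w).comap (psi i)
  | ext i :: w => (V w).comap (killCoord i)

/-- The set `B_ω`, by recursion on `ω` from the left. -/
def B : List (Step n) → Set (Zn n)
  | [] => {0}
  | fin i :: w => {x | psi i x ∈ B w ∨ psi i x - unitVec i ∈ B w}
  | ext i :: w => {x | killCoord i x ∈ B w}

/-- The vectors `δ^k_ω`, by recursion on `ω` from the left. -/
def delta : List (Step n) → Fin n → Zn n
  | [], k => unitVec k
  | fin i :: w, k => phi i (delta w k)
  | ext i :: w, k => if k = i then unitVec i else delta w k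

/-- The top element of `B_ω`, modulo `V_ω`. -/
def top : List (Step n) → Zn n
  | [] => 0
  | fin i :: w => unitVec i + phi i (top w)
  | ext _ :: w => top w

/-- After `ext j`, neither `fin j` nor `ext j` appears. -/
def Good (w : List (Step n)) : Prop :=
  w.Pairwise fun a b => ∀ j, a = ext j → b ≠ fin j ∧ b ≠ ext j

lemma good_fin_cons {i : Fin n} {w : List (Step n)} : Good (fin i :: w) ↔ Good w := by
  simp [Good]

lemma good_ext_cons {i : Fin n} {w : List (Step n)} :
    Good (ext i :: w) ↔ (fin i ∉ w ∧ ext i ∉ w) ∧ Good w := by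
  simp only [Good, List.pairwise_cons, ext.injEq, forall_eq']
  refine and_congr_left fun _ => ⟨fun h => ⟨fun h' => (h _ h').1 rfl, fun h' => (h _ h').2 rfl⟩,
    fun h b hb => ⟨?_, ?_⟩⟩
  · rintro rfl
    exact h.1 hb
  · rintro rfl
    exact h.2 hb

lemma good_append_fin {j : Fin n} {w : List (Step n)} :
    Good (w ++ [fin j]) ↔ Good w ∧ ext j ∉ w := by
  simp only [Good, List.pairwise_append, List.pairwise_singleton, true_and, List.mem_singleton,
    forall_eq]
  refine and_congr_right fun _ => ⟨fun h h' => (h _ h' j rfl).1 rfl, fun h a ha k hk => ?_⟩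
  subst hk
  refine ⟨fun h' => ?_, by simp⟩
  rw [fin.injEq] at h'
  subst h'
  exact h ha

lemma good_append_ext {j : Fin n} {w : List (Step n)} :
    Good (w ++ [ext j]) ↔ Good w ∧ ext j ∉ w := by
  simp only [Good, List.pairwise_append, List.pairwise_singleton, true_and, List.mem_singleton,
    forall_eq]
  refine and_congr_right fun _ => ⟨fun h h' => (h _ h' j rfl).2 rfl, fun h a ha k hk => ?_⟩
  subst hk
  refine ⟨by simp, fun h' => ?_⟩
  rw [ext.injEq] at h'
  subst h'
  exact h ha

/-! #### Coordinates that do not occur -/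

/-- Only steps belonging to i alter coordinate i. In a good list this applies to the tail after `ext
i`, so there `killCoord i` fixes the top element and all `delta w k` with k ≠ i. -/
lemma apply_eq_zero_of_mem_B {j : Fin n} {w : List (Step n)} (hf : fin j ∉ w) (he : ext j ∉ w)
    {x : Zn n} (hx : x ∈ B w) : x j = 0 := by
  induction w generalizing x with
  | nil => rw [show x = 0 from hx]; rfl
  | cons a w ih =>
    simp only [List.mem_cons, not_or] at hf he
    cases a with
    | fin i =>
      have hne : j ≠ i := fun h => hf.1 (by rw [h])
      rcases hx with hx | hx
      · have := ih hf.2 he.2 hx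
        rwa [psi_apply_of_ne hne] at this
      · have := ih hf.2 he.2 hx
        rwa [Pi.sub_apply, psi_apply_of_ne hne, unitVec, Pi.single_eq_of_ne hne, sub_zero] at this
    | ext i =>
      have hne : j ≠ i := fun h => he.1 (by rw [h])
      have := ih hf.2 he.2 hx
      rwa [killCoord_apply_of_ne hne] at this

lemma top_apply_eq_zero {j : Fin n} {w : List (Step n)} (hf : fin j ∉ w) (he : ext j ∉ w) :
    top w j = 0 := by
  induction w with
  | nil => rfl
  | cons a w ih =>
    simp only [List.mem_cons, not_or] at hf he
    cases a with
    | fin i =>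
      have hne : j ≠ i := fun h => hf.1 (by rw [h])
      simp [top, phi_apply_of_ne hne, ih hf.2 he.2, hne]
    | ext i => exact ih hf.2 he.2

lemma delta_apply_eq_zero {j k : Fin n} (hk : k ≠ j) {w : List (Step n)} (hf : fin j ∉ w)
    (he : ext j ∉ w) : delta w k j = 0 := by
  induction w with
  | nil => simp [delta, hk.symm]
  | cons a w ih =>
    simp only [List.mem_cons, not_or] at hf he
    cases a with
    | fin i =>
      have hne : j ≠ i := fun h => hf.1 (by rw [h])
      simp [delta, phi_apply_of_ne hne, ih hf.2 he.2]
    | ext i =>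
      have hne : j ≠ i := fun h => he.1 (by rw [h])
      simp only [delta]
      split_ifs
      · simp [hne]
      · exact ih hf.2 he.2

lemma killCoord_top {i : Fin n} {w : List (Step n)} (h : Good (ext i :: w)) :
    killCoord i (top w) = top w :=
  killCoord_eq_self (top_apply_eq_zero (good_ext_cons.1 h).1.1 (good_ext_cons.1 h).1.2)

lemma killCoord_delta {i k : Fin n} (hk : k ≠ i) {w : List (Step n)} (h : Good (ext i :: w)) :
    killCoord i (delta w k) = delta w k :=
  killCoord_eq_self (delta_apply_eq_zero hk (good_ext_cons.1 h).1.1 (good_ext_cons.1 h).1.2)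

/-! #### Recursion from the right -/

-- Reconciles the recursion from the left with the defining one from the right. Prefixing `fin i` is
-- linear on all vectors δ^k; after `ext i` goodness forces j ≠ i, so the exceptional value of δ^i
-- is never subtracted from another vector.
open Classical in
lemma delta_append_fin {j : Fin n} {w : List (Step n)} (h : Good (w ++ [fin j])) (k : Fin n) :
    delta (w ++ [fin j]) k = delta w k - if k = j ∨ ext k ∈ w then 0 else delta w j := by
  induction w with
  | nil =>
    by_cases hk : k = j
    · simp [delta, phi_apply, deg_unitVec, hk]
    · simp [delta, phi_apply, deg_unitVec, hk]
  | cons a w ih =>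
    cases a with
    | fin i =>
      simp only [List.cons_append, delta, ih (good_fin_cons.1 h), map_sub, List.mem_cons,
        reduceCtorEq, false_or]
      split_ifs <;> simp
    | ext i =>
      rw [List.cons_append] at h
      have hji : j ≠ i := by
        rintro rfl
        simpa using (good_ext_cons.1 h).1.1
      simp only [List.cons_append, delta, ih (good_ext_cons.1 h).2, List.mem_cons, ext.injEq, hji,
        if_false]
      by_cases hki : k = i
      · simp [hki]
      · simp [hki]

lemma delta_append_ext {j : Fin n} {w : List (Step n)} (k : Fin n) :
    delta (w ++ [ext j]) k = delta w k := by
  induction w with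
  | nil => simp only [List.nil_append, delta]; split_ifs with h <;> simp [h]
  | cons a w ih => cases a <;> simp [delta, ih]

lemma top_append_fin {j : Fin n} {w : List (Step n)} (h : Good (w ++ [fin j])) :
    top (w ++ [fin j]) = top w + delta w j := by
  induction w with
  | nil => simp [top, delta]
  | cons a w ih =>
    cases a with
    | fin i => simp [top, delta, ih (good_fin_cons.1 h), add_assoc]
    | ext i =>
      rw [List.cons_append] at h
      have hji : j ≠ i := by
        rintro rfl
        simpa using (good_ext_cons.1 h).1.1
      simp [top, delta, ih (good_ext_cons.1 h).2, hji]

lemma top_append_ext {j : Fin n} {w : List (Step n)} : top (w ++ [ext j]) = top w := by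
  induction w with
  | nil => rfl
  | cons a w ih => cases a <;> simp [top, ih]

lemma V_append_fin {j : Fin n} {w : List (Step n)} : V (w ++ [fin j]) = V w := by
  induction w with
  | nil =>
    ext x
    simp only [List.nil_append, V, AddSubgroup.mem_comap, AddSubgroup.mem_bot]
    refine ⟨fun h => ?_, fun h => by rw [h, map_zero]⟩
    rw [← phi_psi j x, h, map_zero]
  | cons a w ih => cases a <;> simp [V, ih]

lemma mem_V_append_ext {j : Fin n} {w : List (Step n)} (h : Good (w ++ [ext j])) {x : Zn n} :
    x ∈ V (w ++ [ext j]) ↔ ∃ m : ℤ, x - m • delta w j ∈ V w := by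
  induction w generalizing x with
  | nil =>
    simp only [List.nil_append, V, AddSubgroup.mem_comap, AddSubgroup.mem_bot, delta,
      killCoord_apply]
    refine ⟨fun h => ⟨x j, h⟩, fun ⟨m, hm⟩ => ?_⟩
    rw [sub_eq_zero] at hm
    rw [hm]
    simp
  | cons a w ih =>
    cases a with
    | fin i => simp [V, delta, ih (good_fin_cons.1 h), -zsmul_eq_mul, map_zsmul]
    | ext i =>
      rw [List.cons_append] at h
      have hji : j ≠ i := by
        rintro rfl
        simpa using (good_ext_cons.1 h).1.2
      have hg : Good (ext i :: w) := good_ext_cons.2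
        ⟨⟨fun h' => (good_ext_cons.1 h).1.1 (by simp [h']),
          fun h' => (good_ext_cons.1 h).1.2 (by simp [h'])⟩,
          (good_append_ext.1 (good_ext_cons.1 h).2).1⟩
      simp [V, delta, ih (good_ext_cons.1 h).2, hji, killCoord_delta hji hg, -zsmul_eq_mul,
        map_zsmul]

lemma mem_B_append_fin {j : Fin n} {w : List (Step n)} (h : Good (w ++ [fin j])) {x : Zn n} :
    x ∈ B (w ++ [fin j]) ↔ x ∈ B w ∨ x - delta w j ∈ B w := by
  induction w generalizing x with
  | nil =>
    simp only [List.nil_append, B, delta, Set.mem_ofPred_eq, Set.mem_singleton_iff]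
    have : psi j x - unitVec j = psi j (x - unitVec j) := by simp
    rw [this, ← (phi_psi j x), psi_phi]
    have h0 : ∀ y : Zn n, psi j y = 0 ↔ y = 0 := fun y =>
      ⟨fun h => by rw [← phi_psi j y, h, map_zero], fun h => by rw [h, map_zero]⟩
    rw [h0, h0, phi_psi]
  | cons a w ih =>
    cases a with
    | fin i =>
      simp only [List.cons_append, B, delta, ih (good_fin_cons.1 h), Set.mem_ofPred_eq, map_sub,
        psi_phi, sub_right_comm]
      tauto
    | ext i =>
      rw [List.cons_append] at h
      have hji : j ≠ i := by
        rintro rfl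
        simpa using (good_ext_cons.1 h).1.1
      have hg : Good (ext i :: w) := good_ext_cons.2
        ⟨⟨fun h' => (good_ext_cons.1 h).1.1 (by simp [h']),
          fun h' => (good_ext_cons.1 h).1.2 (by simp [h'])⟩,
          (good_append_fin.1 (good_ext_cons.1 h).2).1⟩
      simp [B, delta, ih (good_ext_cons.1 h).2, hji, killCoord_delta hji hg]

lemma mem_B_append_ext {j : Fin n} {w : List (Step n)} (h : Good (w ++ [ext j])) {x : Zn n} :
    x ∈ B (w ++ [ext j]) ↔ ∃ m : ℤ, x - m • delta w j ∈ B w := by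
  induction w generalizing x with
  | nil =>
    simp only [List.nil_append, B, delta, Set.mem_ofPred_eq, Set.mem_singleton_iff,
      killCoord_apply]
    refine ⟨fun h => ⟨x j, h⟩, fun ⟨m, hm⟩ => ?_⟩
    rw [sub_eq_zero] at hm
    rw [hm]
    simp
  | cons a w ih =>
    cases a with
    | fin i =>
      simp only [List.cons_append, B, delta, ih (good_fin_cons.1 h), Set.mem_ofPred_eq, map_sub,
        map_zsmul, psi_phi, sub_right_comm _ (unitVec i)]
      exact exists_or.symm
    | ext i =>
      rw [List.cons_append] at h
      have hji : j ≠ i := by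
        rintro rfl
        simpa using (good_ext_cons.1 h).1.2
      have hg : Good (ext i :: w) := good_ext_cons.2
        ⟨⟨fun h' => (good_ext_cons.1 h).1.1 (by simp [h']),
          fun h' => (good_ext_cons.1 h).1.2 (by simp [h'])⟩,
          (good_append_ext.1 (good_ext_cons.1 h).2).1⟩
      simp [B, delta, ih (good_ext_cons.1 h).2, hji, killCoord_delta hji hg, -zsmul_eq_mul,
        map_zsmul]

/-! #### Heights -/

lemma height_nonneg (w : List (Step n)) {x : Zn n} (h : 0 ≤ x) : 0 ≤ height w x := by
  induction w generalizing x with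
  | nil => exact deg_nonneg h
  | cons a w ih =>
    cases a with
    | fin i => exact ih (psi_nonneg h)
    | ext i => exact ih (killCoord_nonneg h)

lemma height_mono (w : List (Step n)) {x y : Zn n} (h : x ≤ y) : height w x ≤ height w y := by
  rw [← sub_nonneg, ← map_sub]
  exact height_nonneg w (sub_nonneg.2 h)

lemma height_eq_zero_of_mem_V {w : List (Step n)} {x : Zn n} (h : x ∈ V w) : height w x = 0 := by
  induction w generalizing x with
  | nil => rw [show x = 0 from h, map_zero]
  | cons a w ih => cases a <;> exact ih h

/-- `psi i` and `killCoord i` preserve nonnegativity, and for the empty word a nonnegative vector of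
degree 0 vanishes. -/
lemma mem_V_of_nonneg {w : List (Step n)} {x : Zn n} (h : 0 ≤ x) (h' : height w x = 0) :
    x ∈ V w := by
  induction w generalizing x with
  | nil => exact eq_zero_of_deg_eq_zero h h'
  | cons a w ih =>
    cases a with
    | fin i => exact ih (psi_nonneg h) h'
    | ext i => exact ih (killCoord_nonneg h) h'

lemma add_mem_B {w : List (Step n)} {x y : Zn n} (hx : x ∈ B w) (hy : y ∈ V w) : x + y ∈ B w := by
  induction w generalizing x y with
  | nil => rw [show x = 0 from hx, show y = 0 from hy]; exact add_zero _
  | cons a w ih =>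
    cases a with
    | fin i =>
      refine hx.imp (fun h => ?_) fun h => ?_
      · rw [map_add]; exact ih h hy
      · rw [map_add, add_sub_right_comm]; exact ih h hy
    | ext i =>
      change killCoord i (x + y) ∈ B w
      rw [map_add]
      exact ih hx hy

lemma zero_mem_B (w : List (Step n)) : (0 : Zn n) ∈ B w := by
  induction w with
  | nil => rfl
  | cons a w ih =>
    cases a with
    | fin i => exact Or.inl (by rwa [map_zero])
    | ext i => change killCoord i 0 ∈ B w; rwa [map_zero]

lemma mem_B_of_mem_V {w : List (Step n)} {x : Zn n} (h : x ∈ V w) : x ∈ B w := by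
  simpa using add_mem_B (zero_mem_B w) h

/-- The reflection exchanges the two alternatives in the recursion for `fin i`. It converts
statements about lower levels of `B` into statements about upper levels. -/
lemma top_sub_mem_B {w : List (Step n)} (hw : Good w) {x : Zn n} (hx : x ∈ B w) :
    top w - x ∈ B w := by
  induction w generalizing x with
  | nil => rw [show x = 0 from hx]; exact sub_zero _
  | cons a w ih =>
    cases a with
    | fin i =>
      have key : psi i (top (fin i :: w) - x) = unitVec i + top w - psi i x := by
        simp [top]
      rcases hx with hx | hx
      · refine Or.inr ?_
        rw [key, add_sub_assoc, add_sub_cancel_left]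
        exact ih (good_fin_cons.1 hw) hx
      · refine Or.inl ?_
        rw [key, add_comm, ← sub_sub_eq_add_sub]
        exact ih (good_fin_cons.1 hw) hx
    | ext i =>
      change killCoord i (top w - x) ∈ B w
      rw [map_sub, killCoord_top hw]
      exact ih (good_ext_cons.1 hw).2 hx

lemma height_top_cons_fin (i : Fin n) (w : List (Step n)) :
    height (fin i :: w) (top (fin i :: w)) = height w (unitVec i) + height w (top w) := by
  simp [height, top]

lemma height_nonneg_of_mem_B {w : List (Step n)} {x : Zn n} (hx : x ∈ B w) : 0 ≤ height w x := by
  induction w generalizing x with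
  | nil => rw [show x = 0 from hx, map_zero]
  | cons a w ih =>
    cases a with
    | fin i =>
      rcases hx with hx | hx
      · exact ih hx
      · have h1 := ih hx
        have h2 := height_nonneg w (unitVec_nonneg i)
        rw [map_sub] at h1
        change 0 ≤ height w (psi i x)
        linarith
    | ext i => exact ih hx

lemma height_le_of_mem_B {w : List (Step n)} (hw : Good w) {x : Zn n} (hx : x ∈ B w) :
    height w x ≤ height w (top w) := by
  have := height_nonneg_of_mem_B (top_sub_mem_B hw hx)
  rwa [map_sub, sub_nonneg] at this

/-- The alternative `psi i x - unitVec i ∈ B w` is compatible with height 0 only if `unitVec i` has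
height 0, and then `unitVec i` itself lies in `V w`. -/
lemma mem_V_of_mem_B {w : List (Step n)} {x : Zn n} (hx : x ∈ B w) (h : height w x = 0) :
    x ∈ V w := by
  induction w generalizing x with
  | nil => exact hx
  | cons a w ih =>
    cases a with
    | fin i =>
      rcases hx with hx | hx
      · exact ih hx h
      · have h1 := height_nonneg_of_mem_B hx
        have h2 := height_nonneg w (unitVec_nonneg i)
        change height w (psi i x) = 0 at h
        rw [map_sub, h] at h1
        have h3 : height w (unitVec i) = 0 := by linarith
        have h4 := add_mem (ih hx (by rw [map_sub, h, h3, sub_zero]))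
          (mem_V_of_nonneg (unitVec_nonneg i) h3)
        rwa [sub_add_cancel] at h4
    | ext i => exact ih hx h

lemma top_sub_mem_V_of_mem_B {w : List (Step n)} (hw : Good w) {x : Zn n} (hx : x ∈ B w)
    (h : height w x = height w (top w)) : top w - x ∈ V w :=
  mem_V_of_mem_B (top_sub_mem_B hw hx) (by rw [map_sub, h, sub_self])

lemma top_mem_B {w : List (Step n)} (hw : Good w) : top w ∈ B w := by
  simpa using top_sub_mem_B hw (zero_mem_B w)

lemma height_top_nonneg {w : List (Step n)} (hw : Good w) : 0 ≤ height w (top w) :=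
  height_nonneg_of_mem_B (top_mem_B hw)

lemma height_delta {w : List (Step n)} {k : Fin n} (hw : Good w) (hk : ext k ∉ w) :
    height w (delta w k) = 1 := by
  induction w with
  | nil => exact deg_unitVec k
  | cons a w ih =>
    simp only [List.mem_cons, not_or] at hk
    cases a with
    | fin i => simpa [height, delta] using ih (good_fin_cons.1 hw) hk.2
    | ext i =>
      have hne : k ≠ i := fun h => hk.1 (by rw [h])
      simpa [height, delta, hne, killCoord_delta hne hw] using ih (good_ext_cons.1 hw).2 hk.2

/-- This bound makes the period N + W in `periodic_convex` at most 2N + 1, which is the hypothesis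
of `exists_mul_mem_Icc`. -/
lemma height_unitVec_le {w : List (Step n)} (hw : Good w) (k : Fin n) :
    height w (unitVec k) ≤ height w (top w) + 1 := by
  induction w with
  | nil => simp [height, top, deg_unitVec]
  | cons a w ih =>
    cases a with
    | fin i =>
      have h1 := ih (good_fin_cons.1 hw)
      have h2 := height_nonneg w (unitVec_nonneg i)
      have h3 := height_top_nonneg (good_fin_cons.1 hw)
      rw [height_top_cons_fin]
      by_cases hk : k = i
      · subst hk
        simp only [height, AddMonoidHom.comp_apply, psi_unitVec_self]
        linarith
      · simp only [height, AddMonoidHom.comp_apply, psi_unitVec_of_ne hk, map_add]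
        linarith
    | ext i =>
      have h1 := ih (good_ext_cons.1 hw).2
      have h3 := height_top_nonneg (good_ext_cons.1 hw).2
      simp only [height, AddMonoidHom.comp_apply, top, killCoord_top hw]
      by_cases hk : k = i
      · subst hk
        rw [killCoord_unitVec_self, map_zero]
        linarith
      · rwa [killCoord_unitVec_of_ne hk]

lemma height_unitVec_le_of_mem {w : List (Step n)} (hw : Good w) {k : Fin n}
    (hk : fin k ∈ w ∨ ext k ∈ w) : height w (unitVec k) ≤ height w (top w) := by
  induction w with
  | nil => simp at hk
  | cons a w ih =>
    simp only [List.mem_cons] at hk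
    cases a with
    | fin i =>
      have h2 := height_nonneg w (unitVec_nonneg i)
      have h3 := height_top_nonneg (good_fin_cons.1 hw)
      rw [height_top_cons_fin]
      by_cases hki : k = i
      · subst hki
        simp only [height, AddMonoidHom.comp_apply, psi_unitVec_self]
        linarith
      · have h1 := ih (good_fin_cons.1 hw) (by simpa [hki] using hk)
        simp only [height, AddMonoidHom.comp_apply, psi_unitVec_of_ne hki, map_add]
        linarith
    | ext i =>
      simp only [height, AddMonoidHom.comp_apply, top, killCoord_top hw]
      by_cases hki : k = i
      · subst hki
        rw [killCoord_unitVec_self, map_zero]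
        exact height_top_nonneg (good_ext_cons.1 hw).2
      · rw [killCoord_unitVec_of_ne hki]
        exact ih (good_ext_cons.1 hw).2 (by simpa [hki] using hk)

lemma height_eq_sum (w : List (Step n)) (x : Zn n) :
    height w x = ∑ k, x k * height w (unitVec k) := by
  have hx : x = ∑ k, x k • unitVec k := by
    funext i
    simp [Finset.sum_apply, Pi.single_apply]
  conv_lhs => rw [hx]
  rw [map_sum]
  exact Finset.sum_congr rfl fun k _ => by rw [map_zsmul, smul_eq_mul]

lemma height_le_deg_mul {w : List (Step n)} (hw : Good w) {x : Zn n} (hx : 0 ≤ x)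
    (h : ∀ k, fin k ∉ w → ext k ∉ w → x k = 0) :
    height w x ≤ deg n x * height w (top w) := by
  rw [height_eq_sum, show deg n x = ∑ k, x k from rfl, Finset.sum_mul]
  refine Finset.sum_le_sum fun k _ => ?_
  by_cases hk : fin k ∈ w ∨ ext k ∈ w
  · exact mul_le_mul_of_nonneg_left (height_unitVec_le_of_mem hw hk) (hx k)
  · rw [not_or] at hk
    simp [h k hk.1 hk.2]

/-- `B_ω` is stable under adding unit vectors as long as the height permits. -/
lemma add_unitVec_mem_B {w : List (Step n)} (hw : Good w) {x : Zn n} (hx : x ∈ B w) {k : Fin n}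
    (h : height w x + height w (unitVec k) ≤ height w (top w)) : x + unitVec k ∈ B w := by
  induction w generalizing x k with
  | nil =>
    rw [show x = 0 from hx] at h
    simp [height, top, deg_unitVec] at h
  | cons a w ih =>
    cases a with
    | fin i =>
      have hw' := good_fin_cons.1 hw
      rw [height_top_cons_fin] at h
      change height w (psi i x) + height w (psi i (unitVec k)) ≤ _ at h
      have h2 := height_nonneg w (unitVec_nonneg i)
      have h3 := height_nonneg w (unitVec_nonneg k)
      by_cases hki : k = i
      · subst hki
        rw [psi_unitVec_self] at h
        rcases hx with hx | hx
        · exact Or.inr (by simpa using hx)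
        · refine Or.inr ?_
          have := ih hw' hx (k := k) (by rw [map_sub]; linarith)
          simpa [add_sub_right_comm] using this
      · rw [psi_unitVec_of_ne hki, map_add] at h
        rcases hx with hx | hx
        · refine Or.inr ?_
          have := ih hw' hx (k := k) (by linarith)
          rw [map_add, psi_unitVec_of_ne hki, ← add_assoc, add_sub_cancel_right]
          exact this
        · refine Or.inr ?_
          have h4 := ih hw' hx (k := k) (by rw [map_sub]; linarith)
          have h5 := ih hw' h4 (k := i) (by rw [map_add, map_sub]; linarith)
          rw [map_add, psi_unitVec_of_ne hki, ← add_assoc, add_sub_cancel_right]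
          rwa [add_right_comm, sub_add_cancel] at h5
    | ext i =>
      have hw' := (good_ext_cons.1 hw).2
      simp only [height, AddMonoidHom.comp_apply, top, killCoord_top hw] at h
      change killCoord i (x + unitVec k) ∈ B w
      rw [map_add]
      by_cases hki : k = i
      · subst hki
        rw [killCoord_unitVec_self, add_zero]
        exact hx
      · rw [killCoord_unitVec_of_ne hki] at h ⊢
        exact ih hw' hx h

lemma sub_unitVec_mem_B {w : List (Step n)} (hw : Good w) {x : Zn n} (hx : x ∈ B w) {k : Fin n}
    (h : height w (unitVec k) ≤ height w x) : x - unitVec k ∈ B w := by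
  have := top_sub_mem_B hw (add_unitVec_mem_B hw (top_sub_mem_B hw hx) (k := k)
    (by rw [map_sub]; linarith))
  rwa [← sub_sub, sub_sub_cancel] at this

end Step

namespace Step

variable {n : ℕ}

/-! #### Convexity -/

/-- The periodic set `B_ω + ℤ c`, where `c` is the top element of `B_ω`. -/
def periodic (w : List (Step n)) : Set (Zn n) := {x | ∃ m : ℤ, x - m • top w ∈ B w}

/-- An element of `B_ω + ℤ c` lies in the translate of `B_ω` determined by its height. -/
lemma sub_smul_top_mem_B {w : List (Step n)} (hw : Good w) {x : Zn n} (hx : x ∈ periodic w) {m : ℤ}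
    (h₁ : m * height w (top w) ≤ height w x) (h₂ : height w x ≤ (m + 1) * height w (top w)) :
    x - m • top w ∈ B w := by
  obtain ⟨g, hg⟩ := hx
  have hN := height_top_nonneg hw
  have hb := height_nonneg_of_mem_B hg
  have hb' := height_le_of_mem_B hw hg
  rw [map_sub, map_zsmul, smul_eq_mul] at hb hb'
  set N := height w (top w) with hNdef
  have key : x - m • top w = x - g • top w + (g - m) • top w := by module
  rcases hN.eq_or_lt with h0 | h0
  · rw [key]
    exact add_mem_B hg (zsmul_mem (mem_V_of_mem_B (top_mem_B hw) h0.symm) _)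
  have hg₁ : g ≤ m + 1 := by
    by_contra hlt
    nlinarith
  have hg₂ : m - 1 ≤ g := by
    by_contra hlt
    nlinarith
  -- Neighbouring translates of `B w` share a boundary level. If `g` is off by one, then `x` has
  -- exactly that height, and modulo `V w` it is the bottom of one translate and the top of the
  -- other.
  obtain rfl | rfl | rfl : g = m ∨ g = m + 1 ∨ g = m - 1 := by omega
  · exact hg
  · have h := mem_V_of_mem_B hg (by
      rw [map_sub, map_zsmul, smul_eq_mul]
      linarith)
    rw [key, add_sub_cancel_left, one_smul, add_comm]
    exact add_mem_B (top_mem_B hw) h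
  · have h := top_sub_mem_V_of_mem_B hw hg (by
      rw [map_sub, map_zsmul, smul_eq_mul]
      linarith)
    have h' := neg_mem h
    rw [key]
    have e : m - 1 - m = -1 := by ring
    rw [e, neg_one_smul, ← sub_eq_add_neg, ← neg_sub]
    exact mem_B_of_mem_V h'

lemma apply_eq_zero_of_mem_periodic {j : Fin n} {w : List (Step n)} (hf : fin j ∉ w)
    (he : ext j ∉ w) {x : Zn n} (hx : x ∈ periodic w) : x j = 0 := by
  obtain ⟨m, hm⟩ := hx
  simpa [top_apply_eq_zero hf he] using apply_eq_zero_of_mem_B hf he hm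

/-- Coordinates whose letters do not occur vanish on `periodic w`, hence on everything squeezed
between two of its elements. Each remaining unit vector has height at most that of `top w`. -/
lemma height_sub_le {w : List (Step n)} (hw : Good w) {x y z z' : Zn n} (hxy : x ≤ y) (hyz : y ≤ z)
    (hz : z' ≤ x) (hx' : z' ∈ periodic w) (hz' : z ∈ periodic w) :
    height w y - height w x ≤ deg n (y - x) * height w (top w) := by
  rw [← map_sub]
  refine height_le_deg_mul hw (sub_nonneg.2 hxy) fun k hf he => ?_
  have h1 : x k ≤ y k := hxy k
  have h2 : y k ≤ 0 := (hyz k).trans_eq (apply_eq_zero_of_mem_periodic hf he hz')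
  have h3 : 0 ≤ x k := (apply_eq_zero_of_mem_periodic hf he hx').symm.trans_le (hz k)
  rw [Pi.sub_apply]
  omega

/-- Membership in `B_ω + ℤ c` for `ω = i * ω'` with a representation `(m, ε)` whose first entry
cannot be enlarged. -/
lemma exists_upper_representation {i : Fin n} {w : List (Step n)} (hw : Good w) {x : Zn n}
    (hx : x ∈ periodic (fin i :: w)) :
    ∃ m ε : ℤ, 0 ≤ ε ∧ ε ≤ 1 ∧ psi i x - (m + ε) • unitVec i - m • top w ∈ B w ∧
      (ε = 0 → height w (psi i x - (m + ε) • unitVec i - m • top w) < height w (unitVec i)) := by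
  obtain ⟨m, hm⟩ := hx
  have e0 : psi i (x - m • top (fin i :: w)) = psi i x - (m + 0) • unitVec i - m • top w := by
    rw [map_sub, map_zsmul, top, map_add, psi_unitVec_self, psi_phi]
    module
  have e1 : psi i x - (m + 1) • unitVec i - m • top w =
      psi i x - (m + 0) • unitVec i - m • top w - unitVec i := by module
  rcases hm with hm | hm
  · rw [e0] at hm
    by_cases h : height w (psi i x - (m + 0) • unitVec i - m • top w) < height w (unitVec i)
    · exact ⟨m, 0, le_rfl, zero_le_one, hm, fun _ => h⟩
    · refine ⟨m, 1, zero_le_one, le_rfl, ?_, fun h => absurd h one_ne_zero⟩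
      rw [e1]
      exact sub_unitVec_mem_B hw hm (not_lt.1 h)
  · refine ⟨m, 1, zero_le_one, le_rfl, ?_, fun h => absurd h one_ne_zero⟩
    rw [e1, ← e0]
    exact hm

/-- Mirror image of `exists_upper_representation`: here `m + ε` is made as small as possible. The
extremal choices on the two sides guarantee that the range searched in `periodic_convex` is
nonempty. -/
lemma exists_lower_representation {i : Fin n} {w : List (Step n)} (hw : Good w) {x : Zn n}
    (hx : x ∈ periodic (fin i :: w)) :
    ∃ m ε : ℤ, 0 ≤ ε ∧ ε ≤ 1 ∧ psi i x - (m + ε) • unitVec i - m • top w ∈ B w ∧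
      (ε = 1 → height w (top w) <
        height w (psi i x - (m + ε) • unitVec i - m • top w) + height w (unitVec i)) := by
  obtain ⟨m, hm⟩ := hx
  have e0 : psi i (x - m • top (fin i :: w)) = psi i x - (m + 0) • unitVec i - m • top w := by
    rw [map_sub, map_zsmul, top, map_add, psi_unitVec_self, psi_phi]
    module
  have e1 : psi i x - (m + 0) • unitVec i - m • top w =
      psi i x - (m + 1) • unitVec i - m • top w + unitVec i := by module
  rcases hm with hm | hm
  · rw [e0] at hm
    exact ⟨m, 0, le_rfl, zero_le_one, hm, fun h => absurd h zero_ne_one⟩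
  · rw [e0, e1, add_sub_cancel_right] at hm
    by_cases h : height w (top w) <
        height w (psi i x - (m + 1) • unitVec i - m • top w) + height w (unitVec i)
    · exact ⟨m, 1, zero_le_one, le_rfl, hm, fun _ => h⟩
    · refine ⟨m, 0, le_rfl, zero_le_one, ?_, fun h => absurd h zero_ne_one⟩
      rw [e1]
      exact add_unitVec_mem_B hw hm (not_lt.1 h)

lemma mem_periodic_cons_fin {i : Fin n} {w : List (Step n)} {x : Zn n} {m : ℤ}
    (h : psi i x - m • unitVec i - m • top w ∈ B w ∨
      psi i x - m • unitVec i - (m - 1) • top w ∈ B w) : x ∈ periodic (fin i :: w) := by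
  have e0 : ∀ m : ℤ, psi i (x - m • top (fin i :: w)) =
      psi i x - m • unitVec i - m • top w := fun m => by
    rw [map_sub, map_zsmul, top, map_add, psi_unitVec_self, psi_phi]
    module
  rcases h with h | h
  · exact ⟨m, Or.inl (by rwa [e0])⟩
  · refine ⟨m - 1, Or.inr ?_⟩
    rw [e0]
    convert h using 1
    module

/-- A decreasing arithmetic progression with difference at most `2N + 1` hits `[-N, N]`. -/
lemma exists_mul_mem_Icc {H D N lo hi : ℤ} (hD : 0 < D) (hDN : D ≤ 2 * N + 1) (hlh : lo ≤ hi)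
    (hhi : H - hi * D ≤ N) (hlo : -N ≤ H - lo * D) :
    ∃ m, lo ≤ m ∧ m ≤ hi ∧ H - m * D ≤ N ∧ -N ≤ H - m * D := by
  by_cases h : -N ≤ H - hi * D
  · exact ⟨hi, hlh, le_rfl, hhi, h⟩
  · have h1 : lo ≤ (H + N) / D := (Int.le_ediv_iff_mul_le hD).2 (by linarith)
    have h2 : (H + N) / D ≤ hi := by
      have : (H + N) / D < hi := (Int.ediv_lt_iff_lt_mul hD).2 (by linarith)
      exact this.le
    have h3 := Int.ediv_mul_le (H + N) hD.ne'
    have h4 := Int.lt_ediv_add_one_mul_self (H + N) hD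
    refine ⟨(H + N) / D, h1, h2, ?_, by linarith⟩
    have : ((H + N) / D + 1) * D = (H + N) / D * D + D := by ring
    linarith

/-- The set `B_ω + ℤ c` is convex with respect to the componentwise order. -/
theorem periodic_convex {w : List (Step n)} (hw : Good w) {x y z : Zn n} (hx : x ∈ periodic w)
    (hz : z ∈ periodic w) (hxy : x ≤ y) (hyz : y ≤ z) : y ∈ periodic w := by
  induction w generalizing x y z with
  | nil =>
    obtain ⟨m, hm⟩ := hx
    obtain ⟨m', hm'⟩ := hz
    have hx0 : x = 0 := by simpa [top, B] using hm
    have hz0 : z = 0 := by simpa [top, B] using hm'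
    subst hx0 hz0
    rw [le_antisymm hyz hxy]
    exact ⟨0, by simp [B]⟩
  | cons a w ih =>
    cases a with
    | ext i =>
      have key : ∀ x : Zn n, x ∈ periodic (ext i :: w) ↔ killCoord i x ∈ periodic w := fun x => by
        refine exists_congr fun m => ?_
        change killCoord i (x - m • top w) ∈ B w ↔ _
        rw [map_sub, map_zsmul, killCoord_top hw]
      rw [key] at hx hz ⊢
      exact ih (good_ext_cons.1 hw).2 hx hz (killCoord_mono hxy) (killCoord_mono hyz)
    | fin i =>
      have hw' := good_fin_cons.1 hw
      -- The heights of `psi i x`, `psi i y`, `psi i z` grow at most by N + W per unit of degree,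
      -- where N + W is the height of the top element of the longer word.
      have hyx := height_sub_le hw hxy hyz le_rfl hx hz
      have hzy := height_sub_le hw hyz le_rfl hxy hx hz
      rw [height_top_cons_fin] at hyx hzy
      change height w (psi i y) - height w (psi i x) ≤ _ at hyx
      change height w (psi i z) - height w (psi i y) ≤ _ at hzy
      obtain ⟨k, ε, hε0, hε1, hk, hkε⟩ := exists_upper_representation hw' hx
      obtain ⟨l, ε', hε0', hε1', hl, hlε⟩ := exists_lower_representation hw' hz
      have hα0 := height_nonneg_of_mem_B hk
      have hαN := height_le_of_mem_B hw' hk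
      have hβ0 := height_nonneg_of_mem_B hl
      have hβN := height_le_of_mem_B hw' hl
      have hW := height_nonneg w (unitVec_nonneg i)
      have hN := height_top_nonneg hw'
      have hWN := height_unitVec_le hw' i
      simp only [map_sub, map_zsmul, smul_eq_mul] at hα0 hαN hβ0 hβN hkε hlε
      set N := height w (top w) with hNdef
      set W := height w (unitVec i) with hWdef
      set D₁ := deg n (y - x) with hD₁
      set D₂ := deg n (z - y) with hD₂
      -- If N + W = 0, then `top w`, `unitVec i` and `psi i (y - x)` all lie in `V w`, so `psi i y`
      -- does as well.
      rcases (add_nonneg hN hW).eq_or_lt with h0 | h0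
      · have hN0 : N = 0 := by linarith
        have hW0 : W = 0 := by linarith
        have htop : top w ∈ V w := mem_V_of_mem_B (top_mem_B hw') hN0
        have he : unitVec i ∈ V w := mem_V_of_nonneg (unitVec_nonneg i) hW0
        have hkV := mem_V_of_mem_B hk (by
          rw [map_sub, map_sub, map_zsmul, map_zsmul, smul_eq_mul, smul_eq_mul]
          linarith)
        have hyx' : psi i (y - x) ∈ V w := by
          refine mem_V_of_nonneg (psi_nonneg (sub_nonneg.2 hxy)) ?_
          have h1 := height_nonneg w (psi_nonneg (i := i) (sub_nonneg.2 hxy))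
          have : W + N = 0 := by linarith
          rw [this, mul_zero, ← map_sub, ← map_sub] at hyx
          exact le_antisymm hyx h1
        refine ⟨0, Or.inl ?_⟩
        rw [zero_smul, sub_zero]
        have := add_mem (add_mem (add_mem hyx' hkV) (zsmul_mem htop k)) (zsmul_mem he (k + ε))
        have e : psi i y = psi i (y - x) + (psi i x - (k + ε) • unitVec i - k • top w) +
            k • top w + (k + ε) • unitVec i := by
          rw [map_sub]
          module
        rw [e]
        exact mem_B_of_mem_V this
      -- Otherwise the height would rise from x to z by more than (D₁ + D₂)(N + W). The extremality
      -- of `k + ε` and `l + ε'` is what excludes ε = 0 and ε' = 1 respectively.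
      · have hlh : l + ε' - D₂ ≤ k + ε + D₁ := by
          by_contra hcon
          have hg : D₁ + D₂ + 1 ≤ l + ε' - k - ε := by linarith
          have h1 : (D₁ + D₂ + 1) * (W + N) ≤ (l + ε' - k - ε) * (W + N) :=
            mul_le_mul_of_nonneg_right hg (by linarith)
          obtain rfl | rfl : ε = 0 ∨ ε = 1 := by omega
          all_goals obtain rfl | rfl : ε' = 0 ∨ ε' = 1 := by omega
          · have := hkε rfl
            nlinarith
          · have := hkε rfl
            have := hlε rfl
            nlinarith
          · nlinarith
          · have := hlε rfl
            nlinarith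
        have hhi : height w (psi i y) - (k + ε + D₁) * (N + W) ≤ N := by nlinarith
        have hlo : -N ≤ height w (psi i y) - (l + ε' - D₂) * (N + W) := by nlinarith
        -- Since D₁ and D₂ are the i-th coordinates of the images of y - x and z - y under `psi i`,
        -- the range of m keeps `psi i y - m • unitVec i` between the chosen elements for x and z,
        -- and induction applies. The condition on m places its height between (m - 1)N and (m +
        -- 1)N, so it lies in translate m or m - 1 of `B w`: the two cases of
        -- `mem_periodic_cons_fin`.
        obtain ⟨m, hm₁, hm₂, hm₃, hm₄⟩ :=
          exists_mul_mem_Icc h0 (by linarith) hlh hhi hlo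
        have hm : psi i y - m • unitVec i ∈ periodic w := by
          refine ih hw' ⟨k, hk⟩ ⟨l, hl⟩ ?_ ?_
          · have := psi_sub_smul_nonneg (i := i) (sub_nonneg.2 hxy) (m := m - (k + ε))
              (by linarith)
            rw [← sub_nonneg]
            convert this using 1
            rw [map_sub]
            module
          · have := psi_sub_smul_nonneg (i := i) (sub_nonneg.2 hyz) (m := l + ε' - m)
              (by linarith)
            rw [← sub_nonneg]
            convert this using 1
            rw [map_sub]
            module
        have hh : height w (psi i y - m • unitVec i) = height w (psi i y) - m * W := by
          rw [map_sub, map_zsmul, smul_eq_mul]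
        refine mem_periodic_cons_fin (m := m) ?_
        by_cases hmN : m * N ≤ height w (psi i y - m • unitVec i)
        · exact Or.inl (sub_smul_top_mem_B hw' hm hmN (by rw [hh]; linarith))
        · exact Or.inr (sub_smul_top_mem_B hw' hm (by rw [hh]; linarith)
            (by rw [sub_add_cancel]; exact (not_le.1 hmN).le))

end Step

namespace Step

variable {n : ℕ}

/-! #### Incomparability -/

lemma height_top_add_delta {w : List (Step n)} (hw : Good w) {j : Fin n} (hj : ext j ∉ w)
    {x : Zn n} (hx : x - top w - delta w j ∈ V w) : height w x = height w (top w) + 1 := by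
  have := height_eq_zero_of_mem_V hx
  rw [map_sub, map_sub, height_delta hw hj] at this
  linarith

lemma mem_periodic_append_fin_of_mem_B {w : List (Step n)} {j : Fin n} (h : Good (w ++ [fin j]))
    {x : Zn n} (hx : x ∈ B w) : x ∈ periodic (w ++ [fin j]) :=
  ⟨0, by rw [zero_smul, sub_zero]; exact (mem_B_append_fin h).2 (Or.inl hx)⟩

/-- Elements of `B_ω + δ^j_ω` outside of `B_ω` and different from `a^j_ω` modulo `V_ω` are not
comparable to any element of `B_ω`. -/
theorem mem_B_or_mem_V_of_comparable {w : List (Step n)} (hw : Good w) {j : Fin n}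
    (hj : ext j ∉ w) {x y : Zn n} (hx : x ∈ B w) (hy : y - delta w j ∈ B w)
    (hxy : x ≤ y ∨ y ≤ x) : y ∈ B w ∨ y - top w - delta w j ∈ V w := by
  induction w generalizing x y with
  | nil =>
    have hy' : y - delta [] j = 0 := hy
    exact Or.inr (show y - 0 - delta [] j = 0 by rw [sub_zero, hy'])
  | cons a w ih =>
    simp only [List.mem_cons, not_or] at hj
    cases a with
    | ext i =>
      have hji : j ≠ i := fun h => hj.1 (by rw [h])
      have hd : delta (ext i :: w) j = delta w j := by simp [delta, hji]
      change killCoord i (y - delta (ext i :: w) j) ∈ B w at hy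
      rw [hd, map_sub, killCoord_delta hji hw] at hy
      change killCoord i y ∈ B w ∨ killCoord i (y - top w - delta (ext i :: w) j) ∈ V w
      rw [hd, map_sub, map_sub, killCoord_delta hji hw, killCoord_top hw]
      exact ih (good_ext_cons.1 hw).2 hj.2 hx hy (hxy.imp killCoord_mono killCoord_mono)
    | fin i =>
      have hw' := good_fin_cons.1 hw
      obtain rfl | hne := eq_or_ne x y
      · exact Or.inl hx
      have he := unitVec_nonneg i
      -- Both alternatives for x supply an element of `B w` within one unit vector of `psi i x`; the
      -- induction hypothesis is applied to it.
      have hb : ∃ b ∈ B w, psi i x - unitVec i ≤ b ∧ b ≤ psi i x := by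
        rcases hx with hx | hx
        · exact ⟨_, hx, sub_le_self _ he, le_rfl⟩
        · exact ⟨_, hx, le_rfl, sub_le_self _ he⟩
      obtain ⟨b, hbB, hb₁, hb₂⟩ := hb
      have hV : ∀ y, y - top (fin i :: w) - delta (fin i :: w) j ∈ V (fin i :: w) ↔
          psi i y - unitVec i - top w - delta w j ∈ V w := fun y => by
        simp [V, top, delta, sub_sub]
      have hyδ : psi i (y - delta (fin i :: w) j) = psi i y - delta w j := by simp [delta]
      have hy' : (psi i y - delta w j ∈ B w) ∨ psi i y - unitVec i - delta w j ∈ B w := by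
        rcases hy with hy | hy
        · exact Or.inl (by rwa [hyδ] at hy)
        · rw [hyδ, sub_right_comm] at hy
          exact Or.inr hy
      rcases hxy with hxy | hxy
      · have hlt := psi_add_le_psi (i := i) (lt_of_le_of_ne hxy hne)
        have hb₃ : b ≤ psi i y - unitVec i := hb₂.trans (le_sub_iff_add_le.2 hlt)
        rcases hy' with hy' | hy'
        · rcases ih hw' hj.2 hbB hy' (Or.inl (hb₃.trans (sub_le_self _ he))) with h | h
          · exact Or.inl (Or.inl h)
          -- Here `psi i y` is the exceptional corner for w, that is, the top of `B (w ++ [fin j])`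
          -- modulo `V w`. The element `psi i y - unitVec i` lies between b and this corner, so
          -- convexity puts it into B_w or B_w + δ, and the induction hypothesis applies to it.
          have hg : Good (w ++ [fin j]) := good_append_fin.2 ⟨hw', hj.2⟩
          have hp : psi i y ∈ periodic (w ++ [fin j]) := by
            refine ⟨1, ?_⟩
            rw [one_smul, top_append_fin hg, ← sub_sub]
            exact mem_B_of_mem_V (by rwa [V_append_fin])
          have hq := periodic_convex hg (mem_periodic_append_fin_of_mem_B hg hbB) hp hb₃
            (sub_le_self _ he)
          have hh : height (w ++ [fin j]) (psi i y) =
              height (w ++ [fin j]) (top (w ++ [fin j])) := by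
            rw [← sub_eq_zero, ← map_sub, top_append_fin hg, ← sub_sub]
            exact height_eq_zero_of_mem_V (by rwa [V_append_fin])
          have hq' := sub_smul_top_mem_B hg hq (m := 0)
            (by
              rw [zero_mul]
              exact (height_nonneg_of_mem_B ((mem_B_append_fin hg).2 (Or.inl hbB))).trans
                (height_mono _ hb₃))
            (by
              rw [zero_add, one_mul, ← hh]
              exact height_mono _ (sub_le_self _ he))
          rw [zero_smul, sub_zero, mem_B_append_fin hg] at hq'
          rcases hq' with h' | h'
          · exact Or.inl (Or.inr h')
          · rcases ih hw' hj.2 hbB h' (Or.inl hb₃) with h'' | h''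
            · exact Or.inl (Or.inr h'')
            · exact Or.inr ((hV y).2 h'')
        · rcases ih hw' hj.2 hbB hy' (Or.inl hb₃) with h | h
          · exact Or.inl (Or.inr h)
          · exact Or.inr ((hV y).2 h)
      · have hlt := psi_add_le_psi (i := i) (lt_of_le_of_ne hxy hne.symm)
        have hb₃ : psi i y ≤ b := (le_sub_iff_add_le.2 hlt).trans hb₁
        -- Below b the exceptional corner cannot occur: its height exceeds the maximum on `B w` by
        -- 1.
        have hcon : ∀ g, g ≤ b → g - delta w j ∈ B w → g ∈ B w := fun g hgb hg => by
          rcases ih hw' hj.2 hbB hg (Or.inr hgb) with h | h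
          · exact h
          · have h1 := height_top_add_delta hw' hj.2 h
            have h2 := height_mono w hgb
            have h3 := height_le_of_mem_B hw' hbB
            linarith
        rcases hy' with hy' | hy'
        · exact Or.inl (Or.inl (hcon _ hb₃ hy'))
        · exact Or.inl (Or.inr (hcon _ ((sub_le_self _ he).trans hb₃) hy'))

/-- Elements of `B_ω + δ^j_ω` below an element of `B_ω` are in `B_ω`. -/
lemma mem_B_of_le {w : List (Step n)} (hw : Good w) {j : Fin n}
    (hj : ext j ∉ w) {x y : Zn n} (hx : x ∈ B w) (hy : y - delta w j ∈ B w)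
    (hxy : y ≤ x) : y ∈ B w := by
  rcases mem_B_or_mem_V_of_comparable hw hj hx hy (Or.inr hxy) with h | h
  · exact h
  · have h1 := height_top_add_delta hw hj h
    have h2 := height_mono w hxy
    have h3 := height_le_of_mem_B hw hx
    linarith

/-- Elements of `B_ω - δ^j_ω` outside of `B_ω` and different from `-δ^j_ω` modulo `V_ω` are not
comparable to any element of `B_ω`. -/
lemma mem_B_or_mem_V_of_comparable' {w : List (Step n)} (hw : Good w) {j : Fin n}
    (hj : ext j ∉ w) {x y : Zn n} (hx : x ∈ B w) (hy : y + delta w j ∈ B w)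
    (hxy : x ≤ y ∨ y ≤ x) : y ∈ B w ∨ y + delta w j ∈ V w := by
  have hy' : top w - y - delta w j ∈ B w := by
    rw [sub_sub]
    exact top_sub_mem_B hw hy
  rcases mem_B_or_mem_V_of_comparable hw hj (top_sub_mem_B hw hx) hy'
    (hxy.symm.imp (sub_le_sub_left · _) (sub_le_sub_left · _)) with h | h
  · exact Or.inl (by simpa using top_sub_mem_B hw h)
  · refine Or.inr ?_
    have := neg_mem h
    convert this using 1
    abel

/-! #### Repeated letters -/

lemma good_append_replicate {w : List (Step n)} (hw : Good w) {j : Fin n} (hj : ext j ∉ w)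
    (k : ℕ) : Good (w ++ List.replicate k (fin j)) ∧ ext j ∉ w ++ List.replicate k (fin j) := by
  induction k with
  | zero => simpa using ⟨hw, hj⟩
  | succ k ih =>
    rw [List.replicate_succ', ← List.append_assoc]
    exact ⟨good_append_fin.2 ih, by simpa using ih.2⟩

lemma delta_append_replicate {w : List (Step n)} (hw : Good w) {j : Fin n} (hj : ext j ∉ w)
    (k : ℕ) : delta (w ++ List.replicate k (fin j)) j = delta w j := by
  induction k with
  | zero => simp
  | succ k ih =>
    rw [List.replicate_succ', ← List.append_assoc,
      delta_append_fin (good_append_fin.2 (good_append_replicate hw hj k)), ih]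
    simp

lemma V_append_replicate (w : List (Step n)) (j : Fin n) (k : ℕ) :
    V (w ++ List.replicate k (fin j)) = V w := by
  induction k with
  | zero => simp
  | succ k ih => rw [List.replicate_succ', ← List.append_assoc, V_append_fin, ih]

lemma mem_B_append_replicate {w : List (Step n)} (hw : Good w) {j : Fin n} (hj : ext j ∉ w)
    {k : ℕ} {x : Zn n} : x ∈ B (w ++ List.replicate k (fin j)) ↔
      ∃ m : ℕ, m ≤ k ∧ x - m • delta w j ∈ B w := by
  induction k generalizing x with
  | zero => simp
  | succ k ih =>
    rw [List.replicate_succ', ← List.append_assoc,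
      mem_B_append_fin (good_append_fin.2 (good_append_replicate hw hj k)), ih, ih,
      delta_append_replicate hw hj]
    constructor
    · rintro (⟨m, hm, h⟩ | ⟨m, hm, h⟩)
      · exact ⟨m, by omega, h⟩
      · refine ⟨m + 1, by omega, ?_⟩
        rwa [add_smul, one_smul, add_comm, ← sub_sub]
    · rintro ⟨m, hm, h⟩
      rcases hm.eq_or_lt with rfl | hm
      · refine Or.inr ⟨k, le_rfl, ?_⟩
        rwa [add_smul, one_smul, add_comm, ← sub_sub] at h
      · exact Or.inl ⟨m, by omega, h⟩

/-- The set `B_{ω * j^∞} = B_ω + ℤ_{≥0} δ^j_ω`. -/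
def Binf (w : List (Step n)) (j : Fin n) : Set (Zn n) := {x | ∃ m : ℕ, x - m • delta w j ∈ B w}

lemma B_append_replicate_subset_Binf {w : List (Step n)} (hw : Good w) {j : Fin n}
    (hj : ext j ∉ w) (k : ℕ) : B (w ++ List.replicate k (fin j)) ⊆ Binf w j := fun _ hx =>
  let ⟨m, _, h⟩ := (mem_B_append_replicate hw hj).1 hx
  ⟨m, h⟩

lemma B_append_replicate_mono {w : List (Step n)} (hw : Good w) {j : Fin n}
    (hj : ext j ∉ w) {k l : ℕ} (h : k ≤ l) :
    B (w ++ List.replicate k (fin j)) ⊆ B (w ++ List.replicate l (fin j)) := fun _ hx =>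
  let ⟨m, hm, h'⟩ := (mem_B_append_replicate hw hj).1 hx
  (mem_B_append_replicate hw hj).2 ⟨m, hm.trans h, h'⟩

lemma exists_mem_B_append_replicate {w : List (Step n)} (hw : Good w) {j : Fin n}
    (hj : ext j ∉ w) {x : Zn n} (hx : x ∈ Binf w j) :
    ∃ k, x ∈ B (w ++ List.replicate k (fin j)) :=
  let ⟨m, h⟩ := hx
  ⟨m, (mem_B_append_replicate hw hj).2 ⟨m, le_rfl, h⟩⟩

/-- Elements of `B_{ω * j^∞}` below an element of `B_{ω * j^k}` are in `B_{ω * j^k}`. -/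
lemma mem_B_append_replicate_of_le {w : List (Step n)} (hw : Good w) {j : Fin n}
    (hj : ext j ∉ w) {k : ℕ} {x y : Zn n} (hx : x ∈ B (w ++ List.replicate k (fin j)))
    (hy : y ∈ Binf w j) (hyx : y ≤ x) : y ∈ B (w ++ List.replicate k (fin j)) := by
  obtain ⟨m, hm⟩ := exists_mem_B_append_replicate hw hj hy
  have key : ∀ l, y ∈ B (w ++ List.replicate (k + l) (fin j)) →
      y ∈ B (w ++ List.replicate k (fin j)) := by
    intro l
    induction l with
    | zero => exact id
    | succ l ih =>
      intro h
      have hg := good_append_replicate hw hj (k + l)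
      refine ih ?_
      rw [← add_assoc, List.replicate_succ', ← List.append_assoc,
        mem_B_append_fin (good_append_fin.2 hg)] at h
      rcases h with h | h
      · exact h
      · exact mem_B_of_le hg.1 hg.2 (B_append_replicate_mono hw hj (Nat.le_add_right k l) hx) h hyx
  exact key m (B_append_replicate_mono hw hj (Nat.le_add_left m k) hm)

/-- Elements of `B_{ω * j^∞ ext}` that are comparable to an element of `B_{ω * j^∞}` are in
`B_{ω * j^∞}`, or a negative multiple of `δ^j_ω` modulo `V_ω`. -/
lemma mem_Binf_or_mem_V_of_comparable {w : List (Step n)} (hw : Good w) {j : Fin n}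
    (hj : ext j ∉ w) {x y : Zn n} (hx : x ∈ Binf w j) {m : ℤ} (hy : y - m • delta w j ∈ B w)
    (hxy : x ≤ y ∨ y ≤ x) : y ∈ Binf w j ∨ ∃ l : ℤ, l < 0 ∧ y - l • delta w j ∈ V w := by
  -- A single multiple of δ is removed at a time. The elements involved lie in B_{ω*j^k} for a
  -- common large k, so the finite statement applies there.
  have step : ∀ x ∈ Binf w j, ∀ y, y + delta w j ∈ Binf w j → x ≤ y ∨ y ≤ x →
      y ∈ Binf w j ∨ y + delta w j ∈ V w := by
    intro x hx y hy hxy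
    obtain ⟨k, hk⟩ := exists_mem_B_append_replicate hw hj hx
    obtain ⟨l, hl⟩ := exists_mem_B_append_replicate hw hj hy
    have hg := good_append_replicate hw hj (max k l)
    have hd := delta_append_replicate hw hj (max k l)
    have := mem_B_or_mem_V_of_comparable' hg.1 hg.2
      (B_append_replicate_mono hw hj (le_max_left k l) hk)
      (by rw [hd]; exact B_append_replicate_mono hw hj (le_max_right k l) hl) hxy
    rw [hd, V_append_replicate] at this
    exact this.imp_left fun h => B_append_replicate_subset_Binf hw hj _ h
  have key : ∀ l : ℕ, y + l • delta w j ∈ Binf w j →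
      y ∈ Binf w j ∨ ∃ l : ℤ, l < 0 ∧ y - l • delta w j ∈ V w := by
    intro l
    induction l with
    | zero => intro h; exact Or.inl (by simpa using h)
    | succ l ih =>
      intro h
      have hx' : x + l • delta w j ∈ Binf w j := by
        obtain ⟨m, hm⟩ := hx
        refine ⟨m + l, ?_⟩
        convert hm using 1
        rw [add_smul]
        abel
      rcases step _ hx' (y + l • delta w j) (by rwa [add_assoc, ← succ_nsmul])
        (hxy.imp (add_le_add_left · _) (add_le_add_left · _)) with h' | h'
      · exact ih h'
      · refine Or.inr ⟨-(l + 1 : ℤ), by omega, ?_⟩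
        convert h' using 1
        rw [neg_smul, sub_neg_eq_add, add_smul, one_smul, natCast_zsmul]
        abel
  -- Adding |m| copies of δ makes the coefficient m + |m| nonnegative.
  refine key m.natAbs ⟨(m + m.natAbs).toNat, ?_⟩
  convert hy using 1
  have h1 : ((m + m.natAbs).toNat : ℤ) = m + m.natAbs := Int.toNat_of_nonneg (by omega)
  rw [← natCast_zsmul, ← natCast_zsmul, h1, add_smul]
  abel

/-! #### The vectors `δ` and the lattice `V` -/

lemma delta_mem_V {w : List (Step n)} (hw : Good w) {k : Fin n} (hk : ext k ∈ w) :
    delta w k ∈ V w := by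
  induction w using List.reverseRecOn with
  | nil => simp at hk
  | append_singleton w a ih =>
    cases a with
    | fin j =>
      have hk' : ext k ∈ w := by simpa using hk
      have hw' := (good_append_fin.1 hw).1
      rw [delta_append_fin hw, V_append_fin, if_pos (Or.inr hk'), sub_zero]
      exact ih hw' hk'
    | ext j =>
      rw [delta_append_ext, mem_V_append_ext hw]
      by_cases hkj : k = j
      · exact ⟨1, by simp [hkj]⟩
      · refine ⟨0, ?_⟩
        rw [zero_smul, sub_zero]
        exact ih (good_append_ext.1 hw).1 (by simpa [hkj] using hk)

/-- Each letter changes the family δ unimodularly: δ^j is kept, so every δ^k can be recovered from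
δ^k - δ^j. -/
lemma closure_range_delta {w : List (Step n)} (hw : Good w) :
    AddSubgroup.closure (Set.range (delta w)) = ⊤ := by
  classical
  induction w using List.reverseRecOn with
  | nil =>
    rw [eq_top_iff]
    rintro x -
    have hx : x = ∑ k, x k • (unitVec k : Zn n) := by
      funext i
      simp [Finset.sum_apply, Pi.single_apply]
    rw [hx]
    exact sum_mem fun k _ => zsmul_mem (AddSubgroup.subset_closure (Set.mem_range_self k)) _
  | append_singleton w a ih =>
    cases a with
    | fin j =>
      rw [eq_top_iff, ← ih (good_append_fin.1 hw).1, AddSubgroup.closure_le]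
      rintro _ ⟨k, rfl⟩
      have hj := AddSubgroup.subset_closure (k := Set.range (delta (w ++ [fin j])))
        (Set.mem_range_self j)
      have hk := AddSubgroup.subset_closure (k := Set.range (delta (w ++ [fin j]))) ⟨k, rfl⟩
      rw [delta_append_fin hw, if_pos (Or.inl rfl), sub_zero] at hj
      rw [delta_append_fin hw] at hk
      split_ifs at hk
      · rwa [sub_zero] at hk
      · have := add_mem hk hj
        rwa [sub_add_cancel] at this
    | ext j =>
      have : delta (w ++ [ext j]) = delta w := funext fun k => delta_append_ext k
      rw [this]
      exact ih (good_append_ext.1 hw).1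

lemma V_eq_top {w : List (Step n)} (hw : Good w) (h : ∀ k, ext k ∈ w) : V w = ⊤ := by
  rw [eq_top_iff, ← closure_range_delta hw, AddSubgroup.closure_le]
  rintro _ ⟨k, rfl⟩
  exact delta_mem_V hw (h k)

/-! #### Convexity of `B ∪ -B` -/

/-- If -z ∈ `B w`, then z has height at most 0, whereas elements of B_w + δ have height at least 1;
only the case z ∈ `B w` remains. -/
lemma mem_B_of_le_of_mem_or_neg_mem {w : List (Step n)} (hw : Good w) {j : Fin n}
    (hj : ext j ∉ w) {y z : Zn n} (hy : y - delta w j ∈ B w) (hyz : y ≤ z)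
    (hz : z ∈ B w ∨ -z ∈ B w) : y ∈ B w := by
  rcases hz with hz | hz
  · exact mem_B_of_le hw hj hz hy hyz
  · have h1 := height_nonneg_of_mem_B hy
    have h2 := height_nonneg_of_mem_B hz
    have h3 := height_mono w hyz
    rw [map_sub, height_delta hw hj] at h1
    rw [map_neg] at h2
    linarith

/-- Append a letter j with `ext j ∉ w`. By the symmetry of B, -B is B + δ^j translated by minus the
top of w*j. Thus B ∪ -B lies in the convex set `periodic (w ++ [fin j])`, at heights between -N and
N, and y falls into one of two adjacent translates of B_{w*j}. The unwanted halves are removed by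
`mem_B_of_le_of_mem_or_neg_mem`. If there is no such j, `V w` is everything. -/
theorem convex_B_union_neg_B {w : List (Step n)} (hw : Good w) {x y z : Zn n}
    (hx : x ∈ B w ∨ -x ∈ B w) (hz : z ∈ B w ∨ -z ∈ B w) (hxy : x ≤ y) (hyz : y ≤ z) :
    y ∈ B w ∨ -y ∈ B w := by
  by_cases hall : ∀ k, ext k ∈ w
  · refine Or.inl (mem_B_of_mem_V ?_)
    rw [V_eq_top hw hall]
    trivial
  obtain ⟨j, hj⟩ := not_forall.1 hall
  have hg : Good (w ++ [fin j]) := good_append_fin.2 ⟨hw, hj⟩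
  have hper : ∀ x, (x ∈ B w ∨ -x ∈ B w) → x ∈ periodic (w ++ [fin j]) ∧
      -height (w ++ [fin j]) (top (w ++ [fin j])) ≤ height (w ++ [fin j]) x ∧
      height (w ++ [fin j]) x ≤ height (w ++ [fin j]) (top (w ++ [fin j])) := by
    intro x hx
    have hN := height_top_nonneg hg
    rcases hx with hx | hx
    · have hx' := (mem_B_append_fin hg).2 (Or.inl hx)
      have h1 := height_nonneg_of_mem_B hx'
      have h2 := height_le_of_mem_B hg hx'
      exact ⟨mem_periodic_append_fin_of_mem_B hg hx, by linarith, by linarith⟩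
    · have hx' := (mem_B_append_fin hg).2 (Or.inl hx)
      have h1 := height_nonneg_of_mem_B hx'
      have h2 := height_le_of_mem_B hg hx'
      rw [map_neg] at h1 h2
      refine ⟨⟨-1, ?_⟩, by linarith, by linarith⟩
      rw [neg_one_smul, mem_B_append_fin hg, top_append_fin hg]
      refine Or.inr ?_
      convert top_sub_mem_B hw hx using 1
      abel
  obtain ⟨hx₁, hx₂, -⟩ := hper x hx
  obtain ⟨hz₁, -, hz₃⟩ := hper z hz
  have hy := periodic_convex hg hx₁ hz₁ hxy hyz
  have h1 := height_mono (w ++ [fin j]) hxy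
  have h2 := height_mono (w ++ [fin j]) hyz
  by_cases h0 : 0 ≤ height (w ++ [fin j]) y
  · have := sub_smul_top_mem_B hg hy (m := 0) (by simpa using h0) (by linarith)
    rw [zero_smul, sub_zero, mem_B_append_fin hg] at this
    rcases this with h | h
    · exact Or.inl h
    · exact Or.inl (mem_B_of_le_of_mem_or_neg_mem hw hj h hyz hz)
  · have := sub_smul_top_mem_B hg hy (m := -1) (by linarith) (by
      rw [neg_add_cancel, zero_mul]; exact (not_le.1 h0).le)
    rw [neg_one_smul, mem_B_append_fin hg, top_append_fin hg] at this
    refine Or.inr ?_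
    rcases this with h | h
    · refine mem_B_of_le_of_mem_or_neg_mem hw hj ?_ (neg_le_neg hxy)
        (by rw [neg_neg]; exact hx.symm)
      convert top_sub_mem_B hw h using 1
      abel
    · convert top_sub_mem_B hw h using 1
      abel

theorem convex_Binf_union_neg_Binf {w : List (Step n)} (hw : Good w) {j : Fin n}
    (hj : ext j ∉ w) {x y z : Zn n} (hx : x ∈ Binf w j ∨ -x ∈ Binf w j)
    (hz : z ∈ Binf w j ∨ -z ∈ Binf w j) (hxy : x ≤ y) (hyz : y ≤ z) :
    y ∈ Binf w j ∨ -y ∈ Binf w j := by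
  have key : ∀ x, (x ∈ Binf w j ∨ -x ∈ Binf w j) → ∃ k,
      ∀ l, k ≤ l → (x ∈ B (w ++ List.replicate l (fin j)) ∨
        -x ∈ B (w ++ List.replicate l (fin j))) := by
    rintro x (hx | hx)
    all_goals
      obtain ⟨k, hk⟩ := exists_mem_B_append_replicate hw hj hx
      refine ⟨k, fun l hl => ?_⟩
      have := B_append_replicate_mono hw hj hl hk
      tauto
  obtain ⟨k, hk⟩ := key x hx
  obtain ⟨l, hl⟩ := key z hz
  exact (convex_B_union_neg_B (good_append_replicate hw hj (max k l)).1 (hk _ (le_max_left _ _))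
    (hl _ (le_max_right _ _)) hxy hyz).imp (fun h => B_append_replicate_subset_Binf hw hj _ h)
    (fun h => B_append_replicate_subset_Binf hw hj _ h)

end Step

/-! #### Connectedness -/

namespace ComparablyConnected

variable {n : ℕ} {S T : Set (Zn n)}

lemma reflTransGen_mono (h : S ⊆ T) {v w : Zn n}
    (hvw : Relation.ReflTransGen (fun v w => v ∈ S ∧ w ∈ S ∧ (v ≤ w ∨ w ≤ v)) v w) :
    Relation.ReflTransGen (fun v w => v ∈ T ∧ w ∈ T ∧ (v ≤ w ∨ w ≤ v)) v w :=
  Relation.ReflTransGen.mono (fun _ _ h' => ⟨h h'.1, h h'.2.1, h'.2.2⟩) _ _ hvw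

lemma of_exists (h : ∀ v ∈ T, ∀ w ∈ T, ∃ S ⊆ T, ComparablyConnected S ∧ v ∈ S ∧ w ∈ S) :
    ComparablyConnected T := fun v hv w hw =>
  let ⟨_, hST, hS, hv', hw'⟩ := h v hv w hw
  reflTransGen_mono hST (hS v hv' w hw')

lemma singleton (x : Zn n) : ComparablyConnected {x} := by
  rintro _ rfl _ rfl
  exact .refl

lemma union (hS : ComparablyConnected S) (hT : ComparablyConnected T) {a b : Zn n} (ha : a ∈ S)
    (hb : b ∈ T) (hab : a ≤ b ∨ b ≤ a) : ComparablyConnected (S ∪ T) := by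
  have h₁ : ∀ v ∈ S, ∀ w ∈ S, _ := fun v hv w hw =>
    reflTransGen_mono (Set.subset_union_left (t := T)) (hS v hv w hw)
  have h₂ : ∀ v ∈ T, ∀ w ∈ T, _ := fun v hv w hw =>
    reflTransGen_mono (Set.subset_union_right (s := S)) (hT v hv w hw)
  rintro v (hv | hv) w (hw | hw)
  · exact h₁ v hv w hw
  · exact ((h₁ v hv a ha).tail ⟨Or.inl ha, Or.inr hb, hab⟩).trans (h₂ b hb w hw)
  · exact ((h₂ v hv b hb).tail ⟨Or.inr hb, Or.inl ha, hab.symm⟩).trans (h₁ a ha w hw)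
  · exact h₂ v hv w hw

lemma preimage_sub (hS : ComparablyConnected S) (a : Zn n) :
    ComparablyConnected {x | x - a ∈ S} := by
  intro v hv w hw
  have := Relation.ReflTransGen.lift (p := fun v w => v ∈ {x | x - a ∈ S} ∧ w ∈ {x | x - a ∈ S} ∧
    (v ≤ w ∨ w ≤ v)) (· + a) (fun x y h => ⟨by simpa using h.1, by simpa using h.2.1, by
      simpa using h.2.2⟩) _ _ (hS _ hv _ hw)
  simpa [Function.onFun] using this

end ComparablyConnected

namespace Step

variable {n : ℕ}

/-- Provides the link between B and B + δ^j: either the corner a^j is still e_j, which lies above 0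
∈ B, or B and B + δ^j have a common point. -/
lemma top_add_delta_eq_unitVec_or {w : List (Step n)} (hw : Good w) {j : Fin n}
    (hj : ext j ∉ w) :
    top w + delta w j = unitVec j ∨ ∃ x ∈ B w, x + delta w j ∈ B w := by
  induction w with
  | nil => exact Or.inl (zero_add _)
  | cons a w ih =>
    simp only [List.mem_cons, not_or] at hj
    cases a with
    | fin i =>
      have hw' := good_fin_cons.1 hw
      rcases ih hw' hj.2 with h | ⟨x, hx, hx'⟩
      · by_cases hji : j = i
        · subst hji
          refine Or.inr ⟨phi j (top w), Or.inl (by rw [psi_phi]; exact top_mem_B hw'), Or.inr ?_⟩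
          rw [delta, ← map_add, h, psi_phi, sub_self]
          exact zero_mem_B w
        · left
          rw [top, delta, add_assoc, ← map_add, h, phi_apply, deg_unitVec]
          simp [Ne.symm hji]
      · refine Or.inr ⟨phi i x, Or.inl (by rwa [psi_phi]), Or.inl ?_⟩
        rwa [delta, ← map_add, psi_phi]
    | ext i =>
      have hji : j ≠ i := fun h => hj.1 (by rw [h])
      have hg := good_ext_cons.1 hw
      rw [top, delta, if_neg hji]
      refine (ih hg.2 hj.2).imp_right fun ⟨x, hx, hx'⟩ => ⟨x, ?_, ?_⟩
      · change killCoord i x ∈ B w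
        rwa [killCoord_eq_self (apply_eq_zero_of_mem_B hg.1.1 hg.1.2 hx)]
      · change killCoord i (x + delta w j) ∈ B w
        rwa [killCoord_eq_self (apply_eq_zero_of_mem_B hg.1.1 hg.1.2 hx')]

lemma comparablyConnected_B_append_fin {w : List (Step n)} {j : Fin n}
    (hg : Good (w ++ [fin j])) (h : ComparablyConnected (B w)) :
    ComparablyConnected (B (w ++ [fin j])) := by
  have hw := good_append_fin.1 hg
  have heq : B (w ++ [fin j]) = B w ∪ {x | x - delta w j ∈ B w} :=
    Set.ext fun x => mem_B_append_fin hg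
  rw [heq]
  rcases top_add_delta_eq_unitVec_or hw.1 hw.2 with h' | ⟨x, hx, hx'⟩
  · refine h.union (h.preimage_sub _) (zero_mem_B w) (b := unitVec j) ?_ (Or.inl (unitVec_nonneg j))
    rw [← h']
    simpa using top_mem_B hw.1
  · exact h.union (h.preimage_sub _) hx' (b := x + delta w j) (by simpa using hx) (Or.inl le_rfl)

lemma comparablyConnected_B_append_replicate {w : List (Step n)} (hw : Good w) {j : Fin n}
    (hj : ext j ∉ w) (h : ComparablyConnected (B w)) (k : ℕ) :
    ComparablyConnected (B (w ++ List.replicate k (fin j))) := by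
  induction k with
  | zero => simpa using h
  | succ k ih =>
    rw [List.replicate_succ', ← List.append_assoc]
    exact comparablyConnected_B_append_fin
      (good_append_fin.2 (good_append_replicate hw hj k)) ih

theorem comparablyConnected_B {w : List (Step n)} (hw : Good w) : ComparablyConnected (B w) := by
  induction w using List.reverseRecOn with
  | nil => exact .singleton 0
  | append_singleton w a ih =>
    cases a with
    | fin j => exact comparablyConnected_B_append_fin hw (ih (good_append_fin.1 hw).1)
    | ext j =>
      have hw' := good_append_ext.1 hw
      refine .of_exists fun v hv x hx => ?_
      obtain ⟨m, hm⟩ := (mem_B_append_ext hw).1 hv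
      obtain ⟨l, hl⟩ := (mem_B_append_ext hw).1 hx
      -- After translation by kδ both coefficients lie in [0, 2k], so the two points belong to one
      -- translate of the connected set B_{ω*j^{2k}}.
      set k := m.natAbs + l.natAbs with hk
      have key : ∀ (y : Zn n) (m : ℤ), m.natAbs ≤ k → y - m • delta w j ∈ B w →
          y - (-(k : ℤ)) • delta w j ∈ B (w ++ List.replicate (2 * k) (fin j)) := by
        intro y m hm hy
        refine (mem_B_append_replicate hw'.1 hw'.2).2 ⟨(m + k).toNat, by omega, ?_⟩
        have h1 : ((m + k).toNat : ℤ) = m + k := Int.toNat_of_nonneg (by omega)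
        rw [← natCast_zsmul, h1, sub_sub, ← add_smul]
        simpa using hy
      refine ⟨_, fun y hy => ?_, (comparablyConnected_B_append_replicate hw'.1 hw'.2
        (ih hw'.1) (2 * k)).preimage_sub ((-(k : ℤ)) • delta w j),
        key v m (by omega) hm, key x l (by omega) hl⟩
      obtain ⟨i, -, hi⟩ := (mem_B_append_replicate hw'.1 hw'.2).1 hy
      refine (mem_B_append_ext hw).2 ⟨-(k : ℤ) + i, ?_⟩
      rwa [add_smul, ← sub_sub, natCast_zsmul _ i]

theorem comparablyConnected_Binf {w : List (Step n)} (hw : Good w) {j : Fin n}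
    (hj : ext j ∉ w) : ComparablyConnected (Binf w j) := by
  refine .of_exists fun v hv x hx => ?_
  obtain ⟨k, hk⟩ := exists_mem_B_append_replicate hw hj hv
  obtain ⟨l, hl⟩ := exists_mem_B_append_replicate hw hj hx
  exact ⟨_, B_append_replicate_subset_Binf hw hj (max k l),
    comparablyConnected_B (good_append_replicate hw hj _).1,
    B_append_replicate_mono hw hj (le_max_left k l) hk,
    B_append_replicate_mono hw hj (le_max_right k l) hl⟩

end Step

/-! ### Admissible words as lists of steps -/

namespace Word

variable {n : ℕ}

lemma Admissible.of_append {ω τ : Word n} (h : Admissible (ω ++ τ)) : ω.Admissible := by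
  refine ⟨fun σ τ' j h' => ?_, fun σ τ' j l h' => ?_, fun σ τ' h' => ?_⟩
  · have := h.1 σ (τ' ++ τ) j (by rw [h', List.append_assoc])
    simp only [List.mem_append, not_or] at this
    exact ⟨this.1.1, this.2.1⟩
  · exact h.2.1 σ (τ' ++ τ) j l (by rw [h', List.append_assoc])
  · exact h.2.2 σ (τ' ++ τ) (by rw [h', List.append_assoc])

open Classical in
lemma delta_append_fin (ω : Word n) (j i : Fin n) : delta (ω ++ [Letter.fin j]) i =
    if i = j ∨ i ∈ X ω then delta ω i else delta ω i - delta ω j := by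
  simp [delta, deltaRev]

lemma delta_append_inf_ext (ω : Word n) (j i : Fin n) :
    delta (ω ++ [Letter.inf j, Letter.ext]) i = delta ω i := by
  simp [delta, deltaRev]

lemma dir_append_fin (ω : Word n) (j i : Fin n) : dir (ω ++ [Letter.fin j]) i =
    if i = j then dir ω i + delta ω i else dir ω i := by
  simp [dir, delta, dirRev]

lemma dir_append_inf_ext (ω : Word n) (j i : Fin n) :
    dir (ω ++ [Letter.inf j, Letter.ext]) i = dir ω i := by
  simp [dir, dirRev]

lemma B_append_fin (ω : Word n) (j : Fin n) :
    B (ω ++ [Letter.fin j]) = B ω + {0, delta ω j} := by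
  simp [B, BRev, delta]

lemma B_append_inf (ω : Word n) (j : Fin n) :
    B (ω ++ [Letter.inf j]) = B ω + Set.range (fun m : ℕ => m • delta ω j) := by
  simp [B, BRev, delta]

lemma B_append_inf_ext (ω : Word n) (j : Fin n) :
    B (ω ++ [Letter.inf j, Letter.ext]) = B ω + Set.range (fun m : ℤ => m • delta ω j) := by
  simp [B, BRev, delta]

lemma V_append_fin (ω : Word n) (j : Fin n) : V (ω ++ [Letter.fin j]) = V ω := by
  simp [V, VRev]

lemma V_append_inf (ω : Word n) (j : Fin n) : V (ω ++ [Letter.inf j]) = V ω := by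
  simp [V, VRev]

lemma V_append_inf_ext (ω : Word n) (j : Fin n) :
    V (ω ++ [Letter.inf j, Letter.ext]) = V ω ⊔ AddSubgroup.zmultiples (delta ω j) := by
  simp [V, VRev, delta]

end Word

namespace Step

variable {n : ℕ}

/-- The word that belongs to a list of steps. -/
def toWord : List (Step n) → Word n
  | [] => []
  | fin j :: w => Letter.fin j :: toWord w
  | ext j :: w => Letter.inf j :: Letter.ext :: toWord w

lemma toWord_append (v w : List (Step n)) : toWord (v ++ w) = toWord v ++ toWord w := by
  induction v with
  | nil => rfl
  | cons a v ih => cases a <;> simp [toWord, ih]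

lemma toWord_append_fin (w : List (Step n)) (j : Fin n) :
    toWord (w ++ [fin j]) = toWord w ++ [Letter.fin j] := by
  rw [toWord_append]; rfl

lemma toWord_append_ext (w : List (Step n)) (j : Fin n) :
    toWord (w ++ [ext j]) = toWord w ++ [Letter.inf j, Letter.ext] := by
  rw [toWord_append]; rfl

lemma toWord_append_replicate (w : List (Step n)) (j : Fin n) (k : ℕ) :
    toWord (w ++ List.replicate k (fin j)) = toWord w ++ List.replicate k (Letter.fin j) := by
  rw [toWord_append]
  congr 1
  induction k with
  | zero => rfl
  | succ k ih => simp [List.replicate_succ, toWord, ih]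

lemma toWord_ne_append_inf (w : List (Step n)) (σ : Word n) (j : Fin n) :
    toWord w ≠ σ ++ [Letter.inf j] := by
  intro h
  have h' := congrArg List.getLast? h
  rw [List.getLast?_append] at h'
  induction w using List.reverseRecOn with
  | nil => simp [toWord] at h
  | append_singleton w a _ => cases a <;> simp [toWord_append, toWord] at h'

lemma mem_X_toWord {w : List (Step n)} {j : Fin n} : j ∈ Word.X (toWord w) ↔ ext j ∈ w := by
  change _ <:+: _ ↔ _
  induction w with
  | nil => simp [toWord]
  | cons a w ih =>
    cases a with
    | fin i => simp [toWord, List.infix_cons_iff, ih]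
    | ext i => simp [toWord, List.infix_cons_iff, ih]

lemma delta_toWord {w : List (Step n)} (hw : Good w) (i : Fin n) :
    (toWord w).delta i = delta w i := by
  classical
  induction w using List.reverseRecOn generalizing i with
  | nil => rfl
  | append_singleton w a ih =>
    cases a with
    | fin j =>
      have hw' := good_append_fin.1 hw
      rw [toWord_append_fin, Word.delta_append_fin, ih hw'.1, ih hw'.1, delta_append_fin hw,
        mem_X_toWord]
      split_ifs <;> simp
    | ext j =>
      rw [toWord_append_ext, Word.delta_append_inf_ext, ih (good_append_ext.1 hw).1,
        delta_append_ext]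

/-- Appending j ≠ i adds δ^j to the top and subtracts it from δ^i; appending i adds δ^i to the top.
Hence the direction of the differential is the top element of B_{ω*i}, the period of the convex set
from which the complex is cut. -/
lemma dir_toWord {w : List (Step n)} (hw : Good w) {i : Fin n} (hi : ext i ∉ w) :
    (toWord w).dir i = top w + delta w i := by
  induction w using List.reverseRecOn with
  | nil => exact (zero_add _).symm
  | append_singleton w a ih =>
    have hi' : ext i ∉ w := fun h => hi (by simp [h])
    cases a with
    | fin j =>
      have hw' := good_append_fin.1 hw
      rw [toWord_append_fin, Word.dir_append_fin, ih hw'.1 hi', delta_toWord hw'.1,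
        delta_append_fin hw, top_append_fin hw]
      by_cases hij : i = j
      · simp [hij]
      · simp [hij, hi']
    | ext j =>
      rw [toWord_append_ext, Word.dir_append_inf_ext, ih (good_append_ext.1 hw).1 hi',
        delta_append_ext, top_append_ext]

lemma B_toWord {w : List (Step n)} (hw : Good w) : (toWord w).B = B w := by
  induction w using List.reverseRecOn with
  | nil => rfl
  | append_singleton w a ih =>
    ext x
    cases a with
    | fin j =>
      have hw' := good_append_fin.1 hw
      rw [toWord_append_fin, Word.B_append_fin, ih hw'.1, delta_toWord hw'.1,
        mem_B_append_fin hw, Set.mem_add]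
      constructor
      · rintro ⟨y, hy, z, rfl | rfl, rfl⟩
        · exact Or.inl (by simpa using hy)
        · exact Or.inr (by simpa using hy)
      · rintro (h | h)
        · exact ⟨x, h, 0, Or.inl rfl, add_zero x⟩
        · exact ⟨_, h, _, Or.inr rfl, sub_add_cancel _ _⟩
    | ext j =>
      have hw' := good_append_ext.1 hw
      rw [toWord_append_ext, Word.B_append_inf_ext, ih hw'.1, delta_toWord hw'.1,
        mem_B_append_ext hw, Set.mem_add]
      constructor
      · rintro ⟨y, hy, _, ⟨m, rfl⟩, rfl⟩
        exact ⟨m, by simpa using hy⟩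
      · rintro ⟨m, hm⟩
        exact ⟨_, hm, _, ⟨m, rfl⟩, sub_add_cancel _ _⟩

lemma B_toWord_append_inf {w : List (Step n)} (hw : Good w) (j : Fin n) :
    Word.B (toWord w ++ [Letter.inf j]) = Binf w j := by
  ext x
  rw [Word.B_append_inf, B_toWord hw, delta_toWord hw, Set.mem_add]
  constructor
  · rintro ⟨y, hy, _, ⟨m, rfl⟩, rfl⟩
    exact ⟨m, by simpa using hy⟩
  · rintro ⟨m, hm⟩
    exact ⟨_, hm, _, ⟨m, rfl⟩, sub_add_cancel _ _⟩

lemma V_toWord {w : List (Step n)} (hw : Good w) : (toWord w).V = V w := by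
  induction w using List.reverseRecOn with
  | nil => rfl
  | append_singleton w a ih =>
    cases a with
    | fin j => rw [toWord_append_fin, Word.V_append_fin, ih (good_append_fin.1 hw).1, V_append_fin]
    | ext j =>
      have hw' := good_append_ext.1 hw
      ext x
      rw [toWord_append_ext, Word.V_append_inf_ext, ih hw'.1, delta_toWord hw'.1,
        mem_V_append_ext hw, AddSubgroup.mem_sup]
      constructor
      · rintro ⟨y, hy, z, hz, rfl⟩
        obtain ⟨m, rfl⟩ := AddSubgroup.mem_zmultiples_iff.1 hz
        exact ⟨m, by simpa using hy⟩
      · rintro ⟨m, hm⟩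
        exact ⟨_, hm, _, AddSubgroup.zsmul_mem_zmultiples _ m, sub_add_cancel _ _⟩

lemma exists_toWord_eq_append_inf {w : List (Step n)} {j : Fin n} (h : ext j ∈ w) :
    ∃ σ τ : Word n, toWord w = σ ++ [Letter.inf j] ++ τ := by
  obtain ⟨v, v', rfl⟩ := List.append_of_mem h
  exact ⟨toWord v, Letter.ext :: toWord v', by simp [toWord_append, toWord]⟩

/-- An admissible word is given by a list of steps, possibly followed by a letter `j^∞`. -/
theorem exists_eq_toWord {ω : Word n} (h : ω.Admissible) :
    (∃ w, Good w ∧ ω = toWord w) ∨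
      ∃ w j, Good w ∧ ext j ∉ w ∧ ω = toWord w ++ [Letter.inf j] := by
  induction ω using List.reverseRecOn with
  | nil => exact Or.inl ⟨[], by simp [Good], rfl⟩
  | append_singleton ω a ih =>
    rcases ih h.of_append with ⟨w, hw, rfl⟩ | ⟨w, i, hw, hi, rfl⟩
    · have key : ∀ j, a = Letter.fin j ∨ a = Letter.inf j → ext j ∉ w := by
        intro j ha hj
        obtain ⟨σ, τ, hστ⟩ := exists_toWord_eq_append_inf hj
        have := h.1 σ (τ ++ [a]) j (by rw [hστ, List.append_assoc])
        rcases ha with rfl | rfl <;> simp at this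
      cases a with
      | fin j =>
        exact Or.inl ⟨w ++ [fin j], good_append_fin.2 ⟨hw, key j (Or.inl rfl)⟩,
          (toWord_append_fin w j).symm⟩
      | inf j => exact Or.inr ⟨w, j, hw, key j (Or.inr rfl), rfl⟩
      | ext =>
        obtain ⟨σ, j, hσ⟩ := h.2.2 (toWord w) [] (by simp)
        exact absurd hσ (toWord_ne_append_inf w σ j)
    · obtain rfl := h.2.1 (toWord w) [] i a (by simp)
      exact Or.inl ⟨w ++ [ext i], good_append_ext.2 ⟨hw, hi⟩, by simp [toWord_append_ext]⟩

lemma exists_eq_toWord_of_append_fin {ω : Word n} {j : Fin n}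
    (h : Word.Admissible (ω ++ [Letter.fin j])) : ∃ w, Good w ∧ ext j ∉ w ∧ ω = toWord w := by
  rcases exists_eq_toWord h.of_append with ⟨w, hw, rfl⟩ | ⟨w, i, hw, hi, rfl⟩
  · refine ⟨w, hw, fun hj => ?_, rfl⟩
    obtain ⟨σ, τ, hστ⟩ := exists_toWord_eq_append_inf hj
    have := h.1 σ (τ ++ [Letter.fin j]) j (by rw [hστ, List.append_assoc])
    simp at this
  · have := h.2.1 (toWord w) [] i (Letter.fin j) (by simp)
    simp at this

lemma exists_eq_toWord_of_final {ω : Word n} (h : ω.Final) :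
    ∃ w, Good w ∧ (∀ j, ext j ∈ w) ∧ ω = toWord w := by
  rcases exists_eq_toWord h.1 with ⟨w, hw, rfl⟩ | ⟨w, j, hw, hj, rfl⟩
  · exact ⟨w, hw, fun j => mem_X_toWord.1 (h.2 j), rfl⟩
  · refine absurd (mem_X_toWord.1 ?_) hj
    have : [Letter.inf j, Letter.ext] <:+: toWord w ++ [Letter.inf j] := h.2 j
    rw [← List.reverse_infix] at this
    simp only [List.reverse_append, List.reverse_cons, List.reverse_nil, List.nil_append,
      List.cons_append, List.infix_cons_iff] at this
    rcases this with h' | h'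
    · simp at h'
    · change _ <:+: _
      rw [← List.reverse_infix]
      simpa using h'

end Step

/-! ### Downsets that are cut out of convex sets -/

section Cut

variable {n : ℕ}

/-- The downset of all elements below some element of `C` that are not above any element of
`C \ L`. -/
def cut (C L : Set (Zn n)) : Downsets n where
  carrier := {v | (∃ c ∈ C, v ≤ c) ∧ ∀ c ∈ C, c ≤ v → c ∈ L}
  lower' := fun _ _ hab ⟨⟨c, hc, hca⟩, h⟩ =>
    ⟨⟨c, hc, hab.trans hca⟩, fun c hc hcb => h c hc (hcb.trans hab)⟩

lemma mem_cut {C L : Set (Zn n)} {v : Zn n} :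
    v ∈ cut C L ↔ (∃ c ∈ C, v ≤ c) ∧ ∀ c ∈ C, c ≤ v → c ∈ L := Iff.rfl

lemma cut_mono {C L M : Set (Zn n)} (h : ∀ x ∈ C, x ∈ L → x ∈ M) : cut C L ≤ cut C M :=
  fun _ hv => ⟨hv.1, fun c hc hcv => h c hc (hv.2 c hc hcv)⟩

/-- The set `L` is closed downwards in `C`. -/
def IsLowerIn (C L : Set (Zn n)) : Prop := ∀ x ∈ C, x ∈ L → ∀ y ∈ C, y ≤ x → y ∈ L

/-- An element of the difference lies below one element of C and above another one, so it belongs to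
C by convexity; parts of the downsets outside C cancel. -/
lemma cut_sdiff_cut {C L M : Set (Zn n)}
    (hC : ∀ x ∈ C, ∀ y ∈ C, ∀ z, x ≤ z → z ≤ y → z ∈ C) (hL : IsLowerIn C L)
    (hM : IsLowerIn C M) :
    (cut C L : Set (Zn n)) \ cut C M = {v | v ∈ C ∧ v ∈ L ∧ v ∉ M} := by
  ext v
  constructor
  · rintro ⟨⟨⟨c, hc, hvc⟩, h⟩, h'⟩
    have h'' : ¬((∃ c ∈ C, v ≤ c) ∧ ∀ c ∈ C, c ≤ v → c ∈ M) := h'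
    push Not at h''
    obtain ⟨c', hc', hcv, hcM⟩ := h'' ⟨c, hc, hvc⟩
    have hv := hC c' hc' c hc v hcv hvc
    exact ⟨hv, h v hv le_rfl, fun hvM => hcM (hM v hv hvM c' hc' hcv)⟩
  · rintro ⟨hv, hvL, hvM⟩
    exact ⟨⟨⟨v, hv, le_rfl⟩, fun c hc hcv => hL v hv hvL c hc hcv⟩,
      fun h => hvM (h.2 v hv le_rfl)⟩

end Cut

/-! ### Translations -/

section Shift

variable {n : ℕ}

/-- The translate of a downset. -/
def shiftLower (a : Zn n) (s : Downsets n) : Downsets n where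
  carrier := {v | v - a ∈ s}
  lower' := fun _ _ h h' => s.lower (sub_le_sub_right h a) h'

lemma shiftLower_mono (a : Zn n) {s t : Downsets n} (h : s ≤ t) :
    shiftLower a s ≤ shiftLower a t := fun _ hv => h hv

lemma shiftLower_shiftLower (a b : Zn n) (s : Downsets n) :
    shiftLower a (shiftLower b s) = shiftLower (a + b) s := by
  ext v
  change v - a - b ∈ s ↔ v - (a + b) ∈ s
  rw [sub_sub]

lemma shiftLower_zero (s : Downsets n) : shiftLower 0 s = s := by
  ext v
  change v - 0 ∈ s ↔ v ∈ s
  rw [sub_zero]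

lemma shiftLower_cut {a : Zn n} {C : Set (Zn n)} (h : ∀ x, x - a ∈ C ↔ x ∈ C)
    (L : Set (Zn n)) : shiftLower a (cut C L) = cut C {x | x - a ∈ L} := by
  ext v
  change v - a ∈ cut C L ↔ v ∈ cut C _
  rw [mem_cut, mem_cut]
  refine and_congr ⟨?_, ?_⟩ ⟨?_, ?_⟩
  · rintro ⟨c, hc, hvc⟩
    exact ⟨c + a, by rw [← h]; simpa using hc, sub_le_iff_le_add.1 hvc⟩
  · rintro ⟨c, hc, hvc⟩
    exact ⟨c - a, (h c).2 hc, sub_le_sub_right hvc a⟩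
  · intro h' c hc hcv
    exact h' _ ((h c).2 hc) (sub_le_sub_right hcv a)
  · intro h' c hc hcv
    have : c + a - a ∈ L := h' (c + a) (by rw [← h]; simpa using hc) (le_sub_iff_add_le.1 hcv)
    simpa using this

/-- The translate of a quadruple. -/
def Quad.shift (a : Zn n) (x : Quad (Downsets n)) : Quad (Downsets n) where
  b := shiftLower a x.b
  p := shiftLower a x.p
  q := shiftLower a x.q
  z := shiftLower a x.z
  hpb := shiftLower_mono a x.hpb
  hqp := shiftLower_mono a x.hqp
  hzq := shiftLower_mono a x.hzq

lemma componentsMeeting_preimage_subset {A C : Set (Zn n)} {f : Zn n → Zn n}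
    (hf : Function.Injective f)
    (h : ∀ x y, (x ≤ y ∨ y ≤ x) → (f x ≤ f y ∨ f y ≤ f x)) :
    componentsMeeting (f ⁻¹' A) (f ⁻¹' C) ⊆ f ⁻¹' componentsMeeting A C := by
  rintro v ⟨hv, w, hw, hwC, hr⟩
  let F : (comparabilityGraph n).induce (f ⁻¹' A) →g (comparabilityGraph n).induce A :=
    { toFun := fun x => ⟨f x.1, x.2⟩
      map_rel' := fun {x y} hxy => by
        simp only [comparabilityGraph, SimpleGraph.comap_adj, SimpleGraph.fromRel_adj,
          Function.Embedding.subtype_apply] at hxy ⊢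
        exact ⟨hf.ne hxy.1, h _ _ hxy.2⟩ }
  exact ⟨hv, f w, hw, hwC, hr.map F⟩

lemma componentsMeeting_preimage {A C : Set (Zn n)} (f : Zn n ≃ Zn n)
    (h : ∀ x y, (x ≤ y ∨ y ≤ x) → (f x ≤ f y ∨ f y ≤ f x))
    (h' : ∀ x y, (x ≤ y ∨ y ≤ x) → (f.symm x ≤ f.symm y ∨ f.symm y ≤ f.symm x)) :
    componentsMeeting (f ⁻¹' A) (f ⁻¹' C) = f ⁻¹' componentsMeeting A C := by
  refine (componentsMeeting_preimage_subset f.injective h).antisymm fun v hv => ?_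
  have := componentsMeeting_preimage_subset (A := f ⁻¹' A) (C := f ⁻¹' C) f.symm.injective h'
  rw [← Set.preimage_comp, ← Set.preimage_comp, Equiv.self_comp_symm, Set.preimage_id,
    Set.preimage_id] at this
  simpa using this hv

lemma componentsMeeting_sub (A C : Set (Zn n)) (a : Zn n) :
    componentsMeeting {v | v - a ∈ A} {v | v - a ∈ C} = {v | v - a ∈ componentsMeeting A C} :=
  componentsMeeting_preimage (Equiv.subRight a)
    (fun _ _ => Or.imp (sub_le_sub_right · a) (sub_le_sub_right · a))
    (fun _ _ => Or.imp (add_le_add_left · a) (add_le_add_left · a))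

lemma componentsMeeting_neg (A C : Set (Zn n)) :
    componentsMeeting {v | -v ∈ A} {v | -v ∈ C} = {v | -v ∈ componentsMeeting A C} :=
  componentsMeeting_preimage (Equiv.neg _)
    (fun _ _ h => (h.imp neg_le_neg neg_le_neg).symm)
    (fun _ _ h => (h.imp neg_le_neg neg_le_neg).symm)

lemma Quad.represents_iff {x : Quad (Downsets n)} {P : Zn n} {ω : Word n} :
    x.Represents P ω ↔ x.zSet = {v | P - v ∈ ω.B} ∧ x.bSet = {v | v - P ∈ ω.B} := by
  have h₁ : P +ᵥ ω.Z = {v | P - v ∈ ω.B} := by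
    ext v
    rw [Set.mem_vadd_set_iff_neg_vadd_mem]
    change -(-P + v) ∈ ω.B ↔ P - v ∈ ω.B
    rw [neg_add, neg_neg, sub_eq_add_neg]
  have h₂ : P +ᵥ ω.B = {v | v - P ∈ ω.B} := by
    ext v
    rw [Set.mem_vadd_set_iff_neg_vadd_mem]
    change -P + v ∈ ω.B ↔ v - P ∈ ω.B
    rw [neg_add_eq_sub]
  rw [Quad.Represents, h₁, h₂]

lemma Quad.Represents.shift {x : Quad (Downsets n)} {P : Zn n} {ω : Word n}
    (h : x.Represents P ω) (a : Zn n) : (x.shift a).Represents (P + a) ω := by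
  rw [Quad.represents_iff] at h ⊢
  constructor
  · refine (componentsMeeting_sub ((x.p : Set (Zn n)) \ x.z) (x.p \ x.q) a).trans ?_
    change {v | v - a ∈ x.zSet} = _
    rw [h.1]
    ext v
    change P - (v - a) ∈ ω.B ↔ P + a - v ∈ ω.B
    rw [← sub_add, sub_add_eq_add_sub]
  · refine (componentsMeeting_sub ((x.b : Set (Zn n)) \ x.q) (x.p \ x.q) a).trans ?_
    change {v | v - a ∈ x.bSet} = _
    rw [h.2]
    ext v
    change v - a - P ∈ ω.B ↔ v - (P + a) ∈ ω.B
    rw [sub_sub, add_comm]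

end Shift

/-! ### Standard representatives -/

section Profile

variable {n : ℕ}

/-- The data needed to construct a representative with `B(z,q,p,b) = T` and `Z(z,q,p,b) = -T`. -/
structure Profile (T : Set (Zn n)) (V : AddSubgroup (Zn n)) (h : Zn n →+ ℤ) : Prop where
  convex : ∀ x ∈ {x | x ∈ T ∨ -x ∈ T}, ∀ y ∈ {x | x ∈ T ∨ -x ∈ T}, ∀ z, x ≤ z → z ≤ y →
    z ∈ {x | x ∈ T ∨ -x ∈ T}
  connected : ComparablyConnected T
  mono : ∀ x y, x ≤ y → h x ≤ h y
  nonneg : ∀ x ∈ T, 0 ≤ h x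
  mem_V : ∀ x ∈ T, h x = 0 → x ∈ V
  h_eq_zero : ∀ x ∈ V, h x = 0
  V_subset : ∀ x ∈ V, x ∈ T

namespace Profile

variable {T : Set (Zn n)} {V : AddSubgroup (Zn n)} {h : Zn n →+ ℤ}

lemma mem_V_of_mem (H : Profile T V h) {x : Zn n} (hx : x ∈ T ∨ -x ∈ T) (h0 : h x = 0) :
    x ∈ V := by
  rcases hx with hx | hx
  · exact H.mem_V x hx h0
  · exact neg_mem_iff.1 (H.mem_V _ hx (by rw [map_neg, h0, neg_zero]))

lemma mem_of_nonneg (H : Profile T V h) {x : Zn n} (hx : x ∈ T ∨ -x ∈ T) (h0 : 0 ≤ h x) :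
    x ∈ T := by
  rcases hx with hx | hx
  · exact hx
  · have := H.nonneg _ hx
    rw [map_neg] at this
    exact H.V_subset _ (H.mem_V_of_mem (Or.inr hx) (by linarith))

lemma neg_mem_of_nonpos (H : Profile T V h) {x : Zn n} (hx : x ∈ T ∨ -x ∈ T) (h0 : h x ≤ 0) :
    -x ∈ T :=
  H.mem_of_nonneg (x := -x) (by rwa [neg_neg, or_comm]) (by rw [map_neg]; linarith)

variable (T h) in
/-- The standard representative. -/
def quad : Quad (Downsets n) where
  b := cut {x | x ∈ T ∨ -x ∈ T} Set.univ
  p := cut {x | x ∈ T ∨ -x ∈ T} {x | h x ≤ 0}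
  q := cut {x | x ∈ T ∨ -x ∈ T} {x | h x < 0}
  z := cut {x | x ∈ T ∨ -x ∈ T} ∅
  hpb := cut_mono fun _ _ _ => trivial
  hqp := cut_mono fun x _ (hx : h x < 0) => hx.le
  hzq := cut_mono fun _ _ h => h.elim

lemma isLowerIn_lt (H : Profile T V h) (C : Set (Zn n)) : IsLowerIn C {x | h x < 0} :=
  fun _ _ hx _ _ hyx => (H.mono _ _ hyx).trans_lt hx

lemma isLowerIn_le (H : Profile T V h) (C : Set (Zn n)) : IsLowerIn C {x | h x ≤ 0} :=
  fun _ _ hx _ _ hyx => (H.mono _ _ hyx).trans hx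

lemma cut_le_sdiff (H : Profile T V h) {M : Set (Zn n)}
    (hM : IsLowerIn {x | x ∈ T ∨ -x ∈ T} M) :
    ((quad T h).p : Set (Zn n)) \ cut {x | x ∈ T ∨ -x ∈ T} M = {v | -v ∈ T ∧ v ∉ M} := by
  refine (cut_sdiff_cut H.convex (H.isLowerIn_le _) hM).trans ?_
  ext v
  refine ⟨fun hv => ⟨H.neg_mem_of_nonpos hv.1 hv.2.1, hv.2.2⟩, fun hv => ⟨Or.inr hv.1, ?_, hv.2⟩⟩
  have := H.nonneg _ hv.1
  rw [map_neg] at this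
  change h v ≤ 0
  linarith

lemma cut_sdiff_lt (H : Profile T V h) {L : Set (Zn n)}
    (hL : IsLowerIn {x | x ∈ T ∨ -x ∈ T} L) :
    (cut {x | x ∈ T ∨ -x ∈ T} L : Set (Zn n)) \ (quad T h).q = {v | v ∈ T ∧ v ∈ L} := by
  refine (cut_sdiff_cut H.convex hL (H.isLowerIn_lt _)).trans ?_
  ext v
  exact ⟨fun hv => ⟨H.mem_of_nonneg hv.1 (not_lt.1 hv.2.2), hv.2.1⟩,
    fun hv => ⟨Or.inl hv.1, hv.2, not_lt.2 (H.nonneg _ hv.1)⟩⟩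

lemma p_sdiff_q (H : Profile T V h) :
    ((quad T h).p : Set (Zn n)) \ (quad T h).q = {v | v ∈ V} := by
  refine (H.cut_sdiff_lt (H.isLowerIn_le _)).trans ?_
  ext v
  exact ⟨fun hv => H.mem_V _ hv.1 (le_antisymm hv.2 (H.nonneg _ hv.1)),
    fun hv => ⟨H.V_subset _ hv, (H.h_eq_zero _ hv).le⟩⟩

lemma componentsMeeting_eq_self (H : Profile T V h) :
    componentsMeeting T {v | v ∈ V} = T :=
  componentsMeeting_eq (fun v hv => H.V_subset v hv) subset_rfl ⟨0, V.zero_mem⟩ H.connected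
    fun _ _ _ hw _ => hw

lemma componentsMeeting_neg_eq_self (H : Profile T V h) :
    componentsMeeting {v | -v ∈ T} {v | v ∈ V} = {v | -v ∈ T} := by
  have : {v | v ∈ V} = {v | -v ∈ {v | v ∈ V}} :=
    Set.ext fun v => (neg_mem_iff (H := V) (x := v)).symm
  rw [this, componentsMeeting_neg, H.componentsMeeting_eq_self]

/-- The construction gives b \ q = T and p \ z = -T on the nose, and both are connected and contain
p \ q = V. -/
lemma represents (H : Profile T V h) {ω : Word n} (hω : ω.B = T) :
    (quad T h).Represents 0 ω := by
  rw [Quad.represents_iff, hω, Quad.zSet, Quad.bSet, H.p_sdiff_q]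
  have h₁ := H.cut_le_sdiff (M := ∅) (fun _ _ h => h.elim)
  have h₂ := H.cut_sdiff_lt (L := Set.univ) (fun _ _ _ _ _ _ => trivial)
  simp only [Set.mem_empty_iff_false, not_false_eq_true, and_true, Set.mem_univ] at h₁ h₂
  constructor
  · refine (congrArg (componentsMeeting · _) h₁).trans ?_
    simpa using H.componentsMeeting_neg_eq_self
  · refine (congrArg (componentsMeeting · _) h₂).trans ?_
    simpa using H.componentsMeeting_eq_self

end Profile

end Profile

namespace Step

variable {n : ℕ} {w : List (Step n)} {j : Fin n}

lemma profile_B (hw : Good w) : Profile (B w) (V w) (height w) where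
  convex _ hx _ hy _ := convex_B_union_neg_B hw hx hy
  connected := comparablyConnected_B hw
  mono _ _ := height_mono w
  nonneg _ := height_nonneg_of_mem_B
  mem_V _ := mem_V_of_mem_B
  h_eq_zero _ := height_eq_zero_of_mem_V
  V_subset _ := mem_B_of_mem_V

lemma height_sub_smul_delta (hw : Good w) (hj : ext j ∉ w) (x : Zn n) (m : ℤ) :
    height w (x - m • delta w j) = height w x - m := by
  rw [map_sub, map_zsmul, height_delta hw hj, smul_eq_mul, mul_one]

lemma B_subset_Binf : B w ⊆ Binf w j := fun x hx => ⟨0, by rwa [zero_smul, sub_zero]⟩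

lemma profile_Binf (hw : Good w) (hj : ext j ∉ w) :
    Profile (Binf w j) (V w) (height w) where
  convex _ hx _ hy _ := convex_Binf_union_neg_Binf hw hj hx hy
  connected := comparablyConnected_Binf hw hj
  mono _ _ := height_mono w
  nonneg x := fun ⟨m, hm⟩ => by
    have := height_nonneg_of_mem_B hm
    rw [← natCast_zsmul, height_sub_smul_delta hw hj] at this
    omega
  mem_V x := fun ⟨m, hm⟩ h0 => by
    have := height_nonneg_of_mem_B hm
    rw [← natCast_zsmul, height_sub_smul_delta hw hj, h0] at this
    obtain rfl : m = 0 := by omega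
    rw [zero_smul, sub_zero] at hm
    exact mem_V_of_mem_B hm h0
  h_eq_zero _ := height_eq_zero_of_mem_V
  V_subset _ hx := B_subset_Binf (mem_B_of_mem_V hx)

end Step

/-! ### Existence of representatives, the empty word and final words -/

section WellDefined

variable {n : ℕ}

open Step

theorem exists_represents {ω : Word n} (hω : ω.Admissible) (P : Zn n) :
    ∃ x : Quad (Downsets n), x.Represents P ω := by
  rcases exists_eq_toWord hω with ⟨w, hw, rfl⟩ | ⟨w, j, hw, hj, rfl⟩
  · exact ⟨_, zero_add P ▸ ((profile_B hw).represents (B_toWord hw)).shift P⟩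
  · exact ⟨_, zero_add P ▸ ((profile_Binf hw hj).represents (B_toWord_append_inf hw j)).shift P⟩

lemma Word.Admissible.add_mem_B {ω : Word n} (hω : ω.Admissible) {x y : Zn n} (hx : x ∈ ω.B)
    (hy : y ∈ ω.V) : x + y ∈ ω.B := by
  rcases exists_eq_toWord hω with ⟨w, hw, rfl⟩ | ⟨w, j, hw, hj, rfl⟩
  · rw [B_toWord hw] at hx ⊢
    rw [V_toWord hw] at hy
    exact Step.add_mem_B hx hy
  · rw [B_toWord_append_inf hw] at hx ⊢
    rw [Word.V_append_inf, V_toWord hw] at hy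
    obtain ⟨m, hm⟩ := hx
    exact ⟨m, by rw [add_sub_right_comm]; exact Step.add_mem_B hm hy⟩

theorem represents_iff_of_sub_mem {ω : Word n} (hω : ω.Admissible) {P P' : Zn n}
    (h : P - P' ∈ ω.V) (x : Quad (Downsets n)) : x.Represents P ω ↔ x.Represents P' ω := by
  have key : ∀ {P P'}, P - P' ∈ ω.V → x.Represents P ω → x.Represents P' ω := by
    intro P P' h hx
    rw [Quad.represents_iff] at hx ⊢
    rw [hx.1, hx.2]
    constructor
    · ext v
      refine ⟨fun hv => ?_, fun hv => ?_⟩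
      · have := hω.add_mem_B hv (neg_mem h)
        change P' - v ∈ ω.B
        convert this using 1
        abel
      · have := hω.add_mem_B hv h
        change P - v ∈ ω.B
        convert this using 1
        abel
    · ext v
      refine ⟨fun hv => ?_, fun hv => ?_⟩
      · have := hω.add_mem_B hv h
        change v - P' ∈ ω.B
        convert this using 1
        abel
      · have := hω.add_mem_B hv (neg_mem h)
        change v - P ∈ ω.B
        convert this using 1
        abel
  exact ⟨key h, key (by rw [← neg_sub]; exact neg_mem h)⟩

theorem nonempty_iso_entry_of_represents_nil {P : Zn n} {x : Quad (Downsets n)}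
    (hx : x.Represents P []) {p q : Downsets n} (h : q ≤ p) (hP : P ∉ q)
    (hpq : (p : Set (Zn n)) = (q : Set (Zn n)) ∪ {P}) :
    Nonempty (Sterm.{u} x ≅ entry.{u} p q h) := by
  have hd : (p : Set (Zn n)) \ q = {P} := by
    rw [hpq, Set.union_sdiff_left]
    exact sdiff_eq_left.2 (Set.disjoint_singleton_left.2 hP)
  have hy : (⟨p, p, q, q, le_rfl, h, le_rfl⟩ : Quad (Downsets n)).Represents P [] := by
    have hB : Word.B (n := n) [] = {0} := rfl
    rw [Quad.represents_iff, hB, Quad.zSet, Quad.bSet]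
    simp only [hd, componentsMeeting_self]
    constructor
    · ext v
      simp [sub_eq_zero, eq_comm]
    · ext v
      simp [sub_eq_zero]
  obtain ⟨e⟩ := hx.nonempty_iso.{u} hy
  exact ⟨e ≪≫ stermIsoEntry p q h⟩

theorem final_V_eq_top {ω : Word n} (hω : ω.Final) : ω.V = ⊤ := by
  obtain ⟨w, hw, hall, rfl⟩ := exists_eq_toWord_of_final hω
  rw [V_toWord hw, V_eq_top hw hall]

theorem nonempty_iso_entry_of_final {ω : Word n} (hω : ω.Final) {P : Zn n}
    {x : Quad (Downsets n)} (hx : x.Represents P ω) :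
    Nonempty (Sterm.{u} x ≅ entry.{u} (⊤ : Downsets n) ⊥ bot_le) := by
  have hB : ω.B = Set.univ := by
    obtain ⟨w, hw, hall, rfl⟩ := exists_eq_toWord_of_final hω
    refine Set.eq_univ_of_forall fun v => ?_
    rw [B_toWord hw]
    exact mem_B_of_mem_V (by rw [V_eq_top hw hall]; trivial)
  have hy : (⟨⊤, ⊤, ⊥, ⊥, le_rfl, bot_le, le_rfl⟩ : Quad (Downsets n)).Represents P ω := by
    rw [Quad.represents_iff, hB, Quad.zSet, Quad.bSet]
    simp only [componentsMeeting_self]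
    simp
  obtain ⟨e⟩ := hx.nonempty_iso.{u} hy
  exact ⟨e ≪≫ stermIsoEntry ⊤ ⊥ bot_le⟩

end WellDefined

lemma componentsMeeting_sub_left {n : ℕ} (A C : Set (Zn n)) (a : Zn n) :
    componentsMeeting {v | a - v ∈ A} {v | a - v ∈ C} = {v | a - v ∈ componentsMeeting A C} :=
  componentsMeeting_preimage (Equiv.subLeft a)
    (fun _ _ h => (h.imp (sub_le_sub_left · a) (sub_le_sub_left · a)).symm)
    (fun _ _ h => (h.imp (fun h => add_le_add_left (neg_le_neg h) a)
      (fun h => add_le_add_left (neg_le_neg h) a)).symm)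

/-! ### Subquotients and filtrations -/

section Subquotient

variable {n : ℕ}

lemma IsNaturalSubquotient.of_iso {C D : Type*} [Category C] [Category D] {F F' G G' : C ⥤ D}
    (h : IsNaturalSubquotient F G) (e : F ≅ F') (e' : G ≅ G') : IsNaturalSubquotient F' G' :=
  let ⟨M, i, π, _, _⟩ := h
  ⟨M, i ≫ e'.hom, π ≫ e.hom, inferInstance, inferInstance⟩

/-- Enlarging `b` and shrinking `z` yields a subquotient. -/
lemma isNaturalSubquotient_of_le {b b' p q z z' : Downsets n} (hpb : p ≤ b) (hbb' : b ≤ b')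
    (hqp : q ≤ p) (hz'z : z' ≤ z) (hzq : z ≤ q) :
    IsNaturalSubquotient (Sterm.{u} ⟨b', p, q, z', hpb.trans hbb', hqp, hz'z.trans hzq⟩)
      (Sterm.{u} ⟨b, p, q, z, hpb, hqp, hzq⟩) :=
  ⟨Sterm ⟨b, p, q, z', hpb, hqp, hz'z.trans hzq⟩,
    stermMap _ _ le_rfl hz'z le_rfl le_rfl, stermMap _ _ le_rfl le_rfl hbb' le_rfl,
    mono_stermMap_of_q_eq _ _ _ _ _ _ le_rfl le_rfl,
    epi_stermMap_of_p_eq _ _ _ _ _ _ le_rfl le_rfl⟩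

open Step

/-- The standard representative for j^∞ has p \ q = V_ω, which is also the middle part required for
j^k. So the term for j^k can be represented with the same p and q, a smaller b and a larger z. -/
theorem isNaturalSubquotient_of_represents {w : List (Step n)} (hw : Good w) {j : Fin n}
    (hj : ext j ∉ w) {P : Zn n} {k : ℕ} {x y : Quad (Downsets n)}
    (hx : x.Represents P (toWord w ++ [Letter.inf j]))
    (hy : y.Represents P (toWord w ++ List.replicate k (Letter.fin j))) :
    IsNaturalSubquotient (Sterm.{u} x) (Sterm.{u} y) := by
  have hg := good_append_replicate hw hj k
  have H := profile_Binf hw hj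
  have hsub := B_append_replicate_subset_Binf hw hj k
  set Bk := B (w ++ List.replicate k (fin j)) with hBk
  have hVB : ∀ x ∈ V w, x ∈ Bk := fun x hx => mem_B_of_mem_V (by rwa [V_append_replicate])
  have hlow : ∀ {x y}, x ∈ Bk → y ∈ Binf w j → y ≤ x → y ∈ Bk :=
    mem_B_append_replicate_of_le hw hj
  set C := {x | x ∈ Binf w j ∨ -x ∈ Binf w j}
  -- These sets are chosen such that b \ q = B_{ω*j^k} and p \ z = -B_{ω*j^k}. They are closed
  -- downwards in C because B_{ω*j^k} is closed downwards in B_{ω*j^∞}.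
  let b := cut C {x | height w x < 0 ∨ x ∈ Bk}
  let z := cut C {x | height w x < 0 ∧ -x ∉ Bk}
  have hb : IsLowerIn C {x | height w x < 0 ∨ x ∈ Bk} := by
    rintro x hx (h | h) y hy hyx
    · exact Or.inl (H.isLowerIn_lt C x hx h y hy hyx)
    · by_cases h0 : height w y < 0
      · exact Or.inl h0
      · exact Or.inr (hlow h (H.mem_of_nonneg hy (not_lt.1 h0)) hyx)
  have hz : IsLowerIn C {x | height w x < 0 ∧ -x ∉ Bk} := by
    rintro x hx ⟨h, h'⟩ y hy hyx
    refine ⟨H.isLowerIn_lt C x hx h y hy hyx, fun hyB => h' ?_⟩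
    exact hlow hyB (H.neg_mem_of_nonpos hx h.le) (neg_le_neg hyx)
  have hpb : (Profile.quad (Binf w j) (height w)).p ≤ b := cut_mono fun v hv hv' => by
    rcases lt_or_eq_of_le (show height w v ≤ 0 from hv') with h | h
    · exact Or.inl h
    · exact Or.inr (hVB v (H.mem_V_of_mem hv h))
  have hzq : z ≤ (Profile.quad (Binf w j) (height w)).q := cut_mono fun _ _ h => h.1
  have hbd : (b : Set (Zn n)) \ (Profile.quad (Binf w j) (height w)).q = Bk := by
    refine (H.cut_sdiff_lt hb).trans (Set.ext fun v => ⟨?_, fun hv => ⟨hsub hv, Or.inr hv⟩⟩)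
    rintro ⟨hv, h | h⟩
    · exact absurd (H.nonneg v hv) (not_le.2 h)
    · exact h
  have hzd : ((Profile.quad (Binf w j) (height w)).p : Set (Zn n)) \ z = {v | -v ∈ Bk} := by
    refine (H.cut_le_sdiff hz).trans (Set.ext fun v => ⟨?_, fun hv => ⟨hsub hv, fun h => h.2 hv⟩⟩)
    rintro ⟨hv, h⟩
    by_contra hvB
    refine h ⟨?_, hvB⟩
    have h0 := H.nonneg _ hv
    rw [map_neg] at h0
    refine lt_of_le_of_ne (by linarith) fun h' => hvB (hVB _ ?_)
    exact neg_mem (H.mem_V_of_mem (Or.inr hv) h')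
  have hP := profile_B hg.1
  rw [V_append_replicate] at hP
  have hy' : (⟨b, (Profile.quad (Binf w j) (height w)).p, (Profile.quad (Binf w j) (height w)).q,
      z, hpb, Profile.quad _ _ |>.hqp, hzq⟩ : Quad (Downsets n)).Represents 0
        (toWord w ++ List.replicate k (Letter.fin j)) := by
    rw [Quad.represents_iff, Quad.zSet, Quad.bSet, ← toWord_append_replicate, B_toWord hg.1]
    simp only [hbd, hzd, H.p_sdiff_q, zero_sub, sub_zero]
    exact ⟨hP.componentsMeeting_neg_eq_self, hP.componentsMeeting_eq_self⟩
  have hx' := (H.represents (B_toWord_append_inf hw j)).shift P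
  have hy'' := hy'.shift P
  rw [zero_add] at hx' hy''
  obtain ⟨e⟩ := hx'.nonempty_iso.{u} hx
  obtain ⟨e'⟩ := hy''.nonempty_iso.{u} hy
  refine IsNaturalSubquotient.of_iso ?_ e e'
  exact isNaturalSubquotient_of_le _ (shiftLower_mono P (cut_mono fun _ _ _ => trivial)) _
    (shiftLower_mono P (cut_mono fun _ _ h => h.elim)) _

end Subquotient

section Filtration

variable {n : ℕ}

open Step

lemma sub_smul_mem_V_of_mem_V_append_ext {w : List (Step n)} {j : Fin n}
    (hg : Good (w ++ [ext j])) {x : Zn n} (hx : x ∈ V (w ++ [ext j])) :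
    x - height w x • delta w j ∈ V w := by
  have hw := good_append_ext.1 hg
  obtain ⟨m, hm⟩ := (mem_V_append_ext hg).1 hx
  have := height_eq_zero_of_mem_V hm
  rw [height_sub_smul_delta hw.1 hw.2, sub_eq_zero] at this
  rwa [this]

lemma smul_delta_mem_V_append_ext {w : List (Step n)} {j : Fin n}
    (hg : Good (w ++ [ext j])) (m : ℤ) : m • delta w j ∈ V (w ++ [ext j]) :=
  (mem_V_append_ext hg).2 ⟨m, by rw [sub_self]; exact zero_mem _⟩

lemma mem_B_append_ext_of_mem_Binf {w : List (Step n)} {j : Fin n}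
    (hg : Good (w ++ [ext j])) {x : Zn n} (hx : x ∈ Binf w j) : x ∈ B (w ++ [ext j]) :=
  let ⟨m, hm⟩ := hx
  (mem_B_append_ext hg).2 ⟨m, by rwa [natCast_zsmul]⟩

/-- The component of `B_{ω * j^∞ ext}` without `V_ω + ℤ_{< 0} δ^j_ω` that contains `V_ω`. -/
lemma componentsMeeting_eq_Binf {w : List (Step n)} {j : Fin n} (hg : Good (w ++ [ext j])) :
    componentsMeeting {x | x ∈ B (w ++ [ext j]) ∧ ¬(x ∈ V (w ++ [ext j]) ∧ height w x < 0)}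
      {x | x ∈ V w} = Binf w j := by
  have hw := good_append_ext.1 hg
  have H := profile_Binf hw.1 hw.2
  refine componentsMeeting_eq (fun v hv => H.V_subset v hv) (fun v hv => ?_)
    ⟨0, (V w).zero_mem⟩ H.connected fun v hv u hu huv => ?_
  · exact ⟨mem_B_append_ext_of_mem_Binf hg hv, fun h => not_lt.2 (H.nonneg v hv) h.2⟩
  · obtain ⟨m, hm⟩ := (mem_B_append_ext hg).1 hu.1
    rcases mem_Binf_or_mem_V_of_comparable hw.1 hw.2 hv hm huv with h | ⟨l, hl, h⟩
    · exact h
    · have h0 := height_eq_zero_of_mem_V h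
      rw [height_sub_smul_delta hw.1 hw.2] at h0
      exact absurd ⟨(mem_V_append_ext hg).2 ⟨l, h⟩, by omega⟩ hu.2

/-- In the standard representative for j^∞ ext, p \ q = V_ω + ℤδ^j. Intermediate downsets cut it
into the slices iδ^j + V_ω. In the i-th quotient the slices below i are missing from b \ q and those
above i from p \ z; by `componentsMeeting_eq_Binf` the surviving components are iδ^j + B_{ω*j^∞} and
its mirror image iδ^j - B_{ω*j^∞}. -/
theorem exists_filtration_of_represents {w : List (Step n)} (hw : Good w) {j : Fin n}
    (hj : ext j ∉ w) {P : Zn n} {x : Quad (Downsets n)}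
    (hx : x.Represents P (toWord w ++ [Letter.inf j, Letter.ext])) :
    ∃ F : ℤ →o Subobject (Sterm.{u} x),
      ∀ (i : ℤ) (y : Quad (Downsets n)),
        y.Represents (P + i • delta w j) (toWord w ++ [Letter.inf j]) →
        Nonempty (cokernel (Subobject.ofLE (F (i - 1)) (F i)
          (F.monotone (sub_le_self i zero_le_one))) ≅ Sterm.{u} y) := by
  have hg : Good (w ++ [ext j]) := good_append_ext.2 ⟨hw, hj⟩
  have H := profile_B hg
  have hlt := H.isLowerIn_lt
  set B' := B (w ++ [ext j]) with hB'
  set V' := V (w ++ [ext j]) with hV'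
  set h' := height (w ++ [ext j]) with hh'
  set C := {x | x ∈ B' ∨ -x ∈ B'} with hC
  -- Two heights occur: that of the extended word vanishes on the whole of V_ω + ℤδ^j, while the
  -- height of ω takes the value i exactly on the slice iδ^j + V_ω.
  let L : ℤ → Set (Zn n) := fun i => {x | h' x < 0 ∨ (x ∈ V' ∧ height w x ≤ i)}
  have hL : ∀ i, IsLowerIn C (L i) := by
    rintro i x hx (h | ⟨h, hi⟩) y hy hyx
    · exact Or.inl (hlt C x hx h y hy hyx)
    · by_cases h0 : h' y < 0
      · exact Or.inl h0
      · have h1 := H.mono y x hyx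
        rw [H.h_eq_zero x h] at h1
        exact Or.inr ⟨H.mem_V_of_mem hy (le_antisymm h1 (not_lt.1 h0)),
          (height_mono w hyx).trans hi⟩
  let r : ℤ →o Downsets n :=
    ⟨fun i => cut C (L i), fun i i' hi => cut_mono fun x _ hx => hx.imp_right fun h =>
      ⟨h.1, h.2.trans hi⟩⟩
  let X := Profile.quad B' h'
  have hr : ∀ i, r i ≤ X.p := fun i => cut_mono fun x _ hx =>
    hx.elim (fun h => le_of_lt h) fun h => (H.h_eq_zero x h.1).le
  have hr' : ∀ i, X.q ≤ r i := fun i => cut_mono fun x _ hx => Or.inl hx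
  have hX : (X.shift P).Represents P (toWord w ++ [Letter.inf j, Letter.ext]) := by
    have := (H.represents (B_toWord hg)).shift P
    rwa [zero_add, toWord_append_ext] at this
  obtain ⟨e⟩ := hX.nonempty_iso.{u} hx
  let rP : ℤ →o Downsets n := ⟨fun i => shiftLower P (r i), fun i i' h =>
    shiftLower_mono P (r.monotone h)⟩
  obtain ⟨F, hF⟩ := exists_filtration (X.shift P).hpb (X.shift P).hqp (X.shift P).hzq e rP
    (fun i => shiftLower_mono P (hr i)) (fun i => shiftLower_mono P (hr' i))
  refine ⟨F, fun i y hy => ?_⟩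
  obtain ⟨e'⟩ := hF i
  let Y : Quad (Downsets n) := ⟨X.b, r i, r (i - 1), X.z, (hr i).trans X.hpb,
    r.monotone (sub_le_self i zero_le_one), X.hzq.trans (hr' _)⟩
  have hδ := smul_delta_mem_V_append_ext hg i
  have hYq : (Y.p : Set (Zn n)) \ Y.q = {x | x - i • delta w j ∈ {x | x ∈ V w}} := by
    refine (cut_sdiff_cut H.convex (hL i) (hL (i - 1))).trans (Set.ext fun v => ⟨?_, fun hv => ?_⟩)
    · rintro ⟨hv, h1 | ⟨h1, h2⟩, h3⟩
      · exact absurd (Or.inl h1) h3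
      · have h4 : ¬ height w v ≤ i - 1 := fun h => h3 (Or.inr ⟨h1, h⟩)
        have h5 := sub_smul_mem_V_of_mem_V_append_ext hg h1
        rwa [show height w v = i by omega] at h5
    · have h1 : v ∈ V' := (mem_V_append_ext hg).2 ⟨i, hv⟩
      have h2 := height_eq_zero_of_mem_V (show v - i • delta w j ∈ V w from hv)
      rw [height_sub_smul_delta hw hj] at h2
      refine ⟨Or.inl (mem_B_of_mem_V h1), Or.inr ⟨h1, by omega⟩, ?_⟩
      rintro (h3 | ⟨-, h3⟩)
      · exact absurd (H.h_eq_zero v h1) h3.ne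
      · omega
  have hYb : (Y.b : Set (Zn n)) \ Y.q = {x | x - i • delta w j ∈
      {x | x ∈ B (w ++ [ext j]) ∧ ¬(x ∈ V (w ++ [ext j]) ∧ height w x < 0)}} := by
    refine (cut_sdiff_cut H.convex (fun _ _ _ _ _ _ => trivial) (hL (i - 1))).trans
      (Set.ext fun v => ?_)
    have hV : v - i • delta w j ∈ V' ↔ v ∈ V' :=
      ⟨fun h => by simpa using add_mem h hδ, fun h => sub_mem h hδ⟩
    have hB : v - i • delta w j ∈ B' ↔ v ∈ B' :=
      ⟨fun h => by simpa using add_mem_B h hδ,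
        fun h => by simpa [sub_eq_add_neg] using add_mem_B h (neg_mem hδ)⟩
    change (v ∈ C ∧ True ∧ ¬(h' v < 0 ∨ (v ∈ V' ∧ height w v ≤ i - 1))) ↔
      v - i • delta w j ∈ B' ∧ ¬(v - i • delta w j ∈ V' ∧ height w (v - i • delta w j) < 0)
    rw [hV, hB, height_sub_smul_delta hw hj]
    constructor
    · rintro ⟨hv, -, h⟩
      rw [not_or] at h
      exact ⟨H.mem_of_nonneg hv (not_lt.1 h.1), fun h0 => h.2 ⟨h0.1, by omega⟩⟩
    · rintro ⟨hv, h⟩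
      refine ⟨Or.inl hv, trivial, ?_⟩
      rintro (h0 | h0)
      · exact absurd (H.nonneg v hv) (not_le.2 h0)
      · exact h ⟨h0.1, by omega⟩
  have hYz : (Y.p : Set (Zn n)) \ Y.z = {x | i • delta w j - x ∈
      {x | x ∈ B (w ++ [ext j]) ∧ ¬(x ∈ V (w ++ [ext j]) ∧ height w x < 0)}} := by
    refine (cut_sdiff_cut H.convex (hL i) (fun _ _ h => h.elim)).trans (Set.ext fun v => ?_)
    have hV : i • delta w j - v ∈ V' ↔ v ∈ V' :=
      ⟨fun h => by simpa using sub_mem hδ h, fun h => sub_mem hδ h⟩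
    have hB : i • delta w j - v ∈ B' ↔ -v ∈ B' :=
      ⟨fun h => by
        simpa [sub_eq_add_neg, add_right_comm] using add_mem_B h (neg_mem hδ),
        fun h => by simpa [add_comm, sub_eq_add_neg] using add_mem_B h hδ⟩
    have hh : height w (i • delta w j - v) = i - height w v := by
      rw [map_sub, map_zsmul, height_delta hw hj, smul_eq_mul, mul_one]
    change (v ∈ C ∧ (h' v < 0 ∨ (v ∈ V' ∧ height w v ≤ i)) ∧ ¬ False) ↔
      i • delta w j - v ∈ B' ∧ ¬(i • delta w j - v ∈ V' ∧ height w (i • delta w j - v) < 0)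
    rw [hV, hB, hh]
    constructor
    · rintro ⟨hv, h | h, -⟩
      · exact ⟨H.neg_mem_of_nonpos hv h.le, fun h0 => h.ne (H.h_eq_zero v h0.1)⟩
      · exact ⟨H.neg_mem_of_nonpos hv (H.h_eq_zero v h.1).le, fun h0 => by omega⟩
    · rintro ⟨hv, h⟩
      refine ⟨Or.inr hv, ?_, not_false⟩
      have h0 := H.nonneg _ hv
      rw [map_neg, neg_nonneg] at h0
      refine h0.lt_or_eq.imp_right fun h1 => ?_
      have h2 := H.mem_V_of_mem (Or.inr hv) h1
      exact ⟨h2, by by_contra h3; exact h ⟨h2, by omega⟩⟩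
  have hY : (Y.shift P).Represents (P + i • delta w j) (toWord w ++ [Letter.inf j]) := by
    rw [add_comm]
    refine Quad.Represents.shift ?_ P
    rw [Quad.represents_iff, B_toWord_append_inf hw, ← componentsMeeting_eq_Binf hg]
    constructor
    · have hYq' : (Y.p : Set (Zn n)) \ Y.q = {x | i • delta w j - x ∈ {x | x ∈ V w}} := by
        rw [hYq]
        ext v
        change v - _ ∈ V w ↔ _ - v ∈ V w
        exact sub_mem_comm_iff
      rw [Quad.zSet, hYq', hYz, componentsMeeting_sub_left]
    · rw [Quad.bSet, hYq, hYb, componentsMeeting_sub]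
  obtain ⟨e''⟩ := hY.nonempty_iso.{u} hy
  exact ⟨e' ≪≫ e''⟩

end Filtration

/-! ### The complexes of `S`-terms -/

namespace Step

variable {n : ℕ} {w : List (Step n)}

lemma sub_smul_top_mem_periodic_iff {x : Zn n} (l : ℤ) :
    x - l • top w ∈ periodic w ↔ x ∈ periodic w := by
  constructor
  · rintro ⟨m, hm⟩
    refine ⟨l + m, ?_⟩
    rwa [add_smul, ← sub_sub]
  · rintro ⟨m, hm⟩
    refine ⟨m - l, ?_⟩
    rwa [sub_smul, sub_sub_sub_cancel_right]

lemma sub_mem_periodic_iff {x v : Zn n} (hv : v ∈ V w) : x - v ∈ periodic w ↔ x ∈ periodic w := by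
  constructor
  · rintro ⟨m, hm⟩
    refine ⟨m, ?_⟩
    have := add_mem_B hm hv
    rwa [sub_right_comm, sub_add_cancel] at this
  · rintro ⟨m, hm⟩
    refine ⟨m, ?_⟩
    have := add_mem_B hm (neg_mem hv)
    rwa [← sub_eq_add_neg, sub_right_comm] at this

lemma B_subset_periodic {x : Zn n} (hx : x ∈ B w) : x ∈ periodic w :=
  ⟨0, by rwa [zero_smul, sub_zero]⟩

lemma neg_mem_periodic_iff (hw : Good w) {x : Zn n} : -x ∈ periodic w ↔ x ∈ periodic w := by
  have key : ∀ {x}, x ∈ periodic w → -x ∈ periodic w := by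
    rintro x ⟨m, hm⟩
    refine ⟨-(m + 1), ?_⟩
    have := top_sub_mem_B hw hm
    convert this using 1
    rw [neg_smul, add_smul, one_smul]
    abel
  exact ⟨fun h => by simpa using key h, key⟩

variable (w) in
/-- The downset `q` of the standard representative in a complex. -/
def chainQ : Downsets n := cut (periodic w) {x | height w x < 0}

variable (w) in
/-- The downset `p` of the standard representative in a complex. -/
def chainP : Downsets n := cut (periodic w) {x | height w x < 0 ∨ x ∈ V w}

lemma convex_periodic (hw : Good w) :
    ∀ x ∈ periodic w, ∀ y ∈ periodic w, ∀ z, x ≤ z → z ≤ y → z ∈ periodic w :=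
  fun _ hx _ hz _ hxy hyz => periodic_convex hw hx hz hxy hyz

lemma isLowerIn_height_lt (C : Set (Zn n)) (a : Zn n) :
    IsLowerIn C {x | x - a ∈ {x | height w x < 0}} :=
  fun _ _ hx _ _ hyx => (height_mono w (sub_le_sub_right hyx a)).trans_lt hx

/-- An element below a point of a + V and of the same height differs from it by a nonnegative vector
of height 0, hence by an element of V. -/
lemma isLowerIn_height_lt_or_mem (C : Set (Zn n)) (a : Zn n) :
    IsLowerIn C {x | x - a ∈ {x | height w x < 0 ∨ x ∈ V w}} := by
  rintro x - hx y - hyx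
  have h := height_mono w (sub_le_sub_right hyx a)
  rcases hx with hx | hx
  · exact Or.inl (h.trans_lt hx)
  · rcases (h.trans_eq (height_eq_zero_of_mem_V hx)).lt_or_eq with h0 | h0
    · exact Or.inl h0
    · refine Or.inr ?_
      have : (x - a) - (y - a) ∈ V w :=
        mem_V_of_nonneg (sub_nonneg.2 (sub_le_sub_right hyx a))
          (by rw [map_sub, height_eq_zero_of_mem_V hx, h0, sub_zero])
      have := sub_mem hx this
      rwa [sub_sub_cancel] at this

/-- The translate by 0 brings the unshifted cut into the form shared with its translates by ±c. -/
lemma chainQ_eq : chainQ w = cut (periodic w) {x | x - 0 ∈ {x | height w x < 0}} := by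
  simp only [sub_zero]
  rfl

lemma chainP_eq :
    chainP w = cut (periodic w) {x | x - 0 ∈ {x | height w x < 0 ∨ x ∈ V w}} := by
  simp only [sub_zero]
  rfl

lemma shiftLower_top_cut (L : Set (Zn n)) : shiftLower (top w) (cut (periodic w) L) =
    cut (periodic w) {x | x - top w ∈ L} :=
  shiftLower_cut (fun x => by simpa using sub_smul_top_mem_periodic_iff (w := w) (x := x) 1) L

lemma shiftLower_neg_top_cut (L : Set (Zn n)) : shiftLower (-top w) (cut (periodic w) L) =
    cut (periodic w) {x | x - -top w ∈ L} :=
  shiftLower_cut (fun x => by simpa using sub_smul_top_mem_periodic_iff (w := w) (x := x) (-1)) L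

lemma shiftLower_chainQ_of_mem_V {v : Zn n} (hv : v ∈ V w) :
    shiftLower v (chainQ w) = chainQ w := by
  rw [chainQ, shiftLower_cut (fun _ => sub_mem_periodic_iff hv)]
  congr 1
  ext x
  change height w (x - v) < 0 ↔ height w x < 0
  rw [map_sub, height_eq_zero_of_mem_V hv, sub_zero]

lemma shiftLower_chainP_of_mem_V {v : Zn n} (hv : v ∈ V w) :
    shiftLower v (chainP w) = chainP w := by
  rw [chainP, shiftLower_cut (fun _ => sub_mem_periodic_iff hv)]
  congr 1
  ext x
  change height w (x - v) < 0 ∨ x - v ∈ V w ↔ height w x < 0 ∨ x ∈ V w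
  rw [map_sub, height_eq_zero_of_mem_V hv, sub_zero]
  exact or_congr_right ⟨fun h => by simpa using add_mem h hv, fun h => sub_mem h hv⟩

lemma chainP_sdiff_chainQ (hw : Good w) :
    (chainP w : Set (Zn n)) \ chainQ w = {x | x ∈ V w} := by
  rw [chainP_eq, chainQ_eq]
  refine (cut_sdiff_cut (convex_periodic hw) (isLowerIn_height_lt_or_mem _ _)
    (isLowerIn_height_lt _ _)).trans (Set.ext fun x => ?_)
  change x ∈ periodic w ∧ (height w (x - 0) < 0 ∨ x - 0 ∈ V w) ∧ ¬height w (x - 0) < 0 ↔ x ∈ V w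
  rw [sub_zero]
  exact ⟨fun h => h.2.1.resolve_left h.2.2, fun h => ⟨B_subset_periodic (mem_B_of_mem_V h),
    Or.inr h, (height_eq_zero_of_mem_V h).not_lt⟩⟩

lemma mem_B_of_mem_periodic (hw : Good w) {x : Zn n} (hx : x ∈ periodic w)
    (h₁ : 0 ≤ height w x) (h₂ : height w x ≤ height w (top w)) : x ∈ B w := by
  have := sub_smul_top_mem_B hw hx (m := 0) (by simpa using h₁) (by simpa using h₂)
  simpa using this

lemma shift_chainQ_sdiff_chainQ (hw : Good w) :
    (shiftLower (top w) (chainQ w) : Set (Zn n)) \ chainQ w =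
      {x | x ∈ B w ∧ height w x < height w (top w)} := by
  have : shiftLower (top w) (chainQ w) = cut (periodic w) {x | x - top w ∈ {x | height w x < 0}} :=
    shiftLower_top_cut _
  rw [this, chainQ_eq]
  refine (cut_sdiff_cut (convex_periodic hw) (isLowerIn_height_lt _ _)
    (isLowerIn_height_lt _ _)).trans (Set.ext fun x => ?_)
  change x ∈ periodic w ∧ height w (x - top w) < 0 ∧ ¬height w (x - 0) < 0 ↔
    x ∈ B w ∧ height w x < height w (top w)
  rw [sub_zero, map_sub, sub_neg, not_lt]
  exact ⟨fun h => ⟨mem_B_of_mem_periodic hw h.1 h.2.2 h.2.1.le, h.2.1⟩,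
    fun h => ⟨B_subset_periodic h.1, h.2, height_nonneg_of_mem_B h.1⟩⟩

lemma shift_chainP_sdiff_chainQ (hw : Good w) :
    (shiftLower (top w) (chainP w) : Set (Zn n)) \ chainQ w = B w := by
  have : shiftLower (top w) (chainP w) =
      cut (periodic w) {x | x - top w ∈ {x | height w x < 0 ∨ x ∈ V w}} :=
    shiftLower_top_cut _
  rw [this, chainQ_eq]
  refine (cut_sdiff_cut (convex_periodic hw) (isLowerIn_height_lt_or_mem _ _)
    (isLowerIn_height_lt _ _)).trans (Set.ext fun x => ?_)
  change x ∈ periodic w ∧ (height w (x - top w) < 0 ∨ x - top w ∈ V w) ∧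
    ¬height w (x - 0) < 0 ↔ x ∈ B w
  rw [sub_zero, map_sub, sub_neg, not_lt]
  constructor
  · rintro ⟨h1, h2, h3⟩
    refine mem_B_of_mem_periodic hw h1 h3 (h2.elim le_of_lt fun h => le_of_eq ?_)
    rw [← sub_eq_zero, ← map_sub]
    exact height_eq_zero_of_mem_V h
  · intro h
    refine ⟨B_subset_periodic h, (height_le_of_mem_B hw h).lt_or_eq.imp_right fun h' => ?_,
      height_nonneg_of_mem_B h⟩
    rw [← neg_sub]
    exact neg_mem (top_sub_mem_V_of_mem_B hw h h')

lemma chainP_sdiff_shift_chainP (hw : Good w) :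
    (chainP w : Set (Zn n)) \ shiftLower (-top w) (chainP w) =
      {x | -x ∈ {x | x ∈ B w ∧ height w x < height w (top w)}} := by
  have : shiftLower (-top w) (chainP w) =
      cut (periodic w) {x | x - -top w ∈ {x | height w x < 0 ∨ x ∈ V w}} :=
    shiftLower_neg_top_cut _
  rw [this, chainP_eq]
  refine (cut_sdiff_cut (convex_periodic hw) (isLowerIn_height_lt_or_mem _ _)
    (isLowerIn_height_lt_or_mem _ _)).trans (Set.ext fun x => ?_)
  change x ∈ periodic w ∧ (height w (x - 0) < 0 ∨ x - 0 ∈ V w) ∧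
    ¬(height w (x - -top w) < 0 ∨ x - -top w ∈ V w) ↔
      -x ∈ B w ∧ height w (-x) < height w (top w)
  rw [sub_zero, sub_neg_eq_add, map_add, map_neg, not_or, not_lt]
  constructor
  · rintro ⟨h1, h2, h3, h4⟩
    have h5 : height w x ≤ 0 := h2.elim le_of_lt fun h => (height_eq_zero_of_mem_V h).le
    have h6 : -x ∈ B w := mem_B_of_mem_periodic hw ((neg_mem_periodic_iff hw).2 h1)
      (by rw [map_neg]; linarith) (by rw [map_neg]; linarith)
    refine ⟨h6, lt_of_le_of_ne (by linarith) fun h7 => h4 ?_⟩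
    have := top_sub_mem_V_of_mem_B hw h6 (by rw [map_neg, h7])
    rwa [sub_neg_eq_add, add_comm] at this
  · rintro ⟨h1, h2⟩
    have h3 := height_nonneg_of_mem_B h1
    rw [map_neg] at h3
    refine ⟨(neg_mem_periodic_iff hw).1 (B_subset_periodic h1), ?_, by linarith, fun h => ?_⟩
    · refine (show height w x ≤ 0 by linarith).lt_or_eq.imp_right fun h => neg_mem_iff.1 ?_
      exact mem_V_of_mem_B h1 (by rw [map_neg, h, neg_zero])
    · have := height_eq_zero_of_mem_V h
      rw [map_add] at this
      linarith

lemma chainP_sdiff_shift_chainQ (hw : Good w) :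
    (chainP w : Set (Zn n)) \ shiftLower (-top w) (chainQ w) = {x | -x ∈ B w} := by
  have : shiftLower (-top w) (chainQ w) =
      cut (periodic w) {x | x - -top w ∈ {x | height w x < 0}} :=
    shiftLower_neg_top_cut _
  rw [this, chainP_eq]
  refine (cut_sdiff_cut (convex_periodic hw) (isLowerIn_height_lt_or_mem _ _)
    (isLowerIn_height_lt _ _)).trans (Set.ext fun x => ?_)
  change x ∈ periodic w ∧ (height w (x - 0) < 0 ∨ x - 0 ∈ V w) ∧
    ¬height w (x - -top w) < 0 ↔ -x ∈ B w
  rw [sub_zero, sub_neg_eq_add, map_add, not_lt]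
  constructor
  · rintro ⟨h1, h2, h3⟩
    have h5 : height w x ≤ 0 := h2.elim le_of_lt fun h => (height_eq_zero_of_mem_V h).le
    exact mem_B_of_mem_periodic hw ((neg_mem_periodic_iff hw).2 h1)
      (by rw [map_neg]; linarith) (by rw [map_neg]; linarith)
  · intro h1
    have h2 := height_le_of_mem_B hw h1
    have h3 := height_nonneg_of_mem_B h1
    rw [map_neg] at h2 h3
    refine ⟨(neg_mem_periodic_iff hw).1 (B_subset_periodic h1), ?_, by linarith⟩
    refine (show height w x ≤ 0 by linarith).lt_or_eq.imp_right fun h => neg_mem_iff.1 ?_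
    exact mem_V_of_mem_B h1 (by rw [map_neg, h, neg_zero])

lemma chainQ_le_chainP : chainQ w ≤ chainP w := cut_mono fun _ _ h => Or.inl h

lemma chainP_le_shift_chainQ (hpos : 0 < height w (top w)) :
    chainP w ≤ shiftLower (top w) (chainQ w) := by
  have : shiftLower (top w) (chainQ w) = cut (periodic w) {x | x - top w ∈ {x | height w x < 0}} :=
    shiftLower_top_cut _
  rw [this]
  refine cut_mono fun x _ hx => ?_
  change height w (x - top w) < 0
  rw [map_sub]
  rcases hx with hx | hx
  · change height w x < 0 at hx
    linarith
  · rw [height_eq_zero_of_mem_V hx]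
    linarith

lemma shift_chainP_le_chainQ (hpos : 0 < height w (top w)) :
    shiftLower (-top w) (chainP w) ≤ chainQ w := by
  have := shiftLower_mono (-top w) (chainP_le_shift_chainQ hpos)
  rwa [shiftLower_shiftLower, neg_add_cancel, shiftLower_zero] at this

/-- The standard representative of `S(P;ω)` in the complex with homology `S(P;ω * j)`, where `w`
is `ω * j`. -/
def chainQuad (w : List (Step n)) (hpos : 0 < height w (top w)) (P : Zn n) :
    Quad (Downsets n) where
  b := shiftLower (P + top w) (chainQ w)
  p := shiftLower P (chainP w)
  q := shiftLower P (chainQ w)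
  z := shiftLower (P - top w) (chainP w)
  hpb := by
    rw [← shiftLower_shiftLower]
    exact shiftLower_mono P (chainP_le_shift_chainQ hpos)
  hqp := shiftLower_mono P chainQ_le_chainP
  hzq := by
    rw [sub_eq_add_neg, ← shiftLower_shiftLower]
    exact shiftLower_mono P (shift_chainP_le_chainQ hpos)

lemma chainQuad_add_of_mem_V {hpos : 0 < height w (top w)} (P : Zn n) {v : Zn n} (hv : v ∈ V w) :
    chainQuad w hpos (P + v) = chainQuad w hpos P := by
  simp only [chainQuad, Quad.mk.injEq]
  refine ⟨?_, ?_, ?_, ?_⟩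
  · rw [add_right_comm, ← shiftLower_shiftLower, shiftLower_chainQ_of_mem_V hv]
  · rw [← shiftLower_shiftLower, shiftLower_chainP_of_mem_V hv]
  · rw [← shiftLower_shiftLower, shiftLower_chainQ_of_mem_V hv]
  · rw [add_sub_right_comm, ← shiftLower_shiftLower, shiftLower_chainP_of_mem_V hv]

end Step

section Complex

variable {n : ℕ} {A : Type*} [AddCommGroup A] {a : A} {r : A → Quad (Downsets n)}

open Classical in
/-- The complex of `S`-terms given by a sequence of quadruples. -/
noncomputable def stermComplex (hz : ∀ j, (r (j + a)).z = (r j).p)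
    (hq : ∀ j, (r (j + a)).q = (r j).b) :
    HomologicalComplex (ExcisiveSystems.{u} n ⥤ AddCommGrpCat.{u}) (ComplexShape.down' a) where
  X j := Sterm (r j)
  d i j := if h : j + a = i then
      stermD (r i) (r j) (by subst h; exact (hz j).le) (by subst h; exact (hq j).le)
    else 0
  shape i j h := dif_neg h
  d_comp_d' i j k hij hjk := by
    have h₁ : j + a = i := hij
    have h₂ : k + a = j := hjk
    rw [dif_pos h₁, dif_pos h₂]
    exact stermD_comp_stermD ..

lemma stermComplex_d (hz : ∀ j, (r (j + a)).z = (r j).p) (hq : ∀ j, (r (j + a)).q = (r j).b)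
    {i j : A} (h : j + a = i) : (stermComplex.{u} hz hq).d i j =
      stermD (r i) (r j) (by subst h; exact (hz j).le) (by subst h; exact (hq j).le) :=
  dif_pos h

theorem nonempty_stermComplex_homology_iso (hz : ∀ j, (r (j + a)).z = (r j).p)
    (hq : ∀ j, (r (j + a)).q = (r j).b) {i j k : A} (hij : j + a = i) (hjk : k + a = j)
    (hz₁ : (r j).z = (r k).p) (hq₁ : (r i).q = (r j).b) :
    Nonempty ((stermComplex.{u} hz hq).homology j ≅
      Sterm.{u} (homologyQuad (r i) (r j) (r k) hz₁ hq₁)) := by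
  have hz₂ : (r i).z = (r j).p := by subst hij; exact hz j
  have hq₂ : (r j).q = (r k).b := by subst hjk; exact hq k
  let D := stermHomologyData.{u} hz₂ hq₁ hz₁ hq₂
  let e : (stermComplex.{u} hz hq).sc' i j k ≅ ShortComplex.mk _ _
      (stermD_comp_stermD.{u} (r i) (r j) (r k) hz₂.le hq₁.le hz₁.le hq₂.le) :=
    ShortComplex.isoMk (Iso.refl _) (Iso.refl _) (Iso.refl _)
      ((Category.id_comp (stermD (r i) (r j) hz₂.le hq₁.le)).trans
        ((stermComplex_d hz hq hij).symm.trans (Category.comp_id _).symm))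
      ((Category.id_comp (stermD (r j) (r k) hz₁.le hq₂.le)).trans
        ((stermComplex_d hz hq hjk).symm.trans (Category.comp_id _).symm))
  exact ⟨ShortComplex.homologyMapIso ((stermComplex.{u} hz hq).isoSc' i j k
    (ComplexShape.prev_eq' _ hij) (ComplexShape.next_eq' _ hjk) ≪≫ e) ≪≫ D.homologyIso⟩

end Complex

/-! ### Representatives in the complex and its homology -/

namespace Step

variable {n : ℕ} {w : List (Step n)} {j : Fin n}

lemma height_top_append_fin_pos (hg : Good (w ++ [fin j])) :
    0 < height (w ++ [fin j]) (top (w ++ [fin j])) := by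
  have hw := good_append_fin.1 hg
  have h₁ : delta w j ∈ B (w ++ [fin j]) :=
    (mem_B_append_fin hg).2 (Or.inr (by rw [sub_self]; exact zero_mem_B w))
  have h₂ := height_delta hg (k := j) (by simpa using hw.2)
  have h₃ := delta_append_replicate hw.1 hw.2 1
  rw [List.replicate_one] at h₃
  have h₄ := height_le_of_mem_B hg h₁
  rw [← h₃, h₂] at h₄
  omega

lemma chainQuad_eq_shift {hpos : 0 < height w (top w)} (P : Zn n) :
    chainQuad w hpos P = (chainQuad w hpos 0).shift P := by
  simp only [chainQuad, Quad.shift, shiftLower_shiftLower, zero_add, add_zero,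
    sub_eq_add_neg]

/-- The only elements of B_ω + δ^j outside B_ω that could be joined to B_ω are a^j modulo V_ω, and
these form the removed top level. The set B_ω survives entirely, since adding δ^j to any of its
elements stays in B_{ω*j} and raises the height by 1. -/
lemma componentsMeeting_eq_B (hg : Good (w ++ [fin j])) :
    componentsMeeting {x | x ∈ B (w ++ [fin j]) ∧ height (w ++ [fin j]) x <
      height (w ++ [fin j]) (top (w ++ [fin j]))} {x | x ∈ V w} = B w := by
  have hw := good_append_fin.1 hg
  have hδ : height (w ++ [fin j]) (delta w j) = 1 := by
    have h₂ := height_delta hg (k := j) (by simpa using hw.2)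
    have h₃ := delta_append_replicate hw.1 hw.2 1
    rw [List.replicate_one] at h₃
    rwa [h₃] at h₂
  refine componentsMeeting_eq (fun v hv => mem_B_of_mem_V hv) (fun v hv => ?_)
    ⟨0, (V w).zero_mem⟩ (comparablyConnected_B hw.1) fun v hv u hu huv => ?_
  · refine ⟨(mem_B_append_fin hg).2 (Or.inl hv), ?_⟩
    have := height_le_of_mem_B hg ((mem_B_append_fin hg (x := v + delta w j)).2
      (Or.inr (by rwa [add_sub_cancel_right])))
    rw [map_add, hδ] at this
    omega
  · rcases (mem_B_append_fin hg).1 hu.1 with h | h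
    · exact h
    · refine (mem_B_or_mem_V_of_comparable hw.1 hw.2 hv h huv).resolve_right fun h' => ?_
      rw [sub_sub, ← top_append_fin hg, ← V_append_fin (j := j)] at h'
      have := height_eq_zero_of_mem_V h'
      rw [map_sub] at this
      have := hu.2
      omega

lemma setOf_mem_V_eq_neg : {x | x ∈ V w} = {x | -x ∈ {x | x ∈ V w}} :=
  Set.ext fun v => (neg_mem_iff (H := V w) (x := v)).symm

/-- The quadruple is cut from the periodic set of ω*j but represents ω: b \ q and p \ z are B_{ω*j}
and its negative without their extreme levels opposite to V_ω, and `componentsMeeting_eq_B` extracts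
B_ω from them. -/
lemma chainQuad_represents (hg : Good (w ++ [fin j])) (P : Zn n) :
    (chainQuad (w ++ [fin j]) (height_top_append_fin_pos hg) P).Represents P (toWord w) := by
  have hw := good_append_fin.1 hg
  suffices h : (chainQuad (w ++ [fin j]) (height_top_append_fin_pos hg) 0).Represents 0
      (toWord w) by
    have := h.shift P
    rwa [zero_add, ← chainQuad_eq_shift] at this
  rw [Quad.represents_iff, B_toWord hw.1, Quad.zSet, Quad.bSet]
  simp only [chainQuad, zero_add, zero_sub, shiftLower_zero, sub_zero]
  rw [chainP_sdiff_shift_chainP hg, chainP_sdiff_chainQ hg, shift_chainQ_sdiff_chainQ hg,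
    V_append_fin, componentsMeeting_eq_B hg]
  refine ⟨?_, rfl⟩
  rw [setOf_mem_V_eq_neg, componentsMeeting_neg, componentsMeeting_eq_B hg]

/-- Homology takes b from p of the preceding term and z from q of the following one. This adds
precisely the missing extreme levels, so b \ q and p \ z become P + B_w and P - B_w. -/
lemma homologyQuad_represents (hg : Good w) (hpos : 0 < height w (top w))
    {x₁ x₂ x₃ : Quad (Downsets n)} {P : Zn n} (h₁ : x₁ = chainQuad w hpos (P + top w))
    (h₂ : x₂ = chainQuad w hpos P) (h₃ : x₃ = chainQuad w hpos (P - top w))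
    (hz : x₂.z = x₃.p) (hq : x₁.q = x₂.b) :
    (homologyQuad x₁ x₂ x₃ hz hq).Represents P (toWord w) := by
  subst h₁ h₂ h₃
  have H := profile_B hg
  have h0 : (⟨shiftLower (top w) (chainP w), chainP w, chainQ w, shiftLower (-top w) (chainQ w),
      (chainP_le_shift_chainQ hpos).trans (shiftLower_mono _ chainQ_le_chainP),
      chainQ_le_chainP, (shiftLower_mono _ chainQ_le_chainP).trans
        (shift_chainP_le_chainQ hpos)⟩ : Quad (Downsets n)).Represents 0 (toWord w) := by
    rw [Quad.represents_iff, B_toWord hg, Quad.zSet, Quad.bSet]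
    simp only [zero_sub, sub_zero]
    rw [shift_chainP_sdiff_chainQ hg, chainP_sdiff_shift_chainQ hg, chainP_sdiff_chainQ hg]
    exact ⟨H.componentsMeeting_neg_eq_self, H.componentsMeeting_eq_self⟩
  have := h0.shift P
  rw [zero_add] at this
  convert this using 1
  simp only [homologyQuad, chainQuad, Quad.shift, shiftLower_shiftLower, sub_eq_add_neg]

end Step

/-! ### Assembly of the complex -/

section Main

variable {n : ℕ}

open Step

theorem exists_complex {w : List (Step n)} (hw : Good w) {j : Fin n} (hj : ext j ∉ w) :
    ∃ (r : Zn n ⧸ (toWord w).V → Quad (Downsets n))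
      (K : HomologicalComplex (ExcisiveSystems.{u} n ⥤ AddCommGrpCat.{u})
        (ComplexShape.down' (QuotientAddGroup.mk ((toWord w).dir j) : Zn n ⧸ (toWord w).V)))
      (φ : ∀ Q : Zn n ⧸ (toWord w).V, K.X Q ≅ Sterm.{u} (r Q)),
      (∀ P : Zn n, (r (QuotientAddGroup.mk P)).Represents P (toWord w)) ∧
      (∀ P : Zn n, IsSpectralDifferential.{u}
        (r (QuotientAddGroup.mk (P + (toWord w).dir j))) (r (QuotientAddGroup.mk P))
        ((φ (QuotientAddGroup.mk (P + (toWord w).dir j))).inv ≫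
          K.d (QuotientAddGroup.mk (P + (toWord w).dir j)) (QuotientAddGroup.mk P) ≫
          (φ (QuotientAddGroup.mk P)).hom)) ∧
      (∀ (P : Zn n) (y : Quad (Downsets n)), y.Represents P (toWord w ++ [Letter.fin j]) →
        Nonempty (K.homology (QuotientAddGroup.mk P) ≅ Sterm.{u} y)) := by
  have hg : Good (w ++ [fin j]) := good_append_fin.2 ⟨hw, hj⟩
  have hpos := height_top_append_fin_pos hg
  have htop : (toWord w).dir j = top (w ++ [fin j]) := by
    rw [dir_toWord hw hj, top_append_fin hg]
  let r : Zn n ⧸ (toWord w).V → Quad (Downsets n) := fun Q =>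
    chainQuad (w ++ [fin j]) hpos Q.out
  -- The quadruples themselves, not merely their S-terms, are invariant under V_ω, so the arbitrary
  -- choice of `Q.out` is harmless and the matching conditions on z, p, q, b hold as equalities.
  have hr : ∀ P : Zn n, r (QuotientAddGroup.mk P) = chainQuad (w ++ [fin j]) hpos P := by
    intro P
    have h : -P + (QuotientAddGroup.mk P : Zn n ⧸ (toWord w).V).out ∈ (toWord w).V :=
      QuotientAddGroup.eq.1 (Quotient.out_eq' _).symm
    have h' : -P + (QuotientAddGroup.mk P : Zn n ⧸ (toWord w).V).out ∈ V (w ++ [fin j]) := by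
      rw [V_append_fin, ← V_toWord hw]
      exact h
    have := chainQuad_add_of_mem_V (hpos := hpos) P h'
    rw [add_neg_cancel_left] at this
    exact this
  have hz : ∀ Q, (r (Q + QuotientAddGroup.mk ((toWord w).dir j))).z = (r Q).p := by
    intro Q
    induction Q using QuotientAddGroup.induction_on with
    | H P =>
      rw [← QuotientAddGroup.mk_add, hr, hr, htop]
      simp only [chainQuad, add_sub_cancel_right]
  have hq : ∀ Q, (r (Q + QuotientAddGroup.mk ((toWord w).dir j))).q = (r Q).b := by
    intro Q
    induction Q using QuotientAddGroup.induction_on with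
    | H P =>
      rw [← QuotientAddGroup.mk_add, hr, hr, htop]
      rfl
  refine ⟨r, stermComplex hz hq, fun Q => Iso.refl _, fun P => ?_, fun P => ?_, fun P y hy => ?_⟩
  · rw [hr]
    exact chainQuad_represents hg P
  · rw [stermComplex_d hz hq (QuotientAddGroup.mk_add _ _ _).symm]
    change IsSpectralDifferential _ _ (𝟙 _ ≫ stermD _ _ _ _ ≫ 𝟙 _)
    rw [Category.id_comp, Category.comp_id]
    exact isSpectralDifferential_stermD _ _ _ _
  · have h₁ := hz (QuotientAddGroup.mk (P - (toWord w).dir j))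
    rw [← QuotientAddGroup.mk_add, sub_add_cancel] at h₁
    have h₂ := hq (QuotientAddGroup.mk P)
    rw [← QuotientAddGroup.mk_add] at h₂
    obtain ⟨e⟩ := nonempty_stermComplex_homology_iso.{u} hz hq
      (i := QuotientAddGroup.mk (P + (toWord w).dir j))
      (j := QuotientAddGroup.mk P) (k := QuotientAddGroup.mk (P - (toWord w).dir j))
      (QuotientAddGroup.mk_add _ _ _).symm
      (by rw [← QuotientAddGroup.mk_add, sub_add_cancel]) h₁ h₂
    have h₃ := homologyQuad_represents hg hpos (P := P) (by rw [hr, htop]) (hr P)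
      (by rw [hr, htop]) h₁ h₂
    rw [toWord_append_fin] at h₃
    obtain ⟨e'⟩ := h₃.nonempty_iso.{u} hy
    exact ⟨e ≪≫ e'⟩

end Main

theorem theorem1 (n : ℕ) :
    -- the terms `S(P;ω)` are well-defined up to natural isomorphism, and only depend on `P + V_ω`
    (∀ ω : Word n, ω.Admissible →
      (∀ P : Zn n, ∃ x : Quad (Downsets n), x.Represents P ω) ∧
      (∀ (P : Zn n) (x y : Quad (Downsets n)), x.Represents P ω → y.Represents P ω →
        Nonempty (Sterm.{u} x ≅ Sterm.{u} y)) ∧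
      (∀ (P P' : Zn n) (x : Quad (Downsets n)), P - P' ∈ ω.V →
        (x.Represents P ω ↔ x.Represents P' ω))) ∧
    -- (a)
    (∀ (P : Zn n) (x : Quad (Downsets n)), x.Represents P [] →
      ∀ (p q : Downsets n) (h : q ≤ p), P ∉ q → (p : Set (Zn n)) = (q : Set (Zn n)) ∪ {P} →
        Nonempty (Sterm.{u} x ≅ entry.{u} p q h)) ∧
    -- (b)
    (∀ ω : Word n, ω.Final →
      ω.V = ⊤ ∧
      ∀ (P : Zn n) (x : Quad (Downsets n)), x.Represents P ω →
        Nonempty (Sterm.{u} x ≅ entry.{u} (⊤ : Downsets n) ⊥ bot_le)) ∧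
    (∀ (ω : Word n) (j : Fin n), ω.Admissible → Word.Admissible (ω ++ [Letter.fin j]) →
      -- (c)
      (∃ (r : Zn n ⧸ ω.V → Quad (Downsets n))
        (K : HomologicalComplex (ExcisiveSystems.{u} n ⥤ AddCommGrpCat.{u})
          (ComplexShape.down' (QuotientAddGroup.mk (ω.dir j) : Zn n ⧸ ω.V)))
        (φ : ∀ Q : Zn n ⧸ ω.V, K.X Q ≅ Sterm.{u} (r Q)),
        (∀ P : Zn n, (r (QuotientAddGroup.mk P)).Represents P ω) ∧
        (∀ P : Zn n, IsSpectralDifferential.{u}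
          (r (QuotientAddGroup.mk (P + ω.dir j))) (r (QuotientAddGroup.mk P))
          ((φ (QuotientAddGroup.mk (P + ω.dir j))).inv ≫
            K.d (QuotientAddGroup.mk (P + ω.dir j)) (QuotientAddGroup.mk P) ≫
            (φ (QuotientAddGroup.mk P)).hom)) ∧
        (∀ (P : Zn n) (y : Quad (Downsets n)), y.Represents P (ω ++ [Letter.fin j]) →
          Nonempty (K.homology (QuotientAddGroup.mk P) ≅ Sterm.{u} y))) ∧
      -- (d)
      (∀ (P : Zn n) (k : ℕ) (x y : Quad (Downsets n)),
        x.Represents P (ω ++ [Letter.inf j]) →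
        y.Represents P (ω ++ List.replicate k (Letter.fin j)) →
        IsNaturalSubquotient (Sterm.{u} x) (Sterm.{u} y)) ∧
      -- (e)
      (∀ (P : Zn n) (x : Quad (Downsets n)),
        x.Represents P (ω ++ [Letter.inf j, Letter.ext]) →
        ∃ F : ℤ →o Subobject (Sterm.{u} x),
          ∀ (i : ℤ) (y : Quad (Downsets n)),
            y.Represents (P + i • ω.delta j) (ω ++ [Letter.inf j]) →
            Nonempty (cokernel (Subobject.ofLE (F (i - 1)) (F i)
              (F.monotone (sub_le_self i zero_le_one))) ≅ Sterm.{u} y))) := by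
  refine ⟨fun ω hω => ⟨exists_represents hω, fun P x y hx hy => hx.nonempty_iso hy,
      fun P P' x h => represents_iff_of_sub_mem hω h x⟩,
    fun P x hx p q h hP hpq => nonempty_iso_entry_of_represents_nil hx h hP hpq,
    fun ω hω => ⟨final_V_eq_top hω, fun P x hx => nonempty_iso_entry_of_final hω hx⟩,
    fun ω j hω hωj => ?_⟩
  -- Since j may follow ω, the word ω does not end in some i^∞ without ext, hence is a list of
  -- steps, and j^∞ does not occur in it.
  obtain ⟨w, hw, hj, rfl⟩ := Step.exists_eq_toWord_of_append_fin hωj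
  refine ⟨exists_complex hw hj,
    fun P k x y hx hy => isNaturalSubquotient_of_represents hw hj hx hy, fun P x hx => ?_⟩
  rw [Step.delta_toWord hw]
  exact exists_filtration_of_represents hw hj hx
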